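/- Let $d\ge 1$ and $\alpha\ge 1$ be integers, and let $X_1,X_2,\dots$ be i.i.d. $\mathbb Z^d$-valued random variables, with no moment assumptions, which are genuinely $d$-dimensional: the set of $z\in\mathbb Z^d$ with $\mathbb P(X_1-X_2=z)>0$ spans $\mathbb R^d$ linearly. Put $S_n=\sum_{j=1}^n X_j$, $l(n,x)=\#\{1\le j\le n: S_j=x\}$ and $L_n(\alpha)=\sum_{x\in\mathbb Z^d} l(n,x)^\alpha$, and let $L_n(\alpha|\epsilon,d)$ be the same quantity for the simple random walk in $\mathbb Z^d$ (i.i.d. steps, equal to each of $\pm e_1,\dots,\pm e_d$ with probability $1/(2d)$). Let $v_{1,\alpha}(n)=n^{1+\alpha}$, $v_{2,\alpha}(n)=n^2(\log n)^{2\alpha-4}$, $v_{3,\alpha}(n)=n\log n$ and $v_{d,\alpha}(n)=n$ for $d\ge 4$ (with the conventions $v_{2,\alpha}(0)=v_{3,\alpha}(0)=0$, $v_{2,2}(1)=1$ and $v_{2,1}(1)=0$). Then there are constants $c,C>0$, depending only on $d$, $\alpha$ and the law of $X_1$, such that $$\operatorname{Var}(L_n(\alpha))\le c\,\operatorname{Var}(L_n(\alpha|\epsilon,d))\le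 C\,v_{d,\alpha}(n)$$ for every integer $n\ge 0$ with $n\ne 2$. For $n=2$ the second inequality and the bound $\operatorname{Var}(L_n(\alpha))\le C\,v_{d,\alpha}(n)$ still hold, with the same constants. -/

import Mathlib

open MeasureTheory ProbabilityTheory

noncomputable section

namespace RandomWalk

variable {d : ℕ} {Ω : Type*}

/-- The random walk `S_n`, started at the origin, whose `(j + 1)`-st increment is `X j`. -/
def walk (X : ℕ → Ω → (Fin d → ℤ)) (n : ℕ) (ω : Ω) : Fin d → ℤ :=
  ∑ j ∈ Finset.range n, X j ω

/-- The local time `l(n, x)`: the number of `j ∈ {1, …, n}` with `S_j = x`. -/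
def localTime (X : ℕ → Ω → (Fin d → ℤ)) (n : ℕ) (x : Fin d → ℤ) (ω : Ω) : ℕ :=
  ((Finset.Icc 1 n).filter (fun j => walk X j ω = x)).card

/-- The `α`-fold self-intersection local time `L_n(α) = ∑ₓ l(n, x) ^ α`.
For `α ≥ 1` only finitely many terms are nonzero. -/
def selfIntersection (X : ℕ → Ω → (Fin d → ℤ)) (α n : ℕ) (ω : Ω) : ℝ :=
  ∑' x : Fin d → ℤ, (localTime X n x ω : ℝ) ^ α

/-- `X` is a sequence of independent, identically distributed random vectors in `ℤ^d`. -/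
structure IsIID [MeasurableSpace Ω] (X : ℕ → Ω → (Fin d → ℤ)) (P : Measure Ω) : Prop where
  measurable : ∀ j, Measurable (X j)
  indep : iIndepFun X P
  identDistrib : ∀ j, IdentDistrib (X j) (X 0) P P

/-- The set of values that the difference of the first two increments takes with positive
probability, as vectors of `ℝ^d`, spans `ℝ^d`. -/
def IsGenuinelyDimensional [MeasurableSpace Ω] (X : ℕ → Ω → (Fin d → ℤ))
    (P : Measure Ω) : Prop :=
  Submodule.span ℝ
    {v : Fin d → ℝ | ∃ z : Fin d → ℤ, P {ω | X 0 ω - X 1 ω = z} ≠ 0 ∧ v = fun i => (z i : ℝ)} = ⊤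

/-- The step law of the simple random walk in `ℤ^d`: mass `1 / (2 d)` at each of `± e_k`. -/
def simpleStep (d : ℕ) : Measure (Fin d → ℤ) :=
  (2 * (d : ENNReal))⁻¹ •
    ∑ k : Fin d, (Measure.dirac (Pi.single k (1 : ℤ)) + Measure.dirac (-Pi.single k (1 : ℤ)))

instance isProbabilityMeasure_simpleStep (d : ℕ) [NeZero d] :
    IsProbabilityMeasure (simpleStep d) := by
  constructor
  have h0 : (2 * (d : ENNReal)) ≠ 0 := by simp [NeZero.ne d]
  have h1 : (2 * (d : ENNReal)) ≠ ⊤ := ENNReal.mul_ne_top (by simp) (by simp)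
  have h : (1 + 1 : ENNReal) = 2 := by norm_num
  simp only [simpleStep, Measure.smul_apply, Measure.finsetSum_apply, Measure.add_apply,
    measure_univ, h, Finset.sum_const, Finset.card_univ, Fintype.card_fin, nsmul_eq_mul,
    smul_eq_mul]
  rw [mul_comm (d : ENNReal) 2]
  exact ENNReal.inv_mul_cancel h0 h1

/-- The law of the sequence of increments of the simple random walk in `ℤ^d`: independent steps,
each with law `simpleStep d`. -/
def simpleLaw (d : ℕ) [NeZero d] : Measure (ℕ → (Fin d → ℤ)) :=
  Measure.infinitePi (fun _ : ℕ => simpleStep d)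

/-- The increments of the simple random walk: the coordinates of `ℕ → ℤ^d`, under
`simpleLaw d`. -/
def simpleIncrement (d : ℕ) (j : ℕ) (ω : ℕ → (Fin d → ℤ)) : Fin d → ℤ := ω j

/-- The order `v_{d,α}(n)`. The exponent of the logarithm is an integer, negative if `α = 1`. -/
def varianceOrder (d α n : ℕ) : ℝ :=
  if d = 1 then (n : ℝ) ^ (1 + α)
  else if d = 2 then (n : ℝ) ^ 2 * Real.log n ^ (2 * (α : ℤ) - 4)
  else if d = 3 then (n : ℝ) * Real.log n
  else (n : ℝ)

end RandomWalk

end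

/-! Expanding the power, `L_n(α)` counts the families `f` of `α` times in `{1, …, n}` at which the
walk is at one common place (`selfIntersection_eq_card`). Write `P(f)` for the probability of this
coincidence and `P(f, g)` for a joint one. Both the upper and the lower bound rest on this count.

Upper bound. The variance is the sum over pairs of `P(f, g) - P(f) P(g)`. If `f` lies entirely
before `g`, independence makes the term vanish. If `g` lies in one gap of `f`, the time span of `g`
is a loop and can be cut out: `P(f, g) = P(f') P(g)` with `f'` the shortened family
(`coProb₂_of_nested`). Since `f ↦ f'` is injective for fixed `g`, and `(f', g)` is either again
nested or crossing, the nested joint probabilities are absorbed by the nested products up to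
products over crossing pairs (`sum_nested_le`). No regularity of the transition probabilities is
needed for this cancellation. What remains are pairs that share a time and pairs that alternate as
`f, g, f, g` (`sum_coProb₂_le`). A crossing with successive gaps `a, b, c` forces displacements `z,
-z, z`, so it costs at most the least pairwise product of `β a, β b, β c`, where `β` bounds the
transition probabilities; the remaining times contribute moments of local times, that is, powers of
`∑ β` (`lintegral_crossInd_mul_returns_mul_le`).

For every genuinely `d`-dimensional law one may take `β m = C (m + 1) ^ (-d / 2)`
(`IsGenuine.exists_stepProb_le`). This comes from Fourier inversion and from the law of `X₁ - X₂`,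
whose atoms include a basis of `ℝ^d`; neither moments nor aperiodicity enter. Summing the profile
gives `v_{d,α}(n)` (`exists_decay_bound_le_varianceOrder`).

Lower bound for the simple random walk. The inner products of two different increments `a < b` are
centred, uncorrelated and bounded by one, so Bessel's inequality bounds the variance below by the
sum of the squared correlations of `L_n(α)` with them. The correlation of a single coincidence event
is zero by a reflection unless `a` and `b` lie in the same gap `[u, v)` of `f`; then
exchangeability, together with the fact that the increments of the gap sum to zero, gives exactly
`-P(f) / (v - u - 1)` (`IsUnitSymmetric.integral_coReal_mul_dot_of_gap`). All signs agree, so a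
convenient subfamily of `f` suffices. With `p_{2m}(0) ≥ c (m + 1) ^ (-d / 2)`
(`IsUnitSymmetric.decay_le_returnProb`), the pair `(a, a + D)` has correlation at least of order `D
^ (1 - d / 2) G ^ (α - 2)`, where `G` is the expected number of returns up to time `n / 4`; squaring
and summing over `a` and `D` gives `v_{d,α}(n)` again.

For `α = 1` or `n ≤ 1` the count is deterministic. At `n = 2` the simple random walk cannot be at
one place twice, so its variance vanishes; for `n ≥ 3` it is positive. -/

/-! ### The path space -/

noncomputable section

namespace RandomWalk

variable {d : ℕ}

/-- The position at time `n` of the walk from the origin with increments `ω`. -/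
def pos (n : ℕ) (ω : ℕ → Fin d → ℤ) : Fin d → ℤ := ∑ j ∈ Finset.range n, ω j

/-- The law of a sequence of independent increments with common law `μ`. -/
def pathLaw (μ : Measure (Fin d → ℤ)) [IsProbabilityMeasure μ] : Measure (ℕ → Fin d → ℤ) :=
  Measure.infinitePi (fun _ : ℕ => μ)

instance isProbabilityMeasure_pathLaw (μ : Measure (Fin d → ℤ)) [IsProbabilityMeasure μ] :
    IsProbabilityMeasure (pathLaw μ) := by unfold pathLaw; infer_instance

/-- The increment sequence that follows `ω` for `s` steps and continues with `ω'`. -/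
def glue (s : ℕ) (ω ω' : ℕ → Fin d → ℤ) (j : ℕ) : Fin d → ℤ := if j < s then ω j else ω' (j - s)

@[fun_prop]
theorem measurable_pos (n : ℕ) : Measurable (pos n : (ℕ → Fin d → ℤ) → Fin d → ℤ) := by
  unfold pos; fun_prop

@[fun_prop]
theorem Measurable.pos {A : Type*} [MeasurableSpace A] {f : A → ℕ → Fin d → ℤ} (hf : Measurable f)
    (n : ℕ) : Measurable (fun a => pos n (f a)) := (measurable_pos n).comp hf

@[fun_prop]
theorem Measurable.glue {A : Type*} [MeasurableSpace A] {f g : A → ℕ → Fin d → ℤ}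
    (hf : Measurable f) (hg : Measurable g) (s : ℕ) :
    Measurable (fun a => glue s (f a) (g a)) := by
  refine measurable_pi_lambda _ fun j => ?_
  unfold RandomWalk.glue
  split_ifs
  · exact (measurable_pi_apply j).comp hf
  · exact (measurable_pi_apply (j - s)).comp hg

@[simp] theorem pos_zero (ω : ℕ → Fin d → ℤ) : pos 0 ω = 0 := by simp [pos]

theorem pos_succ (n : ℕ) (ω : ℕ → Fin d → ℤ) : pos (n + 1) ω = pos n ω + ω n := by
  simp [pos, Finset.sum_range_succ]

theorem pos_glue_of_le {s j : ℕ} (h : j ≤ s) (ω ω' : ℕ → Fin d → ℤ) :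
    pos j (glue s ω ω') = pos j ω := by
  refine Finset.sum_congr rfl fun i hi => ?_
  simp [glue, (Finset.mem_range.1 hi).trans_le h]

theorem pos_glue_add (s j : ℕ) (ω ω' : ℕ → Fin d → ℤ) :
    pos (s + j) (glue s ω ω') = pos s ω + pos j ω' := by
  unfold pos
  rw [Finset.sum_range_add]
  congr 1
  · exact pos_glue_of_le le_rfl ω ω'
  · refine Finset.sum_congr rfl fun i _ => ?_
    simp [glue]

theorem pos_glue_of_ge {s j : ℕ} (h : s ≤ j) (ω ω' : ℕ → Fin d → ℤ) :
    pos j (glue s ω ω') = pos s ω + pos (j - s) ω' := by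
  obtain ⟨k, rfl⟩ := Nat.exists_eq_add_of_le h
  rw [pos_glue_add]; simp

variable (μ : Measure (Fin d → ℤ)) [IsProbabilityMeasure μ]

/-- The Markov property at a fixed time. A box in finitely many coordinates pulls back to a product
of two boxes, one in the coordinates below `s` and one in the others shifted by `s`; this determines
an infinite product measure. -/
theorem map_glue (s : ℕ) :
    ((pathLaw μ).prod (pathLaw μ)).map (fun p => glue s p.1 p.2) = pathLaw μ := by
  classical
  refine Measure.eq_infinitePi (fun _ => μ) fun I t ht => ?_
  rw [Measure.map_apply (by fun_prop) (MeasurableSet.pi I.countable_toSet fun i _ => ht i)]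
  have hset : (fun p : (ℕ → Fin d → ℤ) × (ℕ → Fin d → ℤ) => glue s p.1 p.2) ⁻¹' (Set.pi I t) =
      (Set.pi (I.filter (· < s)) t) ×ˢ
        (Set.pi ((I.filter (fun i => ¬ i < s)).image (· - s)) (fun j => t (j + s))) := by
    ext p
    simp only [Set.mem_preimage, Set.mem_pi, Set.mem_prod, Finset.coe_filter, Finset.mem_coe,
      Finset.coe_image, Set.mem_image, Set.mem_ofPred_eq, glue]
    constructor
    · intro h
      refine ⟨fun i hi => by simpa [hi.2] using h i hi.1, ?_⟩
      rintro _ ⟨i, hi, rfl⟩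
      have := h i hi.1
      rw [if_neg hi.2] at this
      rwa [Nat.sub_add_cancel (not_lt.1 hi.2)]
    · rintro ⟨h1, h2⟩ i hi
      split_ifs with hs
      · exact h1 i ⟨hi, hs⟩
      · have := h2 (i - s) ⟨i, ⟨hi, hs⟩, rfl⟩
        rwa [Nat.sub_add_cancel (not_lt.1 hs)] at this
  rw [hset, Measure.prod_prod, pathLaw, Measure.infinitePi_pi _ (fun i _ => ht i),
    Measure.infinitePi_pi _ (fun i _ => ht _), ← Finset.prod_filter_mul_prod_filter_not I (· < s)]
  congr 1
  rw [Finset.prod_image]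
  · refine Finset.prod_congr rfl fun i hi => ?_
    rw [Nat.sub_add_cancel (not_lt.1 (Finset.mem_filter.1 hi).2)]
  · intro i hi j hj hij
    have h1 := not_lt.1 (Finset.mem_filter.1 hi).2
    have h2 := not_lt.1 (Finset.mem_filter.1 hj).2
    simp only at hij
    omega

theorem lintegral_glue (s : ℕ) {F : (ℕ → Fin d → ℤ) → ENNReal} (hF : Measurable F) :
    ∫⁻ ω, F ω ∂pathLaw μ = ∫⁻ ω, ∫⁻ ω', F (glue s ω ω') ∂pathLaw μ ∂pathLaw μ := by
  conv_lhs => rw [← map_glue μ s]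
  rw [lintegral_map hF (by fun_prop), lintegral_prod]
  exact (hF.comp (by fun_prop)).aemeasurable

/-- Exchangeability of the increments, used for time reversal and for transposing two increments. -/
theorem map_comp_injective {σ : ℕ → ℕ} (hσ : Function.Injective σ) :
    (pathLaw μ).map (fun ω j => ω (σ j)) = pathLaw μ := 
  Measure.map_infinitePi_infinitePi_of_inj hσ

theorem lintegral_comp_injective {σ : ℕ → ℕ} (hσ : Function.Injective σ)
    {F : (ℕ → Fin d → ℤ) → ENNReal} (hF : Measurable F) :
    ∫⁻ ω, F (fun j => ω (σ j)) ∂pathLaw μ = ∫⁻ ω, F ω ∂pathLaw μ := by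
  conv_rhs => rw [← map_comp_injective μ hσ]
  rw [lintegral_map hF (by fun_prop)]

/-- The involution of the time set that reverses `{0, …, a - 1}`. -/
def revTime (a j : ℕ) : ℕ := if j < a then a - 1 - j else j

theorem revTime_injective (a : ℕ) : Function.Injective (revTime a) := by
  intro i j h
  unfold revTime at h
  split_ifs at h <;> omega

theorem pos_revTime {a j : ℕ} (h : j ≤ a) (ω : ℕ → Fin d → ℤ) :
    pos j (fun i => ω (revTime a i)) = pos a ω - pos (a - j) ω := by
  induction j with
  | zero => simp
  | succ k ih =>
    rw [pos_succ, ih (by omega)]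
    have : a - k = (a - (k + 1)) + 1 := by omega
    rw [this, pos_succ]
    have : revTime a k = a - (k + 1) := by unfold revTime; split_ifs <;> omega
    rw [this]; abel

/-- The indicator of `x = y`. -/
def ind (x y : Fin d → ℤ) : ENNReal := if x = y then 1 else 0

@[fun_prop]
theorem Measurable.ind {A : Type*} [MeasurableSpace A] {f g : A → Fin d → ℤ}
    (hf : Measurable f) (hg : Measurable g) : Measurable (fun a => ind (f a) (g a)) :=
  Measurable.ite (measurableSet_eq_fun hf hg) measurable_const measurable_const

theorem ind_le_one (x y : Fin d → ℤ) : ind x y ≤ 1 := by unfold ind; split_ifs <;> simp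

theorem ind_comm (x y : Fin d → ℤ) : ind x y = ind y x := by simp [ind, eq_comm]

theorem ind_congr {x y x' y' : Fin d → ℤ} (h : x = y ↔ x' = y') : ind x y = ind x' y' := by
  simp [ind, h]

/-- The number of visits to `x` at the times `0, …, n`. -/
def visits (n : ℕ) (x : Fin d → ℤ) (ω : ℕ → Fin d → ℤ) : ENNReal :=
  ∑ j ∈ Finset.range (n + 1), ind (pos j ω) x

@[fun_prop]
theorem Measurable.visits {A : Type*} [MeasurableSpace A] {f : A → ℕ → Fin d → ℤ}
    {g : A → Fin d → ℤ} (hf : Measurable f) (hg : Measurable g) (n : ℕ) :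
    Measurable (fun a => visits n (g a) (f a)) := by
  unfold RandomWalk.visits; fun_prop

/-- The probability of being at `x` at time `n`. -/
def stepProb (n : ℕ) (x : Fin d → ℤ) : ENNReal := ∫⁻ ω, ind (pos n ω) x ∂pathLaw μ

end RandomWalk

end

/-! ### Moments of local times under a decay bound -/

noncomputable section

namespace RandomWalk

variable {d : ℕ}

/-- Each term is at most the largest one. The constant is not sharp, but only its independence of
`n` matters. -/
theorem sum_pow_le {ι : Type*} {s : Finset ι} (hs : s.Nonempty) (u : ι → ENNReal) (m : ℕ) :
    (∑ i ∈ s, u i) ^ m ≤ (s.card : ENNReal) ^ m * ∑ i ∈ s, u i ^ m := by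
  obtain ⟨i, hi, hmax⟩ := s.exists_max_image u hs
  calc (∑ i ∈ s, u i) ^ m ≤ (s.card * u i) ^ m := by
        gcongr
        simpa using Finset.sum_le_card_nsmul s u (u i) hmax
    _ = (s.card : ENNReal) ^ m * u i ^ m := mul_pow _ _ _
    _ ≤ _ := by
        gcongr
        exact Finset.single_le_sum (f := fun i => u i ^ m) (fun _ _ => zero_le) hi

theorem add_pow_le_two_pow (u v : ENNReal) (m : ℕ) : (u + v) ^ m ≤ 2 ^ m * (u ^ m + v ^ m) := by
  have := sum_pow_le Finset.univ_nonempty ![u, v] m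
  simpa using this

theorem add_one_pow_succ_le (T : ENNReal) (m : ℕ) :
    (1 + T) ^ (m + 1) ≤ T ^ (m + 1) + (m + 1) * (1 + T) ^ m := by
  induction m with
  | zero => simp [add_comm]
  | succ m ih =>
    calc (1 + T) ^ (m + 1 + 1) = (1 + T) ^ (m + 1) + T * (1 + T) ^ (m + 1) := by ring
      _ ≤ (1 + T) ^ (m + 1) + T * (T ^ (m + 1) + (m + 1) * (1 + T) ^ m) := by gcongr
      _ = T ^ (m + 1 + 1) + ((1 + T) ^ (m + 1) + (m + 1) * (T * (1 + T) ^ m)) := by ring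
      _ ≤ T ^ (m + 1 + 1) + ((1 + T) ^ (m + 1) + (m + 1) * ((1 + T) * (1 + T) ^ m)) := by
          gcongr; exact le_add_self
      _ = _ := by push_cast; ring

/-- A power of a sum of indicators, expanded according to the first nonzero term. -/
theorem sum_pow_succ_le_sum_mul_tail (N m : ℕ) (a : ℕ → ENNReal) (ha : ∀ i, a i = 0 ∨ a i = 1) :
    (∑ i ∈ Finset.range N, a i) ^ (m + 1) ≤
      (m + 1) * ∑ i ∈ Finset.range N, a i * (∑ j ∈ Finset.range (N - i), a (i + j)) ^ m := by
  induction N generalizing a with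
  | zero => simp
  | succ N ih =>
    have key := ih (fun i => a (i + 1)) (fun i => ha (i + 1))
    rw [Finset.sum_range_succ' (fun i => a i * _), Finset.sum_range_succ']
    have e : ∀ i j, a (i + 1 + j) = a (i + j + 1) := fun i j => by congr 1; omega
    simp only [Nat.add_sub_add_right, e, Nat.sub_zero, zero_add]
    rw [Finset.sum_range_succ' (fun j => a j)]
    -- If the first indicator is zero, nothing changes. If it is one, the growth from `T ^ (m + 1)`
    -- to `(1 + T) ^ (m + 1)` is paid for by the new term `i = 0`, whose tail is the whole sum `1 +
    -- T`.
    rcases ha 0 with h | h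
    · simpa [h] using key
    · rw [h, one_mul, mul_add]
      calc _ ≤ (∑ i ∈ Finset.range N, a (i + 1)) ^ (m + 1)
            + (m + 1) * (1 + ∑ i ∈ Finset.range N, a (i + 1)) ^ m := by
              rw [add_comm]; exact add_one_pow_succ_le _ m
        _ ≤ _ := by rw [add_comm 1]; gcongr

theorem ind_eq_zero_or_one (x y : Fin d → ℤ) : ind x y = 0 ∨ ind x y = 1 := by
  unfold ind; split_ifs <;> simp

/-- If `x = y` implies `u ≤ v`, then `ind x y * u ≤ ind x y * v`. -/
theorem ind_mul_le_ind_mul {x y : Fin d → ℤ} {u v : ENNReal} (h : x = y → u ≤ v) :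
    ind x y * u ≤ ind x y * v := by
  unfold ind; split_ifs with hxy
  · simpa using h hxy
  · simp

variable (μ : Measure (Fin d → ℤ)) [IsProbabilityMeasure μ]

/-- A doubling, antitone upper bound `β` for the transition probabilities. -/
structure IsDecayBound (β : ℕ → ENNReal) (κ : ENNReal) : Prop where
  stepProb_le : ∀ m x, stepProb μ m x ≤ β m
  antitone : Antitone β
  half_le : ∀ m, β (m / 2) ≤ κ * β m
  one_le : 1 ≤ κ

/-- The partial sums of `β`. -/
def partialSum (β : ℕ → ENNReal) (n : ℕ) : ENNReal := ∑ r ∈ Finset.range (n + 1), β r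

theorem partialSum_mono (β : ℕ → ENNReal) : Monotone (partialSum β) := fun _ _ h =>
  Finset.sum_le_sum_of_subset (Finset.range_mono (by omega))

variable {μ} {β : ℕ → ENNReal} {κ : ENNReal}

/-- Kac's moment argument: expand the power at the earliest visit used, at time `i`. From there the
walk restarts at `x`, so the later visits are visits to the origin of a fresh walk and the induction
hypothesis applies; summing `β i` gives one factor `partialSum β n`, and the choice of the earliest
visit gives the factorial. -/
theorem lintegral_visits_pow_le (hβ : ∀ m x, stepProb μ m x ≤ β m) (n m k : ℕ) (hk : k ≤ n)
    (x : Fin d → ℤ) :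
    ∫⁻ ω, visits k x ω ^ m ∂pathLaw μ ≤ m.factorial * partialSum β n ^ m := by
  induction m generalizing k x with
  | zero => simp
  | succ m ih =>
    calc ∫⁻ ω, visits k x ω ^ (m + 1) ∂pathLaw μ
        ≤ ∫⁻ ω, (m + 1) * ∑ i ∈ Finset.range (k + 1), ind (pos i ω) x *
            (∑ j ∈ Finset.range (k + 1 - i), ind (pos (i + j) ω) x) ^ m ∂pathLaw μ :=
          lintegral_mono fun ω => sum_pow_succ_le_sum_mul_tail _ _ _ fun i => ind_eq_zero_or_one _ _
      _ = (m + 1) * ∑ i ∈ Finset.range (k + 1), ∫⁻ ω, ind (pos i ω) x *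
            (∑ j ∈ Finset.range (k + 1 - i), ind (pos (i + j) ω) x) ^ m ∂pathLaw μ := by
          rw [lintegral_const_mul _ (by fun_prop), lintegral_finsetSum _ (fun i _ => by fun_prop)]
      _ ≤ (m + 1) * ∑ i ∈ Finset.range (k + 1), β i * (m.factorial * partialSum β n ^ m) := by
          gcongr with i hi
          have hi' := Finset.mem_range.1 hi
          rw [lintegral_glue μ i (by fun_prop)]
          calc _ ≤ ∫⁻ ω, ∫⁻ ω', ind (pos i ω) x * visits (k - i) 0 ω' ^ m
                  ∂pathLaw μ ∂pathLaw μ := by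
                refine lintegral_mono fun ω => lintegral_mono fun ω' => ?_
                simp only [pos_glue_add, pos_glue_of_le le_rfl]
                refine ind_mul_le_ind_mul fun h => ?_
                rw [h, visits, Nat.sub_add_comm (by omega)]
                gcongr with j hj
                exact (ind_congr (by simp)).le
            _ ≤ ∫⁻ ω, ind (pos i ω) x * (m.factorial * partialSum β n ^ m) ∂pathLaw μ := by
                refine lintegral_mono fun ω => ?_
                rw [lintegral_const_mul _ (by fun_prop)]
                gcongr
                exact ih _ (by omega) 0
            _ ≤ _ := by
                rw [lintegral_mul_const _ (by fun_prop)]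
                gcongr
                exact hβ i x
      _ ≤ _ := by
          rw [← Finset.sum_mul, Nat.factorial_succ]
          calc _ ≤ (m + 1) * (partialSum β n * (m.factorial * partialSum β n ^ m)) := by
                gcongr; exact partialSum_mono β hk
            _ = _ := by push_cast; ring

/-- The number of visits at the times `0, …, n` to the translate by `w` of the end point. -/
def endVisits (n : ℕ) (w : Fin d → ℤ) (ω : ℕ → Fin d → ℤ) : ENNReal :=
  ∑ j ∈ Finset.range (n + 1), ind (pos j ω) (pos n ω + w)

@[fun_prop]
theorem Measurable.endVisits {A : Type*} [MeasurableSpace A] {f : A → ℕ → Fin d → ℤ}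
    {g : A → Fin d → ℤ} (hf : Measurable f) (hg : Measurable g) (n : ℕ) :
    Measurable (fun a => endVisits n (g a) (f a)) := by
  unfold RandomWalk.endVisits; fun_prop

theorem pos_self_revTime (a : ℕ) (ω : ℕ → Fin d → ℤ) :
    pos a (fun i => ω (revTime a i)) = pos a ω := by
  rw [pos_revTime le_rfl]; simp

theorem endVisits_revTime (a : ℕ) (w : Fin d → ℤ) (ω : ℕ → Fin d → ℤ) :
    endVisits a w (fun i => ω (revTime a i)) = visits a (-w) ω := by
  unfold endVisits visits
  rw [← Finset.sum_range_reflect]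
  refine Finset.sum_congr rfl fun j hj => ?_
  have hj := Finset.mem_range.1 hj
  rw [pos_self_revTime, pos_revTime (by omega)]
  have : a - (a + 1 - 1 - j) = j := by omega
  rw [this]
  refine ind_congr ⟨fun h => ?_, fun h => by rw [h]; abel⟩
  rw [sub_eq_add_neg, add_right_inj] at h
  rw [← h, neg_neg]

theorem lintegral_endVisits_pow_le (hβ : ∀ m x, stepProb μ m x ≤ β m) (n m k : ℕ) (hk : k ≤ n)
    (w : Fin d → ℤ) :
    ∫⁻ ω, endVisits k w ω ^ m ∂pathLaw μ ≤ m.factorial * partialSum β n ^ m := by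
  rw [← lintegral_comp_injective μ (revTime_injective k) (by fun_prop)]
  simp only [endVisits_revTime]
  exact lintegral_visits_pow_le hβ n m k hk _

/-- Given the first `s` increments, the remaining `t` have to produce one prescribed displacement.
-/
theorem lintegral_weight_mul_ind_le (hβ : ∀ m x, stepProb μ m x ≤ β m) (s t : ℕ)
    {Φ : (ℕ → Fin d → ℤ) → ENNReal} (hΦ : Measurable Φ)
    (hdep : ∀ ω ω', Φ (glue s ω ω') = Φ ω) (z : Fin d → ℤ) :
    ∫⁻ ω, Φ ω * ind (pos (s + t) ω) z ∂pathLaw μ ≤ (∫⁻ ω, Φ ω ∂pathLaw μ) * β t := by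
  rw [lintegral_glue μ s (by fun_prop), ← lintegral_mul_const _ hΦ]
  refine lintegral_mono fun ω => ?_
  simp only [pos_glue_add, hdep]
  rw [lintegral_const_mul _ (by fun_prop)]
  gcongr
  refine le_trans (lintegral_mono fun ω' => ?_) (hβ t (z - pos s ω))
  exact (ind_congr (by rw [eq_sub_iff_add_eq, add_comm])).le

/-- The constant in the moment bounds for local times. -/
def momentConst (κ : ENNReal) (m : ℕ) : ENNReal := 2 * 2 ^ m * m.factorial * κ

theorem factorial_le_momentConst (hκ : 1 ≤ κ) (m : ℕ) : (m.factorial : ENNReal) ≤ momentConst κ m := by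
  unfold momentConst
  calc (m.factorial : ENNReal) = 1 * 1 * m.factorial * 1 := by ring
    _ ≤ _ := by gcongr <;> first | exact one_le_two | exact one_le_pow₀ one_le_two

theorem visits_le_add (h a : ℕ) (ha : h ≤ a) (x : Fin d → ℤ) (ω : ℕ → Fin d → ℤ) :
    visits a x ω ≤ visits h x ω + ∑ j ∈ Finset.range (a - h + 1), ind (pos (h + j) ω) x := by
  unfold visits
  have : a + 1 = h + (a - h + 1) := by omega
  rw [this, Finset.sum_range_add]
  gcongr
  omega

/-- Fixing the end point should cost only a factor `β a` in the moment bound. The time interval is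
halved: visits in one half leave the increments of the other half free to absorb the end point
constraint, and doubling turns `β (a / 2)` into `κ * β a`. -/
theorem lintegral_visits_pow_mul_ind_le (hβ : IsDecayBound μ β κ) (n m a : ℕ) (ha : a ≤ n)
    (z : Fin d → ℤ) :
    ∫⁻ ω, visits a 0 ω ^ m * ind (pos a ω) z ∂pathLaw μ ≤
      momentConst κ m * partialSum β n ^ m * β a := by
  set h := a / 2 with hh
  set V : (ℕ → Fin d → ℤ) → ENNReal := fun ω => ∑ j ∈ Finset.range (a - h + 1), ind (pos (h + j) ω) 0
    with hV
  have h1 : ∫⁻ ω, visits h 0 ω ^ m * ind (pos a ω) z ∂pathLaw μ ≤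
      m.factorial * partialSum β n ^ m * (κ * β a) := by
    have ea : a = h + (a - h) := by omega
    conv_lhs => rw [ea]
    refine (lintegral_weight_mul_ind_le hβ.stepProb_le h (a - h) (by fun_prop) ?_ z).trans ?_
    · intro ω ω'
      unfold visits
      congr 1
      refine Finset.sum_congr rfl fun j hj => ?_
      rw [pos_glue_of_le (by have := Finset.mem_range.1 hj; omega)]
    · gcongr
      · exact lintegral_visits_pow_le hβ.stepProb_le n m h (by omega) 0
      · exact (hβ.antitone (by omega)).trans (hβ.half_le a)
  have h2 : ∫⁻ ω, V ω ^ m * ind (pos a ω) z ∂pathLaw μ ≤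
      m.factorial * partialSum β n ^ m * (κ * β a) := by
    -- After reversal, the visits to the origin in the second half become visits to `z` during the
    -- first `a - h` steps, on the event that the walk ends at `z`.
    rw [← lintegral_comp_injective μ (revTime_injective a) (by fun_prop)]
    have ea : a = (a - h) + h := by omega
    calc _ ≤ ∫⁻ ω, visits (a - h) z ω ^ m * ind (pos a ω) z ∂pathLaw μ := by
          refine lintegral_mono fun ω => ?_
          rw [pos_self_revTime]
          rw [mul_comm, mul_comm _ (ind _ _)]
          refine ind_mul_le_ind_mul fun hz => ?_
          gcongr
          simp only [hV, visits]
          rw [← Finset.sum_range_reflect]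
          gcongr with j hj
          have hj := Finset.mem_range.1 hj
          rw [pos_revTime (by omega), hz]
          have : a - (h + (a - h + 1 - 1 - j)) = j := by omega
          rw [this]
          exact (ind_congr (by rw [sub_eq_zero, eq_comm])).le
      _ ≤ _ := by
          conv_lhs => enter [2, ω, 2]; rw [ea]
          refine (lintegral_weight_mul_ind_le hβ.stepProb_le (a - h) h (by fun_prop) ?_ z).trans ?_
          · intro ω ω'
            unfold visits
            congr 1
            refine Finset.sum_congr rfl fun j hj => ?_
            rw [pos_glue_of_le (by have := Finset.mem_range.1 hj; omega)]
          · gcongr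
            · exact lintegral_visits_pow_le hβ.stepProb_le n m _ (by omega) z
            · exact hβ.half_le a
  calc ∫⁻ ω, visits a 0 ω ^ m * ind (pos a ω) z ∂pathLaw μ
      ≤ ∫⁻ ω, 2 ^ m * (visits h 0 ω ^ m * ind (pos a ω) z + V ω ^ m * ind (pos a ω) z)
          ∂pathLaw μ := by
        refine lintegral_mono fun ω => ?_
        rw [← add_mul, ← mul_assoc]
        gcongr
        refine le_trans ?_ (add_pow_le_two_pow _ _ m)
        gcongr
        exact visits_le_add h a (by omega) 0 ω
    _ = 2 ^ m * (∫⁻ ω, visits h 0 ω ^ m * ind (pos a ω) z ∂pathLaw μ +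
          ∫⁻ ω, V ω ^ m * ind (pos a ω) z ∂pathLaw μ) := by
        rw [lintegral_const_mul _ (by fun_prop), lintegral_add_left (by fun_prop)]
    _ ≤ 2 ^ m * (m.factorial * partialSum β n ^ m * (κ * β a) +
          m.factorial * partialSum β n ^ m * (κ * β a)) := by gcongr
    _ = _ := by unfold momentConst; ring

theorem lintegral_endVisits_pow_mul_ind_le (hβ : IsDecayBound μ β κ) (n m a : ℕ) (ha : a ≤ n)
    (z : Fin d → ℤ) :
    ∫⁻ ω, endVisits a 0 ω ^ m * ind (pos a ω) z ∂pathLaw μ ≤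
      momentConst κ m * partialSum β n ^ m * β a := by
  rw [← lintegral_comp_injective μ (revTime_injective a) (by fun_prop)]
  simp only [endVisits_revTime, pos_self_revTime, neg_zero]
  exact lintegral_visits_pow_mul_ind_le hβ n m a ha z

end RandomWalk

end

/-! ### Return counts with weights -/

noncomputable section

namespace RandomWalk

variable {d : ℕ} {μ : Measure (Fin d → ℤ)} [IsProbabilityMeasure μ] {β : ℕ → ENNReal} {κ : ENNReal}

theorem lintegral_ind_pos_pos_le (hβ : ∀ m x, stepProb μ m x ≤ β m) (s r : ℕ) :
    ∫⁻ ω, ind (pos (s + r) ω) (pos s ω) ∂pathLaw μ ≤ β r := by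
  rw [lintegral_glue μ s (by fun_prop)]
  calc _ ≤ ∫⁻ _ : ℕ → Fin d → ℤ, β r ∂pathLaw μ := by
        refine lintegral_mono fun ω => le_trans (lintegral_mono fun ω' => ?_) (hβ r 0)
        rw [pos_glue_add, pos_glue_of_le le_rfl]
        exact (ind_congr (by simp)).le
    _ = β r := by simp

/-- The number of visits at the times `0, …, n` to the position at time `s`. -/
def returns (n s : ℕ) (ω : ℕ → Fin d → ℤ) : ENNReal :=
  ∑ j ∈ Finset.range (n + 1), ind (pos j ω) (pos s ω)

@[fun_prop]
theorem measurable_returns (n s : ℕ) :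
    Measurable (returns n s : (ℕ → Fin d → ℤ) → ENNReal) := by
  unfold returns; fun_prop

/-- The number of visits at the times `p, …, p + r` to the position at time `s`. -/
def windowReturns (p r s : ℕ) (ω : ℕ → Fin d → ℤ) : ENNReal :=
  ∑ j ∈ Finset.range (r + 1), ind (pos (p + j) ω) (pos s ω)

@[fun_prop]
theorem measurable_windowReturns (p r s : ℕ) :
    Measurable (windowReturns p r s : (ℕ → Fin d → ℤ) → ENNReal) := by
  unfold windowReturns; fun_prop

theorem windowReturns_le_add (p r r' s : ℕ) (ω : ℕ → Fin d → ℤ) :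
    windowReturns p (r + r') s ω ≤ windowReturns p r s ω + windowReturns (p + r) r' s ω := by
  unfold windowReturns
  rw [add_assoc r, Finset.sum_range_add]
  simp only [add_assoc]
  gcongr
  omega

theorem returns_eq_windowReturns (n s : ℕ) (ω : ℕ → Fin d → ℤ) :
    returns n s ω = windowReturns 0 n s ω := by simp [returns, windowReturns]

/-- A factor that counts visits before time `s` to a point determined by the later increments. -/
theorem lintegral_mul_windowReturns_before_le (hβ : ∀ m x, stepProb μ m x ≤ β m) (n m s e : ℕ)
    (hs : s ≤ n) {Φ : (ℕ → Fin d → ℤ) → ENNReal} (hΦ : Measurable Φ)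
    (Ψ : (ℕ → Fin d → ℤ) → ENNReal) (hΨ : Measurable Ψ) (hdep : ∀ ω ω', Φ (glue s ω ω') = Ψ ω') :
    ∫⁻ ω, Φ ω * windowReturns 0 s (s + e) ω ^ m ∂pathLaw μ ≤
      m.factorial * partialSum β n ^ m * ∫⁻ ω, Φ ω ∂pathLaw μ := by
  have hΦΨ : ∫⁻ ω, Φ ω ∂pathLaw μ = ∫⁻ ω, Ψ ω ∂pathLaw μ := by
    rw [lintegral_glue μ s hΦ]; simp [hdep]
  rw [hΦΨ, lintegral_glue μ s (by fun_prop)]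
  have e1 : ∀ ω ω' : ℕ → Fin d → ℤ, Φ (glue s ω ω') * windowReturns 0 s (s + e) (glue s ω ω') ^ m
      = Ψ ω' * endVisits s (pos e ω') ω ^ m := by
    intro ω ω'
    rw [hdep, windowReturns, endVisits, pos_glue_add]
    congr 2
    refine Finset.sum_congr rfl fun j hj => ?_
    rw [zero_add, pos_glue_of_le (by have := Finset.mem_range.1 hj; omega)]
  simp only [e1]
  rw [lintegral_lintegral_swap (by fun_prop), ← lintegral_const_mul _ hΨ]
  refine lintegral_mono fun ω' => ?_
  rw [lintegral_const_mul _ (by fun_prop), mul_comm]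
  gcongr
  exact lintegral_endVisits_pow_le hβ n m s hs _

/-- A factor that counts visits after time `t` to a point determined by the earlier increments. -/
theorem lintegral_mul_windowReturns_after_le (hβ : ∀ m x, stepProb μ m x ≤ β m) (n m t r e : ℕ)
    (hr : r ≤ n) (he : e ≤ t) {Φ : (ℕ → Fin d → ℤ) → ENNReal} (hΦ : Measurable Φ)
    (hdep : ∀ ω ω', Φ (glue t ω ω') = Φ ω) :
    ∫⁻ ω, Φ ω * windowReturns t r e ω ^ m ∂pathLaw μ ≤
      m.factorial * partialSum β n ^ m * ∫⁻ ω, Φ ω ∂pathLaw μ := by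
  rw [lintegral_glue μ t (by fun_prop), ← lintegral_const_mul _ hΦ]
  refine lintegral_mono fun ω => ?_
  have e1 : ∀ ω' : ℕ → Fin d → ℤ, Φ (glue t ω ω') * windowReturns t r e (glue t ω ω') ^ m
      = Φ ω * visits r (pos e ω - pos t ω) ω' ^ m := by
    intro ω'
    rw [hdep, windowReturns, visits, pos_glue_of_le he]
    congr 2
    refine Finset.sum_congr rfl fun j hj => ?_
    rw [pos_glue_add]
    exact ind_congr (by rw [eq_sub_iff_add_eq, add_comm])
  simp only [e1]
  rw [lintegral_const_mul _ (by fun_prop), mul_comm]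
  gcongr
  exact lintegral_visits_pow_le hβ n m r hr _

/-- The visits to the position at time `s` are split into those before `s`, those in `[s, s + r]`
and those after `s + r`. The outer two windows are independent of the loop; in the middle one the
loop is an end point constraint. The constant is `3 ^ m` from the power of a sum of three terms,
times three terms. -/
theorem lintegral_ind_mul_returns_pow_le (hβ : IsDecayBound μ β κ) (n m s r : ℕ)
    (hn : s + r ≤ n) :
    ∫⁻ ω, ind (pos (s + r) ω) (pos s ω) * returns n s ω ^ m ∂pathLaw μ ≤
      3 ^ (m + 1) * momentConst κ m * partialSum β n ^ m * β r := by
  set A := momentConst κ m * partialSum β n ^ m * β r with hA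
  set Φ : (ℕ → Fin d → ℤ) → ENNReal := fun ω => ind (pos (s + r) ω) (pos s ω) with hΦd
  have hΦ : Measurable Φ := by fun_prop
  have h3 : m.factorial * partialSum β n ^ m * ∫⁻ ω, Φ ω ∂pathLaw μ ≤ A := by
    rw [hA]
    gcongr
    · exact factorial_le_momentConst hβ.one_le m
    · exact lintegral_ind_pos_pos_le hβ.stepProb_le s r
  have hg : ∀ ω ω' : ℕ → Fin d → ℤ, Φ (glue s ω ω') = ind (pos r ω') 0 := by
    intro ω ω'
    simp only [hΦd]
    rw [pos_glue_add, pos_glue_of_le le_rfl]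
    exact ind_congr (by simp)
  have p0 : ∫⁻ ω, Φ ω * windowReturns 0 s s ω ^ m ∂pathLaw μ ≤ A :=
    (lintegral_mul_windowReturns_before_le hβ.stepProb_le n m s 0 (by omega) hΦ
      (fun ω' => ind (pos r ω') 0) (by fun_prop) hg).trans h3
  have p2 : ∫⁻ ω, Φ ω * windowReturns (s + r) (n - (s + r)) s ω ^ m ∂pathLaw μ ≤ A := by
    refine (lintegral_mul_windowReturns_after_le hβ.stepProb_le n m (s + r) (n - (s + r)) s
      (by omega) (by omega) hΦ fun ω ω' => ?_).trans h3
    simp only [hΦd]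
    rw [pos_glue_of_le le_rfl, pos_glue_of_le (by omega)]
  have p1 : ∫⁻ ω, Φ ω * windowReturns s r s ω ^ m ∂pathLaw μ ≤ A := by
    rw [lintegral_glue μ s (by fun_prop)]
    calc _ ≤ ∫⁻ _ : ℕ → Fin d → ℤ, A ∂pathLaw μ := by
          refine lintegral_mono fun ω => le_trans (lintegral_mono fun ω' => ?_)
            (lintegral_visits_pow_mul_ind_le hβ n m r (by omega) 0)
          rw [hg, mul_comm]
          gcongr
          simp only [windowReturns, visits]
          gcongr with j hj
          rw [pos_glue_add, pos_glue_of_le le_rfl]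
          exact (ind_congr (by simp)).le
      _ = A := by simp
  have hret : ∀ ω : ℕ → Fin d → ℤ, returns n s ω ≤ ∑ i : Fin 3,
      ![windowReturns 0 s s ω, windowReturns s r s ω, windowReturns (s + r) (n - (s + r)) s ω] i := by
    intro ω
    rw [returns_eq_windowReturns]
    have en : n = s + r + (n - (s + r)) := by omega
    conv_lhs => rw [en]
    refine (windowReturns_le_add 0 (s + r) _ s ω).trans ?_
    simp only [Fin.sum_univ_three, zero_add]
    gcongr ?_ + _
    simpa using windowReturns_le_add 0 s r s ω
  calc _ ≤ ∫⁻ ω, 3 ^ m * (Φ ω * windowReturns 0 s s ω ^ m + Φ ω * windowReturns s r s ω ^ m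
        + Φ ω * windowReturns (s + r) (n - (s + r)) s ω ^ m) ∂pathLaw μ := by
        refine lintegral_mono fun ω => ?_
        have := (pow_le_pow_left' (hret ω) m).trans (sum_pow_le Finset.univ_nonempty _ m)
        simp only [Finset.card_univ, Fintype.card_fin, Fin.sum_univ_three, Nat.cast_ofNat,
          Matrix.cons_val] at this
        calc _ ≤ Φ ω * _ := mul_le_mul_right this _
          _ = _ := by ring
    _ ≤ 3 ^ m * (A + A + A) := by
        rw [lintegral_const_mul _ (by fun_prop), lintegral_add_right _ (by fun_prop),
          lintegral_add_right _ (by fun_prop)]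
        gcongr
    _ = _ := by rw [hA]; ring

/-- The least pairwise product of `β a`, `β b` and `β c`. -/
def pairBound (β : ℕ → ENNReal) (a b c : ℕ) : ENNReal :=
  min (β b * β c) (min (β a * β c) (β a * β b))

/-- Three independent weighted displacements that are forced to be `z`, `-z` and `z`. -/
theorem lintegral_three_le {a b c : ℕ} {φ₁ φ₂ φ₃ : (ℕ → Fin d → ℤ) → ENNReal}
    (h₁ : Measurable φ₁) (h₂ : Measurable φ₂) (h₃ : Measurable φ₃)
    {W₁ W₂ W₃ : ENNReal}
    (hW₁ : ∫⁻ ω, φ₁ ω ∂pathLaw μ ≤ W₁) (hs₁ : ∀ z, ∫⁻ ω, φ₁ ω * ind (pos a ω) z ∂pathLaw μ ≤ W₁ * β a)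
    (hW₂ : ∫⁻ ω, φ₂ ω ∂pathLaw μ ≤ W₂) (hs₂ : ∀ z, ∫⁻ ω, φ₂ ω * ind (pos b ω) z ∂pathLaw μ ≤ W₂ * β b)
    (hW₃ : ∫⁻ ω, φ₃ ω ∂pathLaw μ ≤ W₃) (hs₃ : ∀ z, ∫⁻ ω, φ₃ ω * ind (pos c ω) z ∂pathLaw μ ≤ W₃ * β c) :
    ∫⁻ ω₁, ∫⁻ ω₂, ∫⁻ ω₃, φ₁ ω₁ * φ₂ ω₂ * φ₃ ω₃ * (ind (pos a ω₁) (-pos b ω₂) *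
      ind (pos c ω₃) (pos a ω₁)) ∂pathLaw μ ∂pathLaw μ ∂pathLaw μ ≤
      W₁ * W₂ * W₃ * pairBound β a b c := by
  -- Each of `b1`, `b2`, `b3` leaves one displacement free and bounds the point probabilities of the
  -- other two uniformly in `z`. The free one is integrated last, so `b3` needs `ω₃` moved to the
  -- outside.
  have inner : ∀ ω₁ ω₂ : ℕ → Fin d → ℤ, ∫⁻ ω₃, φ₁ ω₁ * φ₂ ω₂ * φ₃ ω₃ * (ind (pos a ω₁) (-pos b ω₂) *
      ind (pos c ω₃) (pos a ω₁)) ∂pathLaw μ ≤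
      φ₁ ω₁ * φ₂ ω₂ * ind (pos a ω₁) (-pos b ω₂) * (W₃ * β c) := by
    intro ω₁ ω₂
    calc _ = ∫⁻ ω₃, φ₁ ω₁ * φ₂ ω₂ * ind (pos a ω₁) (-pos b ω₂) *
          (φ₃ ω₃ * ind (pos c ω₃) (pos a ω₁)) ∂pathLaw μ := by congr 1; ext; ring
      _ ≤ _ := by
        rw [lintegral_const_mul _ (by fun_prop)]
        gcongr
        exact hs₃ _
  have b1 : ∫⁻ ω₁, ∫⁻ ω₂, φ₁ ω₁ * φ₂ ω₂ * ind (pos a ω₁) (-pos b ω₂) * (W₃ * β c)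
      ∂pathLaw μ ∂pathLaw μ ≤ W₁ * W₂ * W₃ * (β b * β c) := by
    calc _ ≤ ∫⁻ ω₁, φ₁ ω₁ * (W₂ * β b * (W₃ * β c)) ∂pathLaw μ := by
          refine lintegral_mono fun ω₁ => ?_
          calc _ = ∫⁻ ω₂, φ₁ ω₁ * ((φ₂ ω₂ * ind (pos b ω₂) (-pos a ω₁)) * (W₃ * β c)) ∂pathLaw μ := by
                congr 1; ext ω₂
                rw [ind_congr (x := pos a ω₁) (y := -pos b ω₂) (x' := pos b ω₂) (y' := -pos a ω₁)
                  (by rw [eq_neg_iff_add_eq_zero, eq_neg_iff_add_eq_zero, add_comm])]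
                ring
            _ ≤ _ := by
              rw [lintegral_const_mul _ (by fun_prop), lintegral_mul_const _ (by fun_prop)]
              gcongr
              exact hs₂ _
      _ ≤ W₁ * (W₂ * β b * (W₃ * β c)) := by
          rw [lintegral_mul_const _ h₁]; gcongr
      _ = _ := by ring
  have b2 : ∫⁻ ω₁, ∫⁻ ω₂, φ₁ ω₁ * φ₂ ω₂ * ind (pos a ω₁) (-pos b ω₂) * (W₃ * β c)
      ∂pathLaw μ ∂pathLaw μ ≤ W₁ * W₂ * W₃ * (β a * β c) := by
    rw [lintegral_lintegral_swap (by fun_prop)]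
    calc _ ≤ ∫⁻ ω₂, φ₂ ω₂ * (W₁ * β a * (W₃ * β c)) ∂pathLaw μ := by
          refine lintegral_mono fun ω₂ => ?_
          calc _ = ∫⁻ ω₁, φ₂ ω₂ * ((φ₁ ω₁ * ind (pos a ω₁) (-pos b ω₂)) * (W₃ * β c)) ∂pathLaw μ := by
                congr 1; ext ω₁; ring
            _ ≤ _ := by
              rw [lintegral_const_mul _ (by fun_prop), lintegral_mul_const _ (by fun_prop)]
              gcongr
              exact hs₁ _
      _ ≤ W₂ * (W₁ * β a * (W₃ * β c)) := by
          rw [lintegral_mul_const _ h₂]; gcongr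
      _ = _ := by ring
  have b3 : ∫⁻ ω₁, ∫⁻ ω₂, ∫⁻ ω₃, φ₁ ω₁ * φ₂ ω₂ * φ₃ ω₃ * (ind (pos a ω₁) (-pos b ω₂) *
      ind (pos c ω₃) (pos a ω₁)) ∂pathLaw μ ∂pathLaw μ ∂pathLaw μ ≤
      W₁ * W₂ * W₃ * (β a * β b) := by
    calc _ = ∫⁻ ω₃, ∫⁻ ω₁, ∫⁻ ω₂, φ₁ ω₁ * φ₂ ω₂ * φ₃ ω₃ * (ind (pos a ω₁) (-pos b ω₂) *
          ind (pos c ω₃) (pos a ω₁)) ∂pathLaw μ ∂pathLaw μ ∂pathLaw μ := by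
          refine (lintegral_congr fun ω₁ => lintegral_lintegral_swap (by fun_prop)).trans ?_
          exact lintegral_lintegral_swap
            (Measurable.lintegral_prod_right (by fun_prop)).aemeasurable
      _ ≤ ∫⁻ ω₃, φ₃ ω₃ * (W₁ * β a * (W₂ * β b)) ∂pathLaw μ := by
          refine lintegral_mono fun ω₃ => ?_
          calc _ ≤ ∫⁻ ω₁, φ₃ ω₃ * ((φ₁ ω₁ * ind (pos a ω₁) (pos c ω₃)) * (W₂ * β b)) ∂pathLaw μ := by
                refine lintegral_mono fun ω₁ => ?_
                calc _ = ∫⁻ ω₂, φ₃ ω₃ * (φ₁ ω₁ * ind (pos a ω₁) (pos c ω₃)) *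
                      (φ₂ ω₂ * ind (pos b ω₂) (-pos a ω₁)) ∂pathLaw μ := by
                      congr 1; ext ω₂
                      rw [ind_congr (x := pos a ω₁) (y := -pos b ω₂) (x' := pos b ω₂)
                        (y' := -pos a ω₁)
                        (by rw [eq_neg_iff_add_eq_zero, eq_neg_iff_add_eq_zero, add_comm]),
                        ind_comm (pos c ω₃)]
                      ring
                  _ ≤ φ₃ ω₃ * (φ₁ ω₁ * ind (pos a ω₁) (pos c ω₃)) * (W₂ * β b) := by
                      rw [lintegral_const_mul _ (by fun_prop)]
                      gcongr
                      exact hs₂ _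
                  _ = _ := by ring
            _ ≤ _ := by
              rw [lintegral_const_mul _ (by fun_prop), lintegral_mul_const _ (by fun_prop)]
              gcongr
              exact hs₁ _
      _ ≤ W₃ * (W₁ * β a * (W₂ * β b)) := by
          rw [lintegral_mul_const _ h₃]; gcongr
      _ = _ := by ring
  unfold pairBound
  rcases min_choice (β b * β c) (min (β a * β c) (β a * β b)) with h | h
  · rw [h]
    exact le_trans (lintegral_mono fun ω₁ => lintegral_mono fun ω₂ => inner ω₁ ω₂) b1
  · rw [h]
    rcases min_choice (β a * β c) (β a * β b) with h | h
    · rw [h]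
      exact le_trans (lintegral_mono fun ω₁ => lintegral_mono fun ω₂ => inner ω₁ ω₂) b2
    · rw [h]; exact b3

end RandomWalk

end

/-! ### Crossing returns -/

noncomputable section

namespace RandomWalk

variable {d : ℕ} {μ : Measure (Fin d → ℤ)} [IsProbabilityMeasure μ] {β : ℕ → ENNReal} {κ : ENNReal}

/-- The indicator of the event that the walk returns at time `s + a + b` to its position at
time `s`, and at time `s + a + b + c` to its position at time `s + a`. -/
def crossInd (s a b c : ℕ) (ω : ℕ → Fin d → ℤ) : ENNReal :=
  ind (pos (s + (a + b)) ω) (pos s ω) * ind (pos (s + (a + (b + c))) ω) (pos (s + a) ω)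

@[fun_prop]
theorem measurable_crossInd (s a b c : ℕ) :
    Measurable (crossInd s a b c : (ℕ → Fin d → ℤ) → ENNReal) := by
  unfold crossInd; fun_prop

theorem crossInd_glue (s a b c : ℕ) (ω ω' : ℕ → Fin d → ℤ) :
    crossInd s a b c (glue s ω ω') = crossInd 0 a b c ω' := by
  unfold crossInd
  simp only [pos_glue_add, pos_glue_of_le le_rfl, zero_add, pos_zero]
  congr 1 <;> exact ind_congr (by simp)

theorem crossInd_glue_glue (a b c : ℕ) (ω₁ ω₂ ω₃ : ℕ → Fin d → ℤ) :
    crossInd 0 a b c (glue a ω₁ (glue b ω₂ ω₃)) =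
      ind (pos a ω₁) (-pos b ω₂) * ind (pos c ω₃) (pos a ω₁) := by
  unfold crossInd
  simp only [pos_glue_add, pos_glue_of_le le_rfl, zero_add, pos_zero]
  rw [ind_congr (eq_neg_iff_add_eq_zero (a := pos a ω₁) (b := pos b ω₂)).symm]
  unfold ind
  split_ifs with h1 h2 h3 h3 <;> simp_all

/-- After cutting at `s`, `s + a` and `s + (a + b)`, the three segments are independent. The weight
has to factorize over them only on the crossing event, which is what allows its anchor point to be
read off from either end of a segment. -/
theorem lintegral_crossInd_mul_le {s a b c : ℕ} {φ₁ φ₂ φ₃ w : (ℕ → Fin d → ℤ) → ENNReal}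
    (h₁ : Measurable φ₁) (h₂ : Measurable φ₂) (h₃ : Measurable φ₃) (hw : Measurable w)
    {W₁ W₂ W₃ : ENNReal}
    (hW₁ : ∫⁻ ω, φ₁ ω ∂pathLaw μ ≤ W₁) (hs₁ : ∀ z, ∫⁻ ω, φ₁ ω * ind (pos a ω) z ∂pathLaw μ ≤ W₁ * β a)
    (hW₂ : ∫⁻ ω, φ₂ ω ∂pathLaw μ ≤ W₂) (hs₂ : ∀ z, ∫⁻ ω, φ₂ ω * ind (pos b ω) z ∂pathLaw μ ≤ W₂ * β b)
    (hW₃ : ∫⁻ ω, φ₃ ω ∂pathLaw μ ≤ W₃) (hs₃ : ∀ z, ∫⁻ ω, φ₃ ω * ind (pos c ω) z ∂pathLaw μ ≤ W₃ * β c)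
    (H : ∀ ω₀ ω₁ ω₂ ω₃ : ℕ → Fin d → ℤ, pos a ω₁ = -pos b ω₂ → pos c ω₃ = pos a ω₁ →
      w (glue s ω₀ (glue a ω₁ (glue b ω₂ ω₃))) ≤ φ₁ ω₁ * φ₂ ω₂ * φ₃ ω₃) :
    ∫⁻ ω, crossInd s a b c ω * w ω ∂pathLaw μ ≤ W₁ * W₂ * W₃ * pairBound β a b c := by
  rw [lintegral_glue μ s (by fun_prop)]
  calc _ ≤ ∫⁻ _ : ℕ → Fin d → ℤ, W₁ * W₂ * W₃ * pairBound β a b c ∂pathLaw μ := by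
        refine lintegral_mono fun ω₀ => le_trans ?_
          (lintegral_three_le h₁ h₂ h₃ hW₁ hs₁ hW₂ hs₂ hW₃ hs₃)
        simp only [crossInd_glue]
        rw [lintegral_glue μ a (by fun_prop)]
        refine lintegral_mono fun ω₁ => ?_
        simp only
        rw [lintegral_glue μ b (by fun_prop)]
        refine lintegral_mono fun ω₂ => lintegral_mono fun ω₃ => ?_
        simp only
        rw [crossInd_glue_glue, mul_comm _ (_ * ind _ _), mul_assoc, mul_assoc]
        refine ind_mul_le_ind_mul fun e1 => ind_mul_le_ind_mul fun e2 => ?_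
        exact H ω₀ ω₁ ω₂ ω₃ e1 e2
    _ = _ := by simp

theorem lintegral_crossInd_le (hβ : ∀ m x, stepProb μ m x ≤ β m) (s a b c : ℕ) :
    ∫⁻ ω, crossInd s a b c ω ∂pathLaw μ ≤ pairBound β a b c := by
  have h := lintegral_crossInd_mul_le (μ := μ) (β := β) (s := s) (a := a) (b := b) (c := c)
    (φ₁ := fun _ => 1) (φ₂ := fun _ => 1) (φ₃ := fun _ => 1) (w := fun _ => 1) (W₁ := 1) (W₂ := 1)
    (W₃ := 1)
    (by fun_prop) (by fun_prop) (by fun_prop) (by fun_prop) (by simp)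
    (fun z => by simpa [stepProb] using hβ a z) (by simp) (fun z => by simpa [stepProb] using hβ b z) (by simp)
    (fun z => by simpa [stepProb] using hβ c z) (by simp)
  simpa using h

/-- The visits are split over the five windows cut out by the four crossing times. The outer two are
conditionally independent of the crossing. In each of the inner three the anchor point coincides, on
the crossing event, with the start or the end of the segment, so the weight becomes `visits` or
`endVisits` of that segment alone. -/
theorem lintegral_crossInd_mul_returns_pow_le (hβ : IsDecayBound μ β κ) (n m s a b c e : ℕ)
    (hn : s + (a + (b + c)) ≤ n) (he : e = 0 ∨ e = a) :
    ∫⁻ ω, crossInd s a b c ω * returns n (s + e) ω ^ m ∂pathLaw μ ≤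
      5 ^ (m + 1) * momentConst κ m * partialSum β n ^ m * pairBound β a b c := by
  set M := momentConst κ m * partialSum β n ^ m with hM
  have hMf : m.factorial * partialSum β n ^ m ≤ M := by
    rw [hM]; gcongr; exact factorial_le_momentConst hβ.one_le m
  have hv : ∀ k ≤ n, ∫⁻ ω, visits k 0 ω ^ m ∂pathLaw μ ≤ M := fun k hk =>
    (lintegral_visits_pow_le hβ.stepProb_le n m k hk 0).trans hMf
  have hev : ∀ k ≤ n, ∫⁻ ω, endVisits k 0 ω ^ m ∂pathLaw μ ≤ M := fun k hk =>
    (lintegral_endVisits_pow_le hβ.stepProb_le n m k hk 0).trans hMf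
  have hvs := fun k (hk : k ≤ n) => lintegral_visits_pow_mul_ind_le hβ n m k hk
  have hevs := fun k (hk : k ≤ n) => lintegral_endVisits_pow_mul_ind_le hβ n m k hk
  have one_W : ∫⁻ _ : ℕ → Fin d → ℤ, 1 ∂pathLaw μ ≤ 1 := by simp
  have one_s : ∀ k z, ∫⁻ ω, 1 * ind (pos k ω) z ∂pathLaw μ ≤ 1 * β k := fun k z => by
    simpa [stepProb] using hβ.stepProb_le k z
  set A := M * pairBound β a b c with hA
  have hea : e ≤ a := by omega
  have h0A : m.factorial * partialSum β n ^ m * ∫⁻ ω, crossInd s a b c ω ∂pathLaw μ ≤ A := by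
    rw [hA]; gcongr; exact lintegral_crossInd_le hβ.stepProb_le s a b c
  have p0 : ∫⁻ ω, crossInd s a b c ω * windowReturns 0 s (s + e) ω ^ m ∂pathLaw μ ≤ A :=
    (lintegral_mul_windowReturns_before_le hβ.stepProb_le n m s e (by omega) (by fun_prop)
      _ (measurable_crossInd 0 a b c) (crossInd_glue s a b c)).trans h0A
  have p4 : ∫⁻ ω, crossInd s a b c ω * windowReturns (s + (a + (b + c)))
      (n - (s + (a + (b + c)))) (s + e) ω ^ m ∂pathLaw μ ≤ A := by
    refine (lintegral_mul_windowReturns_after_le hβ.stepProb_le n m _ _ _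
      (by omega) (by omega) (by fun_prop) fun ω ω' => ?_).trans h0A
    simp only [crossInd]
    rw [pos_glue_of_le (by omega), pos_glue_of_le (by omega), pos_glue_of_le (by omega),
      pos_glue_of_le (by omega)]
  -- The anchor is the start of this segment if `e = 0` and its end if `e = a`.
  have p1 : ∫⁻ ω, crossInd s a b c ω * windowReturns s a (s + e) ω ^ m ∂pathLaw μ ≤ A := by
    rcases he with rfl | rfl
    · refine (lintegral_crossInd_mul_le (φ₁ := fun ω => visits a 0 ω ^ m) (φ₂ := fun _ => 1)
        (φ₃ := fun _ => 1) (by fun_prop) (by fun_prop) (by fun_prop) (by fun_prop)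
        (hv a (by omega)) (hvs a (by omega)) one_W (one_s b) one_W (one_s c) ?_).trans
        (by rw [mul_one, mul_one])
      intro ω₀ ω₁ ω₂ ω₃ h1 h2
      rw [mul_one, mul_one]
      gcongr
      unfold windowReturns visits
      gcongr with j hj
      have hj := Finset.mem_range.1 hj
      rw [pos_glue_add, pos_glue_add, pos_glue_of_le (by omega)]
      exact (ind_congr (by simp)).le
    · refine (lintegral_crossInd_mul_le (φ₁ := fun ω => endVisits e 0 ω ^ m) (φ₂ := fun _ => 1)
        (φ₃ := fun _ => 1) (by fun_prop) (by fun_prop) (by fun_prop) (by fun_prop)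
        (hev e (by omega)) (hevs e (by omega)) one_W (one_s b) one_W (one_s c) ?_).trans
        (by rw [mul_one, mul_one])
      intro ω₀ ω₁ ω₂ ω₃ h1 h2
      rw [mul_one, mul_one]
      gcongr
      unfold windowReturns endVisits
      gcongr with j hj
      have hj := Finset.mem_range.1 hj
      rw [pos_glue_add, pos_glue_add, pos_glue_of_le (by omega), pos_glue_of_le le_rfl]
      exact (ind_congr (by simp)).le
  -- The second segment leads back to the position at time `s`, so the roles of its two ends are
  -- exchanged.
  have p2 : ∫⁻ ω, crossInd s a b c ω * windowReturns (s + a) b (s + e) ω ^ m ∂pathLaw μ ≤ A := by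
    rcases he with rfl | rfl
    · refine (lintegral_crossInd_mul_le (φ₁ := fun _ => 1) (φ₂ := fun ω => endVisits b 0 ω ^ m)
        (φ₃ := fun _ => 1) (by fun_prop) (by fun_prop) (by fun_prop) (by fun_prop)
        one_W (one_s a) (hev b (by omega)) (hevs b (by omega)) one_W (one_s c) ?_).trans
        (by rw [mul_one, one_mul])
      intro ω₀ ω₁ ω₂ ω₃ h1 h2
      rw [mul_one, one_mul]
      gcongr
      unfold windowReturns endVisits
      gcongr with j hj
      have hj := Finset.mem_range.1 hj
      rw [add_assoc, pos_glue_add, pos_glue_add, pos_glue_add, pos_glue_of_le (by omega), h1]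
      exact (ind_congr (by simp [neg_add_eq_zero, eq_comm])).le
    · refine (lintegral_crossInd_mul_le (φ₁ := fun _ => 1) (φ₂ := fun ω => visits b 0 ω ^ m)
        (φ₃ := fun _ => 1) (by fun_prop) (by fun_prop) (by fun_prop) (by fun_prop)
        one_W (one_s e) (hv b (by omega)) (hvs b (by omega)) one_W (one_s c) ?_).trans
        (by rw [mul_one, one_mul])
      intro ω₀ ω₁ ω₂ ω₃ h1 h2
      rw [mul_one, one_mul]
      gcongr
      unfold windowReturns visits
      gcongr with j hj
      have hj := Finset.mem_range.1 hj
      rw [add_assoc, pos_glue_add, pos_glue_add, pos_glue_add,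
        pos_glue_of_le (by omega), pos_glue_of_le le_rfl]
      exact (ind_congr (by simp)).le
  -- The third segment starts at the position of time `s` and ends at that of time `s + a`.
  have p3 : ∫⁻ ω, crossInd s a b c ω * windowReturns (s + (a + b)) c (s + e) ω ^ m ∂pathLaw μ ≤
      A := by
    rcases he with rfl | rfl
    · refine (lintegral_crossInd_mul_le (φ₁ := fun _ => 1) (φ₂ := fun _ => 1)
        (φ₃ := fun ω => visits c 0 ω ^ m) (by fun_prop) (by fun_prop) (by fun_prop) (by fun_prop)
        one_W (one_s a) one_W (one_s b) (hv c (by omega)) (hvs c (by omega)) ?_).trans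
        (by rw [mul_one, one_mul])
      intro ω₀ ω₁ ω₂ ω₃ h1 h2
      rw [mul_one, one_mul]
      gcongr
      unfold windowReturns visits
      gcongr with j hj
      rw [add_assoc, add_assoc, pos_glue_add, pos_glue_add, pos_glue_add, pos_glue_add, h1]
      exact (ind_congr (by simp)).le
    · refine (lintegral_crossInd_mul_le (φ₁ := fun _ => 1) (φ₂ := fun _ => 1)
        (φ₃ := fun ω => endVisits c 0 ω ^ m) (by fun_prop) (by fun_prop) (by fun_prop)
        (by fun_prop) one_W (one_s e) one_W (one_s b) (hev c (by omega)) (hevs c (by omega))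
        ?_).trans (by rw [mul_one, one_mul])
      intro ω₀ ω₁ ω₂ ω₃ h1 h2
      rw [mul_one, one_mul]
      gcongr
      unfold windowReturns endVisits
      gcongr with j hj
      rw [add_assoc, add_assoc, pos_glue_add, pos_glue_add, pos_glue_add, pos_glue_add,
        pos_glue_of_le le_rfl, h2, h1]
      exact (ind_congr (by simp)).le
  have hret : ∀ ω : ℕ → Fin d → ℤ, returns n (s + e) ω ≤ ∑ i : Fin 5,
      ![windowReturns 0 s (s + e) ω, windowReturns s a (s + e) ω, windowReturns (s + a) b (s + e) ω,
        windowReturns (s + (a + b)) c (s + e) ω,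
        windowReturns (s + (a + (b + c))) (n - (s + (a + (b + c)))) (s + e) ω] i := by
    intro ω
    rw [returns_eq_windowReturns]
    have en : n = s + (a + (b + (c + (n - (s + (a + (b + c))))))) := by omega
    conv_lhs => rw [en]
    simp only [Fin.sum_univ_five, Matrix.cons_val]
    have w1 := windowReturns_le_add 0 s (a + (b + (c + (n - (s + (a + (b + c))))))) (s + e) ω
    have w2 := windowReturns_le_add s a (b + (c + (n - (s + (a + (b + c)))))) (s + e) ω
    have w3 := windowReturns_le_add (s + a) b (c + (n - (s + (a + (b + c))))) (s + e) ω
    have w4 := windowReturns_le_add (s + (a + b)) c (n - (s + (a + (b + c)))) (s + e) ω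
    rw [zero_add] at w1
    rw [add_assoc s a b] at w3
    have e4 : s + (a + b) + c = s + (a + (b + c)) := by omega
    rw [e4] at w4
    refine w1.trans ?_
    simp only [add_assoc (windowReturns 0 s (s + e) ω), add_assoc (windowReturns s a (s + e) ω),
      add_assoc (windowReturns (s + a) b (s + e) ω)]
    gcongr
    refine w2.trans ?_
    gcongr
    refine w3.trans ?_
    gcongr
  calc _ ≤ ∫⁻ ω, 5 ^ m * (crossInd s a b c ω * windowReturns 0 s (s + e) ω ^ m +
        (crossInd s a b c ω * windowReturns s a (s + e) ω ^ m +
        (crossInd s a b c ω * windowReturns (s + a) b (s + e) ω ^ m +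
        (crossInd s a b c ω * windowReturns (s + (a + b)) c (s + e) ω ^ m +
        crossInd s a b c ω * windowReturns (s + (a + (b + c))) (n - (s + (a + (b + c))))
          (s + e) ω ^ m)))) ∂pathLaw μ := by
        refine lintegral_mono fun ω => ?_
        have := (pow_le_pow_left' (hret ω) m).trans (sum_pow_le Finset.univ_nonempty _ m)
        simp only [Finset.card_univ, Fintype.card_fin, Fin.sum_univ_five, Nat.cast_ofNat,
          Matrix.cons_val] at this
        calc _ ≤ crossInd s a b c ω * _ := mul_le_mul_right this _
          _ = _ := by ring
    _ ≤ 5 ^ m * (A + (A + (A + (A + A)))) := by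
        rw [lintegral_const_mul _ (by fun_prop), lintegral_add_left (by fun_prop),
          lintegral_add_left (by fun_prop), lintegral_add_left (by fun_prop),
          lintegral_add_left (by fun_prop)]
        gcongr
    _ = _ := by rw [hA, hM]; ring

/-- The constant in `lintegral_crossInd_mul_returns_mul_le`. -/
def crossConst (κ : ENNReal) (m : ℕ) : ENNReal := 2 * 5 ^ (2 * m + 1) * momentConst κ (2 * m)

/-- By `x ^ m * y ^ m ≤ x ^ (2 * m) + y ^ (2 * m)` it suffices to treat one anchor at a time. -/
theorem lintegral_crossInd_mul_returns_mul_le (hβ : IsDecayBound μ β κ) (n m s a b c : ℕ)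
    (hn : s + (a + (b + c)) ≤ n) :
    ∫⁻ ω, crossInd s a b c ω * (returns n s ω ^ m * returns n (s + a) ω ^ m) ∂pathLaw μ ≤
      crossConst κ m * partialSum β n ^ (2 * m) * pairBound β a b c := by
  have h1 := lintegral_crossInd_mul_returns_pow_le hβ n (2 * m) s a b c 0 hn (.inl rfl)
  have h2 := lintegral_crossInd_mul_returns_pow_le hβ n (2 * m) s a b c a hn (.inr rfl)
  calc _ ≤ ∫⁻ ω, (crossInd s a b c ω * returns n (s + 0) ω ^ (2 * m) +
        crossInd s a b c ω * returns n (s + a) ω ^ (2 * m)) ∂pathLaw μ := by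
        refine lintegral_mono fun ω => ?_
        rw [← mul_add]
        gcongr
        rw [add_zero, two_mul, pow_add, pow_add]
        rcases le_total (returns n s ω ^ m) (returns n (s + a) ω ^ m) with h | h
        · exact (mul_le_mul_left h _).trans le_add_self
        · exact (mul_le_mul_right h _).trans le_self_add
    _ ≤ _ := by
        rw [lintegral_add_left (by fun_prop)]
        refine (add_le_add h1 h2).trans (le_of_eq ?_)
        unfold crossConst; ring

end RandomWalk

end

/-! ### Coincidence events -/

noncomputable section

namespace RandomWalk

variable {d : ℕ} {μ : Measure (Fin d → ℤ)} [IsProbabilityMeasure μ] {β : ℕ → ENNReal} {κ : ENNReal}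
  {ι : Type*}

/-- The walk is at one and the same place at all the times `f i`. -/
def Coincide (f : ι → ℕ) (ω : ℕ → Fin d → ℤ) : Prop := ∀ i j, pos (f i) ω = pos (f j) ω

open Classical in
/-- The indicator of `Coincide f`. -/
def coInd (f : ι → ℕ) (ω : ℕ → Fin d → ℤ) : ENNReal := if Coincide f ω then 1 else 0

theorem measurableSet_coincide [Countable ι] (f : ι → ℕ) :
    MeasurableSet {ω : ℕ → Fin d → ℤ | Coincide f ω} := by
  simp only [Coincide, Set.ofPred_forall]
  exact MeasurableSet.iInter fun i => MeasurableSet.iInter fun j =>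
    measurableSet_eq_fun (by fun_prop) (by fun_prop)

@[fun_prop]
theorem measurable_coInd [Countable ι] (f : ι → ℕ) : Measurable (coInd f : (ℕ → Fin d → ℤ) → ENNReal) :=
  Measurable.ite (measurableSet_coincide f) measurable_const measurable_const

theorem coInd_congr {f g : ι → ℕ} {ω ω' : ℕ → Fin d → ℤ} (h : Coincide f ω ↔ Coincide g ω') :
    coInd f ω = coInd g ω' := by
  classical
  unfold coInd; exact if_congr h rfl rfl

theorem coInd_le_one (f : ι → ℕ) (ω : ℕ → Fin d → ℤ) : coInd f ω ≤ 1 := by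
  unfold coInd; split_ifs <;> simp

variable (μ) in
/-- The probability of `Coincide f`. -/
def coProb (f : ι → ℕ) : ENNReal := ∫⁻ ω, coInd f ω ∂pathLaw μ

variable (μ) in
/-- The joint probability of `Coincide f` and `Coincide g`. -/
def coProb₂ (f g : ι → ℕ) : ENNReal := ∫⁻ ω, coInd f ω * coInd g ω ∂pathLaw μ

theorem coProb₂_comm (f g : ι → ℕ) : coProb₂ μ f g = coProb₂ μ g f := by
  simp only [coProb₂, mul_comm]

theorem coincide_glue_of_le {f : ι → ℕ} {s : ℕ} (h : ∀ i, f i ≤ s) (ω ω' : ℕ → Fin d → ℤ) :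
    Coincide f (glue s ω ω') ↔ Coincide f ω := by
  simp only [Coincide, pos_glue_of_le (h _)]

theorem coincide_glue_of_ge {f : ι → ℕ} {s : ℕ} (h : ∀ i, s ≤ f i) (ω ω' : ℕ → Fin d → ℤ) :
    Coincide f (glue s ω ω') ↔ Coincide (fun i => f i - s) ω' := by
  simp only [Coincide, pos_glue_of_ge (h _), add_right_inj]

theorem coProb_shift [Countable ι] {f : ι → ℕ} {s : ℕ} (h : ∀ i, s ≤ f i) :
    coProb μ f = coProb μ (fun i => f i - s) := by
  unfold coProb
  rw [lintegral_glue μ s (by fun_prop)]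
  simp [coInd_congr (coincide_glue_of_ge h _ _)]

theorem coProb₂_eq_mul_of_separated [Countable ι] {f g : ι → ℕ} {s : ℕ} (hf : ∀ i, f i ≤ s) (hg : ∀ i, s ≤ g i) :
    coProb₂ μ f g = coProb μ f * coProb μ g := by
  rw [coProb_shift hg]
  unfold coProb₂ coProb
  rw [lintegral_glue μ s (by fun_prop), ← lintegral_mul_const _ (by fun_prop)]
  refine lintegral_congr fun ω => ?_
  rw [← lintegral_const_mul _ (by fun_prop)]
  refine lintegral_congr fun ω' => ?_
  rw [coInd_congr (coincide_glue_of_ge hg _ _), coInd_congr (coincide_glue_of_le hf _ _)]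

section MinMax
variable [Fintype ι] [Nonempty ι]

/-- The least time of the family `g`. -/
def firstTime (g : ι → ℕ) : ℕ := Finset.univ.inf' Finset.univ_nonempty g

/-- The greatest time of the family `g`. -/
def lastTime (g : ι → ℕ) : ℕ := Finset.univ.sup' Finset.univ_nonempty g

theorem firstTime_le (g : ι → ℕ) (i : ι) : firstTime g ≤ g i := Finset.inf'_le _ (Finset.mem_univ i)

theorem le_lastTime (g : ι → ℕ) (i : ι) : g i ≤ lastTime g := Finset.le_sup' _ (Finset.mem_univ i)

theorem exists_eq_firstTime (g : ι → ℕ) : ∃ i, g i = firstTime g := by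
  obtain ⟨i, -, hi⟩ := Finset.exists_mem_eq_inf' Finset.univ_nonempty g
  exact ⟨i, hi.symm⟩

theorem exists_eq_lastTime (g : ι → ℕ) : ∃ i, g i = lastTime g := by
  obtain ⟨i, -, hi⟩ := Finset.exists_mem_eq_sup' Finset.univ_nonempty g
  exact ⟨i, hi.symm⟩

theorem firstTime_le_lastTime (g : ι → ℕ) : firstTime g ≤ lastTime g :=
  (firstTime_le g (Classical.arbitrary ι)).trans (le_lastTime g _)

/-- All the times of `g` lie in one and the same gap of `f`. -/
def Nested (f g : ι → ℕ) : Prop :=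
  (∀ i, f i < firstTime g ∨ lastTime g < f i) ∧ (∃ i, f i < firstTime g) ∧ ∃ i, lastTime g < f i

/-- The family `f` with the time span of `g` cut out. -/
def contract (f g : ι → ℕ) (i : ι) : ℕ :=
  if f i < firstTime g then f i else f i - (lastTime g - firstTime g)

/-- When `g` coincides, the walk makes a loop between the first and the last time of `g`. Deleting
the loop does not change the positions at the times of `f`, and what is left is independent of the
loop. -/
theorem coProb₂_of_nested {f g : ι → ℕ} (h : ∀ i, f i < firstTime g ∨ lastTime g < f i) :
    coProb₂ μ f g = coProb μ (contract f g) * coProb μ g := by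
  set m := firstTime g with hm
  set b := lastTime g - firstTime g with hb
  have hml := firstTime_le_lastTime g
  rw [coProb_shift (firstTime_le g)]
  unfold coProb₂ coProb
  rw [lintegral_glue μ m (by fun_prop), lintegral_glue μ m (F := coInd (contract f g)) (by fun_prop),
    ← lintegral_mul_const _ ?_]
  swap
  · exact Measurable.lintegral_prod_right (by fun_prop)
  refine lintegral_congr fun ω₁ => ?_
  rw [lintegral_glue μ b (by fun_prop), mul_comm, ← lintegral_mul_const _ (by fun_prop)]
  refine lintegral_congr fun ω₂ => ?_
  rw [← lintegral_const_mul _ (by fun_prop)]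
  refine lintegral_congr fun ω₃ => ?_
  have hg : Coincide g (glue m ω₁ (glue b ω₂ ω₃)) ↔ Coincide (fun i => g i - m) ω₂ := by
    rw [coincide_glue_of_ge (firstTime_le g), coincide_glue_of_le]
    intro i
    have := le_lastTime g i
    omega
  rw [coInd_congr hg, mul_comm]
  by_cases hc : Coincide (fun i => g i - m) ω₂
  · have hb0 : pos b ω₂ = 0 := by
      obtain ⟨i, hi⟩ := exists_eq_firstTime g
      obtain ⟨j, hj⟩ := exists_eq_lastTime g
      have := hc j i
      simp only [hi, hj] at this
      simpa [hm] using this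
    congr 1
    refine coInd_congr ?_
    have : ∀ i, pos (f i) (glue m ω₁ (glue b ω₂ ω₃)) = pos (contract f g i) (glue m ω₁ ω₃) := by
      intro i
      unfold contract
      split_ifs with hi
      · rw [pos_glue_of_le hi.le, pos_glue_of_le hi.le]
      · have h2 := (h i).resolve_left hi
        rw [pos_glue_of_ge (by omega), pos_glue_of_ge (by omega), pos_glue_of_ge (by omega), hb0,
          zero_add]
        congr 2
        omega
    simp only [Coincide, this]
  · simp [coInd, hc, ← hm]

theorem contract_lt_iff {f g : ι → ℕ} (h : ∀ i, f i < firstTime g ∨ lastTime g < f i) (i : ι) :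
    contract f g i < firstTime g ↔ f i < firstTime g := by
  have := firstTime_le_lastTime g
  have := h i
  unfold contract
  split_ifs <;> omega

/-- Whether a time came before or after the span of `g` can still be seen after the contraction, so
the shift can be undone. -/
theorem contract_injective {f f' g : ι → ℕ} (h : ∀ i, f i < firstTime g ∨ lastTime g < f i)
    (h' : ∀ i, f' i < firstTime g ∨ lastTime g < f' i) (e : contract f g = contract f' g) :
    f = f' := by
  funext i
  have e1 := contract_lt_iff h i
  rw [e, contract_lt_iff h' i] at e1
  have e2 := congrFun e i
  unfold contract at e2
  have := firstTime_le_lastTime g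
  have := h i
  have := h' i
  split_ifs at e2 <;> omega

/-- The times of `f` and `g` alternate at least three times. -/
def Crossing (f g : ι → ℕ) : Prop := ∃ a b c e, f a < g b ∧ g b < f c ∧ f c ≤ g e

/-- Suppose that no time is shared and that `f` starts first. A time of `f` strictly inside the span
of `g`, or a last time of `f` there, produces the pattern `f, g, f, g`. Otherwise `f` ends before
`g` starts, or `g` sits in one gap of `f`. -/
theorem classify (f g : ι → ℕ) :
    (∃ a b, f a = g b) ∨ Crossing f g ∨ Crossing g f ∨ Nested f g ∨ Nested g f ∨
      lastTime f < firstTime g ∨ lastTime g < firstTime f := by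
  by_contra! H
  obtain ⟨hT, hC, hC', hN, hN', hd, hd'⟩ := H
  obtain ⟨a, ha⟩ := exists_eq_firstTime f
  obtain ⟨a', ha'⟩ := exists_eq_lastTime f
  obtain ⟨b, hb⟩ := exists_eq_firstTime g
  obtain ⟨b', hb'⟩ := exists_eq_lastTime g
  rcases lt_or_gt_of_ne (hT a b) with h | h
  · refine hN ⟨fun i => ?_, ⟨a, by omega⟩, ⟨a', ?_⟩⟩
    · by_contra! hi
      have h1 := hT i b
      have h2 := hT i b'
      exact hC ⟨a, b, i, b', h, by omega, by omega⟩
    · have h1 := hT a' b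
      have h2 := hT a' b'
      by_contra! hi
      exact hC ⟨a, b, a', b', h, by omega, by omega⟩
  · refine hN' ⟨fun i => ?_, ⟨b, by omega⟩, ⟨b', ?_⟩⟩
    · by_contra! hi
      have h1 := hT a i
      have h2 := hT a' i
      exact hC' ⟨b, a, i, a', h, by omega, by omega⟩
    · have h1 := hT a b'
      have h2 := hT a' b'
      by_contra! hi
      exact hC' ⟨b, a, b', a', h, by omega, by omega⟩

-- The pairs `(contract f g, g)` are distinct, still consist of times in `{1, …, n}`, and are nested
-- or crossing. The joint probabilities thus become products that are indexed by such pairs without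
-- repetition.
open Classical in
theorem sum_nested_le (n : ℕ) (T : Finset (ι → ℕ)) (hT : ∀ f, f ∈ T ↔ ∀ i, f i ∈ Finset.Icc 1 n) :
    ∑ p ∈ (T ×ˢ T).filter (fun p => Nested p.1 p.2), coProb₂ μ p.1 p.2 ≤
      ∑ p ∈ (T ×ˢ T).filter (fun p => Nested p.1 p.2), coProb μ p.1 * coProb μ p.2 +
      ∑ p ∈ (T ×ˢ T).filter (fun p => Crossing p.1 p.2), coProb μ p.1 * coProb μ p.2 := by
  set N := (T ×ˢ T).filter (fun p => Nested p.1 p.2) with hN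
  set φ : (ι → ℕ) × (ι → ℕ) → (ι → ℕ) × (ι → ℕ) := fun p => (contract p.1 p.2, p.2) with hφ
  have hinj : Set.InjOn φ N := by
    rintro ⟨f, g⟩ hp ⟨f', g'⟩ hp' he
    simp only [hφ, Prod.mk.injEq] at he
    obtain ⟨he, rfl⟩ := he
    have h1 := (Finset.mem_filter.1 (Finset.mem_coe.1 hp)).2.1
    have h2 := (Finset.mem_filter.1 (Finset.mem_coe.1 hp')).2.1
    exact Prod.ext (contract_injective h1 h2 he) rfl
  calc _ = ∑ p ∈ N, coProb μ (φ p).1 * coProb μ (φ p).2 :=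
        Finset.sum_congr rfl fun p hp => coProb₂_of_nested (Finset.mem_filter.1 hp).2.1
    _ = ∑ p ∈ N.image φ, coProb μ p.1 * coProb μ p.2 := by
        rw [Finset.sum_image hinj]
    _ ≤ ∑ p ∈ N ∪ (T ×ˢ T).filter (fun p => Crossing p.1 p.2), coProb μ p.1 * coProb μ p.2 := by
        refine Finset.sum_le_sum_of_subset fun q hq => ?_
        obtain ⟨⟨f, g⟩, hp, rfl⟩ := Finset.mem_image.1 hq
        simp only [hN, Finset.mem_filter, Finset.mem_product, hT, Finset.mem_Icc] at hp
        obtain ⟨⟨hf, hg⟩, h1, ⟨i, hi⟩, ⟨j, hj⟩⟩ := hp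
        have hml := firstTime_le_lastTime g
        have hcT : contract f g ∈ T := by
          rw [hT]
          intro k
          have := hf k
          have := h1 k
          unfold contract
          rw [Finset.mem_Icc]
          obtain ⟨b, hb⟩ := exists_eq_firstTime g
          have := hg b
          split_ifs <;> omega
        have hgT : g ∈ T := (hT g).2 fun k => Finset.mem_Icc.2 (hg k)
        have hci : contract f g i < firstTime g := (contract_lt_iff h1 i).2 hi
        have hcge : ∀ k, contract f g k < firstTime g ∨ firstTime g < contract f g k := by
          intro k
          have := h1 k
          unfold contract
          split_ifs <;> omega
        have hcj : firstTime g < contract f g j := by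
          have := contract_lt_iff h1 j
          have := hcge j
          omega
        simp only [hφ, hN, Finset.mem_union, Finset.mem_filter, Finset.mem_product, hcT, hgT,
          true_and]
        -- A contracted time may fall into the span of `g`, and even onto its last time; therefore
        -- the last inequality in `Crossing` is not strict.
        by_cases hx : ∃ k, firstTime g < contract f g k ∧ contract f g k ≤ lastTime g
        · right
          obtain ⟨k, hk1, hk2⟩ := hx
          obtain ⟨b, hb⟩ := exists_eq_firstTime g
          obtain ⟨e, he⟩ := exists_eq_lastTime g
          exact ⟨i, b, k, e, by omega, by omega, by omega⟩
        · left
          push Not at hx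
          refine ⟨fun k => ?_, ⟨i, hci⟩, ⟨j, hx j hcj⟩⟩
          rcases hcge k with h | h
          · exact .inl h
          · exact .inr (hx k h)
    _ ≤ _ := by
        rw [← Finset.sum_union_inter]
        exact le_self_add

-- The covariance expansion without subtraction: separated pairs contribute equal amounts on both
-- sides, nested pairs in either order are controlled by `sum_nested_le`, and only ties and
-- crossings remain as error.
open Classical in
theorem sum_coProb₂_le (n : ℕ) (T : Finset (ι → ℕ)) (hT : ∀ f, f ∈ T ↔ ∀ i, f i ∈ Finset.Icc 1 n) :
    ∑ p ∈ T ×ˢ T, coProb₂ μ p.1 p.2 ≤ ∑ p ∈ T ×ˢ T, coProb μ p.1 * coProb μ p.2 +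
      (∑ p ∈ (T ×ˢ T).filter (fun p => ∃ a b, p.1 a = p.2 b), coProb₂ μ p.1 p.2 +
      2 * ∑ p ∈ (T ×ˢ T).filter (fun p => Crossing p.1 p.2), coProb₂ μ p.1 p.2 +
      2 * ∑ p ∈ (T ×ˢ T).filter (fun p => Crossing p.1 p.2), coProb μ p.1 * coProb μ p.2) := by
  have swap : ∀ (Q : (ι → ℕ) → (ι → ℕ) → Prop) (F : (ι → ℕ) → (ι → ℕ) → ENNReal),
      ∑ p ∈ (T ×ˢ T).filter (fun p => Q p.2 p.1), F p.2 p.1 =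
      ∑ p ∈ (T ×ˢ T).filter (fun p => Q p.1 p.2), F p.1 p.2 := by
    intro Q F
    refine Finset.sum_nbij' Prod.swap Prod.swap ?_ ?_ ?_ ?_ ?_ <;> simp +contextual
  set D : (ι → ℕ) × (ι → ℕ) → Prop := fun p =>
    lastTime p.1 < firstTime p.2 ∨ lastTime p.2 < firstTime p.1 with hD
  have hx1 := swap Crossing (fun f g => coProb₂ μ f g)
  have hn1 := swap Nested (fun f g => coProb₂ μ f g)
  have hn2 := swap Nested (fun f g => coProb μ f * coProb μ g)
  have key : ∑ p ∈ T ×ˢ T, coProb₂ μ p.1 p.2 ≤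
      ∑ p ∈ (T ×ˢ T).filter (fun p => ∃ a b, p.1 a = p.2 b), coProb₂ μ p.1 p.2 +
      ∑ p ∈ (T ×ˢ T).filter (fun p => Crossing p.1 p.2), coProb₂ μ p.1 p.2 +
      ∑ p ∈ (T ×ˢ T).filter (fun p => Crossing p.2 p.1), coProb₂ μ p.2 p.1 +
      ∑ p ∈ (T ×ˢ T).filter (fun p => Nested p.1 p.2), coProb₂ μ p.1 p.2 +
      ∑ p ∈ (T ×ˢ T).filter (fun p => Nested p.2 p.1), coProb₂ μ p.2 p.1 +
      ∑ p ∈ (T ×ˢ T).filter D, coProb μ p.1 * coProb μ p.2 := by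
    simp only [Finset.sum_filter, ← Finset.sum_add_distrib]
    refine Finset.sum_le_sum fun p _ => ?_
    rcases classify p.1 p.2 with h | h | h | h | h | h
    · rw [if_pos h]; simp only [add_assoc]; exact le_self_add
    · rw [if_pos h, add_comm (ite _ _ _)]; simp only [add_assoc]; exact le_self_add
    · rw [if_pos h, coProb₂_comm p.2, add_comm (_ + _) (coProb₂ μ p.1 p.2)]
      simp only [add_assoc]; exact le_self_add
    · rw [if_pos h, add_comm (_ + _ + _) (coProb₂ μ p.1 p.2)]
      simp only [add_assoc]; exact le_self_add
    · rw [if_pos h, coProb₂_comm p.2, add_comm (_ + _ + _ + _) (coProb₂ μ p.1 p.2)]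
      simp only [add_assoc]; exact le_self_add
    · rw [if_pos h]
      refine le_trans (le_of_eq ?_) le_add_self
      rcases h with h | h
      · exact coProb₂_eq_mul_of_separated (le_lastTime p.1) fun i => h.le.trans (firstTime_le p.2 i)
      · rw [coProb₂_comm, mul_comm]
        exact coProb₂_eq_mul_of_separated (le_lastTime p.2) fun i => h.le.trans (firstTime_le p.1 i)
  -- The two nested cases and the separated case exclude each other, so their products are counted
  -- at most once.
  have key2 : ∑ p ∈ (T ×ˢ T).filter (fun p => Nested p.1 p.2), coProb μ p.1 * coProb μ p.2 +
      ∑ p ∈ (T ×ˢ T).filter (fun p => Nested p.2 p.1), coProb μ p.2 * coProb μ p.1 +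
      ∑ p ∈ (T ×ˢ T).filter D, coProb μ p.1 * coProb μ p.2 ≤
      ∑ p ∈ T ×ˢ T, coProb μ p.1 * coProb μ p.2 := by
    simp only [Finset.sum_filter, ← Finset.sum_add_distrib]
    refine Finset.sum_le_sum fun p _ => ?_
    have h1 := firstTime_le_lastTime p.1
    have h2 := firstTime_le_lastTime p.2
    have nn : ∀ f g : ι → ℕ, Nested f g → firstTime f < firstTime g ∧ lastTime g < lastTime f := by
      rintro f g ⟨-, ⟨i, hi⟩, ⟨j, hj⟩⟩
      exact ⟨(firstTime_le f i).trans_lt hi, hj.trans_le (le_lastTime f j)⟩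
    by_cases ha : Nested p.1 p.2
    · have := nn _ _ ha
      have hb : ¬ Nested p.2 p.1 := fun h => by have := nn _ _ h; omega
      have hc : ¬ D p := by simp only [hD]; omega
      simp [ha, hb, hc]
    · by_cases hb : Nested p.2 p.1
      · have := nn _ _ hb
        have hc : ¬ D p := by simp only [hD]; omega
        simp [ha, hb, hc, mul_comm]
      · simp only [ha, hb, if_false, zero_add]
        split_ifs <;> simp
  have hs := sum_nested_le (μ := μ) n T hT
  rw [hx1, hn1] at key
  rw [hn2] at key2
  refine key.trans ((add_le_add_left (add_le_add (add_le_add le_rfl hs) hs) _).trans ?_)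
  refine le_trans (le_of_eq ?_) (add_le_add_left key2 _)
  ring

end MinMax

end RandomWalk

end

/-! ### Summation over families of times -/

noncomputable section

namespace RandomWalk

variable {d : ℕ} {μ : Measure (Fin d → ℤ)} [IsProbabilityMeasure μ] {β : ℕ → ENNReal} {κ : ENNReal}
  {ι : Type*} [Fintype ι] [DecidableEq ι]

variable (ι) in
/-- The families of times in `{1, …, n}` indexed by `ι`. -/
def timeTuples (n : ℕ) : Finset (ι → ℕ) := Fintype.piFinset fun _ => Finset.Icc 1 n

theorem mem_timeTuples {n : ℕ} {f : ι → ℕ} : f ∈ timeTuples ι n ↔ ∀ i, f i ∈ Finset.Icc 1 n :=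
  Fintype.mem_piFinset

theorem sum_prod_compl_le (n : ℕ) (A : Finset ι) (v : ι → ℕ) (h : ℕ → ENNReal) :
    ∑ f ∈ (timeTuples ι n).filter (fun f => ∀ i ∈ A, f i = v i), ∏ i ∈ Aᶜ, h (f i) ≤
      (∑ j ∈ Finset.range (n + 1), h j) ^ (Fintype.card ι - A.card) := by
  calc _ ≤ ∑ f ∈ Fintype.piFinset (fun i => if i ∈ A then {v i} else Finset.range (n + 1)),
        ∏ i, (if i ∈ A then 1 else h (f i)) := by
        rw [Finset.sum_congr rfl (g := fun f => ∏ i, (if i ∈ A then 1 else h (f i)))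
          (fun f _ => ?_)]
        · refine Finset.sum_le_sum_of_subset fun f hf => ?_
          simp only [Finset.mem_filter, mem_timeTuples, Finset.mem_Icc] at hf
          rw [Fintype.mem_piFinset]
          intro i
          split_ifs with hi
          · simpa using hf.2 i hi
          · have := hf.1 i
            exact Finset.mem_range.2 (by omega)
        · rw [Finset.prod_ite]
          simp [Finset.compl_eq_univ_sdiff, Finset.filter_notMem_eq_sdiff]
    _ = ∏ i, ∑ j ∈ (if i ∈ A then {v i} else Finset.range (n + 1)),
          (if i ∈ A then 1 else h j) := by
        rw [Finset.prod_univ_sum]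
    _ = ∏ i, (if i ∈ A then 1 else ∑ j ∈ Finset.range (n + 1), h j) := by
        refine Finset.prod_congr rfl fun i _ => ?_
        split_ifs <;> simp
    _ ≤ _ := by
        rw [Finset.prod_ite]
        simp [Finset.filter_notMem_eq_sdiff, ← Finset.compl_eq_univ_sdiff, Finset.card_compl]

theorem coInd_le_prod {κ : Type*} (f : κ → ℕ) (a : κ) (A : Finset κ) (ω : ℕ → Fin d → ℤ) :
    coInd f ω ≤ ∏ i ∈ A, ind (pos (f i) ω) (pos (f a) ω) := by
  unfold coInd
  split_ifs with h
  · simp [ind, h _ a]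
  · simp

theorem sum_coInd_le_one_fixed (n : ℕ) (a : ι) (s : ℕ) (ω : ℕ → Fin d → ℤ) :
    ∑ f ∈ (timeTuples ι n).filter (fun f => f a = s), coInd f ω ≤
      returns n s ω ^ (Fintype.card ι - 1) := by
  have h := sum_prod_compl_le n {a} (fun _ => s) (fun j => ind (pos j ω) (pos s ω))
  simp only [Finset.mem_singleton, forall_eq, Finset.card_singleton] at h
  refine le_trans (Finset.sum_le_sum fun f hf => ?_) h
  have hf := (Finset.mem_filter.1 hf).2
  have := coInd_le_prod f a {a}ᶜ ω
  rwa [hf] at this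

theorem sum_coInd_le_two_fixed (n : ℕ) {a c : ι} (hac : a ≠ c) (s t : ℕ) (ω : ℕ → Fin d → ℤ) :
    ∑ f ∈ (timeTuples ι n).filter (fun f => f a = s ∧ f c = t), coInd f ω ≤
      ind (pos t ω) (pos s ω) * returns n s ω ^ (Fintype.card ι - 2) := by
  have h := sum_prod_compl_le n {a, c} (fun i => if i = a then s else t)
    (fun j => ind (pos j ω) (pos s ω))
  rw [Finset.card_pair hac] at h
  have hset : ∀ f : ι → ℕ, (∀ i ∈ ({a, c} : Finset ι), f i = if i = a then s else t) ↔
      (f a = s ∧ f c = t) := by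
    intro f; simp [hac.symm]
  simp only [hset] at h
  unfold returns
  refine le_trans ?_ (mul_le_mul_right h _)
  rw [Finset.mul_sum]
  refine Finset.sum_le_sum fun f hf => ?_
  obtain ⟨h1, h2⟩ := (Finset.mem_filter.1 hf).2
  -- The index `c` is kept although its time is fixed: its factor is the indicator of the return at
  -- time `t`.
  have h3 := coInd_le_prod f a (insert c ({a, c} : Finset ι)ᶜ) ω
  rw [Finset.prod_insert (by simp)] at h3
  rwa [h1, h2] at h3

/-- The admissible starting times and gaps of four increasing times up to `n`. -/
def quads (n : ℕ) : Finset (ℕ × ℕ × ℕ × ℕ) :=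
  (Finset.range (n + 1) ×ˢ Finset.range (n + 1) ×ˢ Finset.range (n + 1) ×ˢ
    Finset.range (n + 1)).filter (fun q => q.1 + (q.2.1 + (q.2.2.1 + q.2.2.2)) ≤ n)

-- A union bound over the four indices that witness the crossing gives the fourth power of the
-- cardinality. For fixed indices the pairs are grouped by the starting time and the three gaps, and
-- the two families then decouple.
open Classical in
theorem sum_crossing_le (n : ℕ) (w w' : (ι → ℕ) → ENNReal) (G G' : ℕ → ℕ → ENNReal)
    (hG : ∀ a c, a ≠ c → ∀ s t, s ≤ t → t ≤ n →
      ∑ f ∈ (timeTuples ι n).filter (fun f => f a = s ∧ f c = t), w f ≤ G s t)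
    (hG' : ∀ a c, a ≠ c → ∀ s t, s ≤ t → t ≤ n →
      ∑ f ∈ (timeTuples ι n).filter (fun f => f a = s ∧ f c = t), w' f ≤ G' s t) :
    ∑ p ∈ (timeTuples ι n ×ˢ timeTuples ι n).filter (fun p => Crossing p.1 p.2),
      w p.1 * w' p.2 ≤ (Fintype.card ι : ENNReal) ^ 4 * ∑ q ∈ quads n,
        G q.1 (q.1 + (q.2.1 + q.2.2.1)) * G' (q.1 + q.2.1) (q.1 + (q.2.1 + (q.2.2.1 + q.2.2.2))) := by
  set T := timeTuples ι n with hT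
  set R := ∑ q ∈ quads n,
        G q.1 (q.1 + (q.2.1 + q.2.2.1)) * G' (q.1 + q.2.1) (q.1 + (q.2.1 + (q.2.2.1 + q.2.2.2)))
  have key : ∀ a b c e : ι, ∑ p ∈ (T ×ˢ T).filter (fun p => p.1 a < p.2 b ∧ p.2 b < p.1 c ∧
      p.1 c ≤ p.2 e), w p.1 * w' p.2 ≤ R := by
    intro a b c e
    set P := (T ×ˢ T).filter (fun p => p.1 a < p.2 b ∧ p.2 b < p.1 c ∧ p.1 c ≤ p.2 e) with hP
    by_cases hac : a = c
    · have : P = ∅ := by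
        refine Finset.filter_eq_empty_iff.2 fun p _ => ?_
        subst hac; omega
      simp [this]
    by_cases hbe : b = e
    · have : P = ∅ := by
        refine Finset.filter_eq_empty_iff.2 fun p _ => ?_
        subst hbe; omega
      simp [this]
    have hmaps : ∀ p ∈ P, (p.1 a, p.2 b - p.1 a, p.1 c - p.2 b, p.2 e - p.1 c) ∈ quads n := by
      intro p hp
      simp only [hP, hT, Finset.mem_filter, Finset.mem_product, mem_timeTuples,
        Finset.mem_Icc] at hp
      have h1 := hp.1.1 a
      have h2 := hp.1.2 b
      have h3 := hp.1.1 c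
      have h4 := hp.1.2 e
      simp only [quads, Finset.mem_filter, Finset.mem_product, Finset.mem_range]
      omega
    rw [← Finset.sum_fiberwise_of_maps_to hmaps]
    refine Finset.sum_le_sum fun q hq => ?_
    have hq := (Finset.mem_filter.1 hq).2
    calc _ ≤ ∑ p ∈ T.filter (fun f => f a = q.1 ∧ f c = q.1 + (q.2.1 + q.2.2.1)) ×ˢ
          T.filter (fun f => f b = q.1 + q.2.1 ∧ f e = q.1 + (q.2.1 + (q.2.2.1 + q.2.2.2))),
          w p.1 * w' p.2 := by
          refine Finset.sum_le_sum_of_subset fun p hp => ?_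
          simp only [hP, Finset.mem_filter, Finset.mem_product] at hp ⊢
          obtain ⟨⟨⟨h1, h2⟩, h3⟩, hq'⟩ := hp
          obtain ⟨q₁, q₂, q₃, q₄⟩ := q
          simp only [Prod.mk.injEq] at hq' ⊢
          refine ⟨⟨h1, ?_⟩, h2, ?_⟩ <;> omega
      _ ≤ _ := by
          rw [Finset.sum_product, ← Finset.sum_mul_sum]
          exact mul_le_mul' (hG a c hac _ _ (by omega) (by omega))
            (hG' b e hbe _ _ (by omega) (by omega))
  calc _ ≤ ∑ x : ι × ι × ι × ι, ∑ p ∈ (T ×ˢ T).filter (fun p => p.1 x.1 < p.2 x.2.1 ∧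
        p.2 x.2.1 < p.1 x.2.2.1 ∧ p.1 x.2.2.1 ≤ p.2 x.2.2.2), w p.1 * w' p.2 := by
        simp only [Finset.sum_filter]
        rw [Finset.sum_comm]
        refine Finset.sum_le_sum fun p _ => ?_
        split_ifs with h
        · obtain ⟨a, b, c, e, h⟩ := h
          refine le_trans ?_ (Finset.single_le_sum (fun _ _ => zero_le)
            (Finset.mem_univ ((a, b, c, e) : ι × ι × ι × ι)))
          simp only
          rw [if_pos h]
        · exact zero_le
    _ ≤ ∑ x : ι × ι × ι × ι, R := Finset.sum_le_sum fun x _ => key _ _ _ _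
    _ = _ := by
        simp only [Finset.sum_const, Finset.card_univ, Fintype.card_prod, nsmul_eq_mul]
        push_cast; ring

open Classical in
theorem sum_tie_le (n : ℕ) (w w' : (ι → ℕ) → ENNReal) (G G' : ℕ → ENNReal)
    (hG : ∀ a s, s ≤ n → ∑ f ∈ (timeTuples ι n).filter (fun f => f a = s), w f ≤ G s)
    (hG' : ∀ a s, s ≤ n → ∑ f ∈ (timeTuples ι n).filter (fun f => f a = s), w' f ≤ G' s) :
    ∑ p ∈ (timeTuples ι n ×ˢ timeTuples ι n).filter (fun p => ∃ a b, p.1 a = p.2 b),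
      w p.1 * w' p.2 ≤ (Fintype.card ι : ENNReal) ^ 2 * ∑ s ∈ Finset.range (n + 1), G s * G' s := by
  set T := timeTuples ι n with hT
  have key : ∀ a b : ι, ∑ p ∈ (T ×ˢ T).filter (fun p => p.1 a = p.2 b), w p.1 * w' p.2 ≤
      ∑ s ∈ Finset.range (n + 1), G s * G' s := by
    intro a b
    set P := (T ×ˢ T).filter (fun p => p.1 a = p.2 b) with hP
    have hmaps : ∀ p ∈ P, p.1 a ∈ Finset.range (n + 1) := by
      intro p hp
      simp only [hP, hT, Finset.mem_filter, Finset.mem_product, mem_timeTuples,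
        Finset.mem_Icc] at hp
      have h1 := hp.1.1 a
      exact Finset.mem_range.2 (by omega)
    rw [← Finset.sum_fiberwise_of_maps_to hmaps]
    refine Finset.sum_le_sum fun s hs => ?_
    have hs := Finset.mem_range.1 hs
    calc _ ≤ ∑ p ∈ T.filter (fun f => f a = s) ×ˢ T.filter (fun f => f b = s),
          w p.1 * w' p.2 := by
          refine Finset.sum_le_sum_of_subset fun p hp => ?_
          simp only [hP, Finset.mem_filter, Finset.mem_product] at hp ⊢
          obtain ⟨⟨⟨h1, h2⟩, h3⟩, rfl⟩ := hp
          exact ⟨⟨h1, rfl⟩, h2, h3.symm⟩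
      _ ≤ _ := by
          rw [Finset.sum_product, ← Finset.sum_mul_sum]
          exact mul_le_mul' (hG a s (by omega)) (hG' b s (by omega))
  calc _ ≤ ∑ x : ι × ι, ∑ p ∈ (T ×ˢ T).filter (fun p => p.1 x.1 = p.2 x.2), w p.1 * w' p.2 := by
        simp only [Finset.sum_filter]
        rw [Finset.sum_comm]
        refine Finset.sum_le_sum fun p _ => ?_
        split_ifs with h
        · obtain ⟨a, b, h⟩ := h
          refine le_trans ?_ (Finset.single_le_sum (fun _ _ => zero_le)
            (Finset.mem_univ ((a, b) : ι × ι)))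
          simp only
          rw [if_pos h]
        · exact zero_le
    _ ≤ ∑ x : ι × ι, ∑ s ∈ Finset.range (n + 1), G s * G' s :=
        Finset.sum_le_sum fun x _ => key _ _
    _ = _ := by
        simp only [Finset.sum_const, Finset.card_univ, Fintype.card_prod, nsmul_eq_mul]
        push_cast; ring

/-- The sum of `pairBound β a b c` over `a, b, c ≤ n`. -/
def pairSum (β : ℕ → ENNReal) (n : ℕ) : ENNReal :=
  ∑ a ∈ Finset.range (n + 1), ∑ b ∈ Finset.range (n + 1), ∑ c ∈ Finset.range (n + 1),
    pairBound β a b c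

theorem sum_quads_pairBound_le (n : ℕ) :
    ∑ q ∈ quads n, pairBound β q.2.1 q.2.2.1 q.2.2.2 ≤ (n + 1) * pairSum β n := by
  calc _ ≤ ∑ q ∈ Finset.range (n + 1) ×ˢ Finset.range (n + 1) ×ˢ Finset.range (n + 1) ×ˢ
        Finset.range (n + 1), pairBound β q.2.1 q.2.2.1 q.2.2.2 :=
        Finset.sum_le_sum_of_subset (Finset.filter_subset _ _)
    _ = _ := by simp [Finset.sum_product, pairSum]

theorem coProb_ne_top {κ : Type*} (f : κ → ℕ) : coProb μ f ≠ ⊤ := by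
  refine ((lintegral_mono fun ω => coInd_le_one f ω).trans_lt ?_).ne
  simp

-- The free times are summed pathwise, before taking expectations; they then appear as powers of
-- local times at the two crossing points.
open Classical in
theorem sum_crossing_coProb₂_le (hβ : IsDecayBound μ β κ) (n : ℕ) :
    ∑ p ∈ (timeTuples ι n ×ˢ timeTuples ι n).filter (fun p => Crossing p.1 p.2),
      coProb₂ μ p.1 p.2 ≤ (Fintype.card ι : ENNReal) ^ 4 * crossConst κ (Fintype.card ι - 2) *
        ((n + 1) * (partialSum β n ^ (2 * (Fintype.card ι - 2)) * pairSum β n)) := by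
  unfold coProb₂
  rw [← lintegral_finsetSum _ (fun p _ => by fun_prop)]
  set m := Fintype.card ι - 2 with hm
  calc _ ≤ ∫⁻ ω, (Fintype.card ι : ENNReal) ^ 4 * ∑ q ∈ quads n,
        crossInd q.1 q.2.1 q.2.2.1 q.2.2.2 ω *
          (returns n q.1 ω ^ m * returns n (q.1 + q.2.1) ω ^ m) ∂pathLaw μ := by
        refine lintegral_mono fun ω => ?_
        refine (sum_crossing_le n (fun f => coInd f ω) (fun f => coInd f ω)
          (fun s t => ind (pos t ω) (pos s ω) * returns n s ω ^ m)
          (fun s t => ind (pos t ω) (pos s ω) * returns n s ω ^ m)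
          (fun a c hac s t _ _ => sum_coInd_le_two_fixed n hac s t ω)
          (fun a c hac s t _ _ => sum_coInd_le_two_fixed n hac s t ω)).trans (le_of_eq ?_)
        congr 1
        refine Finset.sum_congr rfl fun q _ => ?_
        unfold crossInd; ring
    _ = (Fintype.card ι : ENNReal) ^ 4 * ∑ q ∈ quads n,
        ∫⁻ ω, crossInd q.1 q.2.1 q.2.2.1 q.2.2.2 ω *
          (returns n q.1 ω ^ m * returns n (q.1 + q.2.1) ω ^ m) ∂pathLaw μ := by
        rw [lintegral_const_mul _ (by fun_prop), lintegral_finsetSum _ (fun q _ => by fun_prop)]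
    _ ≤ (Fintype.card ι : ENNReal) ^ 4 * ∑ q ∈ quads n,
          crossConst κ m * partialSum β n ^ (2 * m) * pairBound β q.2.1 q.2.2.1 q.2.2.2 := by
        gcongr with q hq
        exact lintegral_crossInd_mul_returns_mul_le hβ n m _ _ _ _ (Finset.mem_filter.1 hq).2
    _ ≤ (Fintype.card ι : ENNReal) ^ 4 * (crossConst κ m * partialSum β n ^ (2 * m) *
          ((n + 1) * pairSum β n)) := by
        rw [← Finset.mul_sum]
        gcongr
        exact sum_quads_pairBound_le n
    _ = _ := by ring

theorem sum_coProb_le_two_fixed (hβ : IsDecayBound μ β κ) (n : ℕ) {a c : ι} (hac : a ≠ c) (s t : ℕ)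
    (hst : s ≤ t) (htn : t ≤ n) :
    ∑ f ∈ (timeTuples ι n).filter (fun f => f a = s ∧ f c = t), coProb μ f ≤
      3 ^ (Fintype.card ι - 2 + 1) * momentConst κ (Fintype.card ι - 2) *
        partialSum β n ^ (Fintype.card ι - 2) * β (t - s) := by
  unfold coProb
  rw [← lintegral_finsetSum _ (fun p _ => by fun_prop)]
  refine (lintegral_mono fun ω => sum_coInd_le_two_fixed n hac s t ω).trans ?_
  obtain ⟨r, rfl⟩ := Nat.exists_eq_add_of_le hst
  rw [Nat.add_sub_cancel_left]
  exact lintegral_ind_mul_returns_pow_le hβ n _ s r htn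

/-- For the products of probabilities, a crossing leaves two returns over the overlapping gaps `i +
j` and `j + k`. Hence these sums need no estimate beyond the one for joint probabilities. -/
theorem mul_le_pairBound (hβ : Antitone β) (i j k : ℕ) :
    β (i + j) * β (j + k) ≤ pairBound β i j k := by
  unfold pairBound
  refine le_min ?_ (le_min ?_ ?_)
  · exact mul_le_mul' (hβ (by omega)) (hβ (by omega))
  · exact mul_le_mul' (hβ (by omega)) (hβ (by omega))
  · exact mul_le_mul' (hβ (by omega)) (hβ (by omega))

open Classical in
theorem sum_crossing_coProb_mul_le (hβ : IsDecayBound μ β κ) (n : ℕ) :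
    ∑ p ∈ (timeTuples ι n ×ˢ timeTuples ι n).filter (fun p => Crossing p.1 p.2),
      coProb μ p.1 * coProb μ p.2 ≤ (Fintype.card ι : ENNReal) ^ 4 *
        (3 ^ (Fintype.card ι - 2 + 1) * momentConst κ (Fintype.card ι - 2)) ^ 2 *
        ((n + 1) * (partialSum β n ^ (2 * (Fintype.card ι - 2)) * pairSum β n)) := by
  set m := Fintype.card ι - 2 with hm
  set K := 3 ^ (m + 1) * momentConst κ m with hK
  refine (sum_crossing_le n (coProb μ) (coProb μ) (fun s t => K * partialSum β n ^ m * β (t - s))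
    (fun s t => K * partialSum β n ^ m * β (t - s))
    (fun a c hac s t h1 h2 => sum_coProb_le_two_fixed hβ n hac s t h1 h2)
    (fun a c hac s t h1 h2 => sum_coProb_le_two_fixed hβ n hac s t h1 h2)).trans ?_
  calc _ ≤ (Fintype.card ι : ENNReal) ^ 4 * ∑ q ∈ quads n,
        K ^ 2 * partialSum β n ^ (2 * m) * pairBound β q.2.1 q.2.2.1 q.2.2.2 := by
        refine mul_le_mul_right (Finset.sum_le_sum fun q _ => ?_) _
        refine le_trans (le_of_eq ?_) (mul_le_mul_right (mul_le_pairBound hβ.antitone _ _ _) _)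
        have e1 : q.1 + (q.2.1 + q.2.2.1) - q.1 = q.2.1 + q.2.2.1 := by omega
        have e2 : q.1 + (q.2.1 + (q.2.2.1 + q.2.2.2)) - (q.1 + q.2.1) = q.2.2.1 + q.2.2.2 := by
          omega
        rw [e1, e2]; ring
    _ ≤ (Fintype.card ι : ENNReal) ^ 4 * (K ^ 2 * partialSum β n ^ (2 * m) *
          ((n + 1) * pairSum β n)) := by
        rw [← Finset.mul_sum]
        gcongr
        exact sum_quads_pairBound_le n
    _ = _ := by ring

open Classical in
theorem sum_tie_coProb₂_le (hβ : IsDecayBound μ β κ) (n : ℕ) :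
    ∑ p ∈ (timeTuples ι n ×ˢ timeTuples ι n).filter (fun p => ∃ a b, p.1 a = p.2 b),
      coProb₂ μ p.1 p.2 ≤ (Fintype.card ι : ENNReal) ^ 2 * (3 ^ (2 * (Fintype.card ι - 1) + 1) *
        momentConst κ (2 * (Fintype.card ι - 1)) * β 0) *
        ((n + 1) * partialSum β n ^ (2 * (Fintype.card ι - 1))) := by
  unfold coProb₂
  rw [← lintegral_finsetSum _ (fun p _ => by fun_prop)]
  set m := Fintype.card ι - 1 with hm
  -- The indicator of a return after zero steps is identically one. It is inserted to apply the
  -- weighted return bound with `r = 0`, and is the origin of the factor `β 0`.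
  calc _ ≤ ∫⁻ ω, (Fintype.card ι : ENNReal) ^ 2 * ∑ s ∈ Finset.range (n + 1),
        ind (pos (s + 0) ω) (pos s ω) * returns n s ω ^ (2 * m) ∂pathLaw μ := by
        refine lintegral_mono fun ω => ?_
        refine (sum_tie_le n (fun f => coInd f ω) (fun f => coInd f ω)
          (fun s => returns n s ω ^ m) (fun s => returns n s ω ^ m)
          (fun a s _ => sum_coInd_le_one_fixed n a s ω)
          (fun a s _ => sum_coInd_le_one_fixed n a s ω)).trans (le_of_eq ?_)
        congr 1
        refine Finset.sum_congr rfl fun q _ => ?_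
        simp only [add_zero, ind, if_true]; ring
    _ = (Fintype.card ι : ENNReal) ^ 2 * ∑ s ∈ Finset.range (n + 1),
        ∫⁻ ω, ind (pos (s + 0) ω) (pos s ω) * returns n s ω ^ (2 * m) ∂pathLaw μ := by
        rw [lintegral_const_mul _ (by fun_prop), lintegral_finsetSum _ (fun q _ => by fun_prop)]
    _ ≤ (Fintype.card ι : ENNReal) ^ 2 * ∑ s ∈ Finset.range (n + 1),
          3 ^ (2 * m + 1) * momentConst κ (2 * m) * partialSum β n ^ (2 * m) * β 0 := by
        gcongr with s hs
        exact lintegral_ind_mul_returns_pow_le hβ n (2 * m) s 0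
          (by have := Finset.mem_range.1 hs; omega)
    _ = _ := by
        simp only [Finset.sum_const, Finset.card_range, nsmul_eq_mul]
        push_cast; ring

theorem momentConst_ne_top (hκ : κ ≠ ⊤) (m : ℕ) : momentConst κ m ≠ ⊤ := by
  unfold momentConst
  exact ENNReal.mul_ne_top (by finiteness) hκ

theorem exists_sum_coProb₂_le [Nonempty ι] (hβ : IsDecayBound μ β κ) (hκ : κ ≠ ⊤) (h0 : β 0 ≠ ⊤) :
    ∃ K : ENNReal, K ≠ ⊤ ∧ ∀ n, ∑ p ∈ timeTuples ι n ×ˢ timeTuples ι n, coProb₂ μ p.1 p.2 ≤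
      ∑ p ∈ timeTuples ι n ×ˢ timeTuples ι n, coProb μ p.1 * coProb μ p.2 +
      K * ((n + 1) * (partialSum β n ^ (2 * (Fintype.card ι - 1)) +
        partialSum β n ^ (2 * (Fintype.card ι - 2)) * pairSum β n)) := by
  classical
  set K₁ : ENNReal := (Fintype.card ι : ENNReal) ^ 2 * (3 ^ (2 * (Fintype.card ι - 1) + 1) *
        momentConst κ (2 * (Fintype.card ι - 1)) * β 0) with hK₁
  set K₂ : ENNReal := (Fintype.card ι : ENNReal) ^ 4 * crossConst κ (Fintype.card ι - 2) with hK₂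
  set K₃ : ENNReal := (Fintype.card ι : ENNReal) ^ 4 *
        (3 ^ (Fintype.card ι - 2 + 1) * momentConst κ (Fintype.card ι - 2)) ^ 2 with hK₃
  have hm := fun m => momentConst_ne_top (κ := κ) hκ m
  refine ⟨K₁ + 2 * K₂ + 2 * K₃, ?_, fun n => ?_⟩
  · have h1 : K₁ ≠ ⊤ := ENNReal.mul_ne_top (by finiteness)
      (ENNReal.mul_ne_top (ENNReal.mul_ne_top (by finiteness) (hm _)) h0)
    have h2 : K₂ ≠ ⊤ := ENNReal.mul_ne_top (by finiteness)
      (ENNReal.mul_ne_top (by finiteness) (hm _))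
    have h3 : K₃ ≠ ⊤ := ENNReal.mul_ne_top (by finiteness)
      (ENNReal.pow_ne_top (ENNReal.mul_ne_top (by finiteness) (hm _)))
    finiteness
  · refine (sum_coProb₂_le n _ fun f => mem_timeTuples).trans ?_
    gcongr
    set A := (n + 1 : ENNReal) * partialSum β n ^ (2 * (Fintype.card ι - 1)) with hA
    set B := (n + 1 : ENNReal) * (partialSum β n ^ (2 * (Fintype.card ι - 2)) * pairSum β n) with hB
    calc _ ≤ K₁ * A + 2 * (K₂ * B) + 2 * (K₃ * B) := by
          gcongr
          · exact sum_tie_coProb₂_le hβ n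
          · exact sum_crossing_coProb₂_le hβ n
          · exact sum_crossing_coProb_mul_le hβ n
      _ ≤ (K₁ + 2 * K₂ + 2 * K₃) * A + (K₁ + 2 * K₂ + 2 * K₃) * B := by
          have e : K₁ * A + 2 * (K₂ * B) + 2 * (K₃ * B) = K₁ * A + (2 * K₂ + 2 * K₃) * B := by ring
          rw [e]
          gcongr
          · rw [add_assoc]; exact le_self_add
          · exact le_add_self
      _ = _ := by rw [hA, hB]; ring

end RandomWalk

end

/-! ### Self-intersections as counts of coinciding families -/

noncomputable section

namespace RandomWalk

variable {d : ℕ} {μ : Measure (Fin d → ℤ)} [IsProbabilityMeasure μ] {β : ℕ → ENNReal} {κ : ENNReal}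

open Classical in
theorem localTime_simpleIncrement (n : ℕ) (x : Fin d → ℤ) (ω : ℕ → Fin d → ℤ) :
    localTime (simpleIncrement d) n x ω =
      ((Finset.Icc 1 n).filter (fun j => pos j ω = x)).card := by
  unfold localTime
  congr 1

-- The power `l(n, x) ^ α` counts the maps from `Fin α` to the visiting times of `x`. Since `α ≥ 1`,
-- a coinciding family determines its point `x`.
open Classical in
theorem selfIntersection_eq_card {α : ℕ} (hα : 1 ≤ α) (n : ℕ) (ω : ℕ → Fin d → ℤ) :
    selfIntersection (simpleIncrement d) α n ω =
      (((timeTuples (Fin α) n).filter (fun f => Coincide f ω)).card : ℝ) := by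
  have : Nonempty (Fin α) := ⟨⟨0, hα⟩⟩
  set i₀ : Fin α := ⟨0, hα⟩
  unfold selfIntersection
  simp only [localTime_simpleIncrement]
  set I := (Finset.Icc 1 n).image (fun j => pos j ω) with hI
  rw [tsum_eq_sum (s := I)]
  · rw [Finset.card_eq_sum_card_fiberwise (f := fun f => pos (f i₀) ω) (t := I)]
    · push_cast
      refine Finset.sum_congr rfl fun x _ => ?_
      rw [← Nat.cast_pow]
      congr 1
      have h1 := Fintype.card_piFinset_const
        ((Finset.Icc 1 n).filter (fun j => pos j ω = x)) α
      rw [← h1]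
      congr 1
      ext f
      rw [Fintype.mem_piFinset, Finset.mem_filter, Finset.mem_filter, mem_timeTuples]
      simp only [Finset.mem_filter]
      constructor
      · intro h
        exact ⟨⟨fun i => (h i).1, fun i j => by rw [(h i).2, (h j).2]⟩, (h i₀).2⟩
      · rintro ⟨⟨h1, h2⟩, h3⟩ i
        exact ⟨h1 i, by rw [h2 i i₀, h3]⟩
    · intro f hf
      have hf := (Finset.mem_filter.1 (Finset.mem_coe.1 hf)).1
      exact Finset.mem_coe.2 (Finset.mem_image_of_mem _ (mem_timeTuples.1 hf i₀))
  · intro x hx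
    have : (Finset.Icc 1 n).filter (fun j => pos j ω = x) = ∅ := by
      refine Finset.filter_eq_empty_iff.2 fun j hj h => hx ?_
      exact Finset.mem_image.2 ⟨j, hj, h⟩
    rw [this]
    simp; omega

theorem selfIntersection_eq_toReal {α : ℕ} (hα : 1 ≤ α) (n : ℕ) (ω : ℕ → Fin d → ℤ) :
    selfIntersection (simpleIncrement d) α n ω =
      (∑ f ∈ timeTuples (Fin α) n, coInd f ω).toReal := by
  classical
  rw [selfIntersection_eq_card hα]
  simp [coInd]

theorem measurable_selfIntersection {α : ℕ} (hα : 1 ≤ α) (n : ℕ) :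
    Measurable (selfIntersection (simpleIncrement d) α n) := by
  have : selfIntersection (simpleIncrement d) α n =
      fun ω => (∑ f ∈ timeTuples (Fin α) n, coInd f ω).toReal :=
    funext fun ω => selfIntersection_eq_toReal hα n ω
  rw [this]
  exact Measurable.ennreal_toReal (by fun_prop)

theorem selfIntersection_nonneg {α : ℕ} (hα : 1 ≤ α) (n : ℕ) (ω : ℕ → Fin d → ℤ) :
    0 ≤ selfIntersection (simpleIncrement d) α n ω := by
  rw [selfIntersection_eq_toReal hα]; exact ENNReal.toReal_nonneg

theorem selfIntersection_le {α : ℕ} (hα : 1 ≤ α) (n : ℕ) (ω : ℕ → Fin d → ℤ) :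
    selfIntersection (simpleIncrement d) α n ω ≤ (timeTuples (Fin α) n).card := by
  classical
  rw [selfIntersection_eq_card hα]
  exact_mod_cast Finset.card_filter_le _ _

theorem memLp_selfIntersection {α : ℕ} (hα : 1 ≤ α) (n : ℕ) (p : ENNReal) :
    MemLp (selfIntersection (simpleIncrement d) α n) p (pathLaw μ) :=
  MemLp.of_bound (measurable_selfIntersection hα n).aestronglyMeasurable
    ((timeTuples (Fin α) n).card : ℝ) (ae_of_all _ fun ω => by
      rw [Real.norm_eq_abs, abs_of_nonneg (selfIntersection_nonneg hα n ω)]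
      exact selfIntersection_le hα n ω)

/-- Here the two pair sums become the second moment and the squared mean. The only subtraction takes
place here, among real numbers. -/
theorem variance_le_of_sum_coProb₂_le {α : ℕ} (hα : 1 ≤ α) (n : ℕ) {R : ENNReal} (hR : R ≠ ⊤)
    (h : ∑ p ∈ timeTuples (Fin α) n ×ˢ timeTuples (Fin α) n, coProb₂ μ p.1 p.2 ≤
      ∑ p ∈ timeTuples (Fin α) n ×ˢ timeTuples (Fin α) n, coProb μ p.1 * coProb μ p.2 + R) :
    variance (selfIntersection (simpleIncrement d) α n) (pathLaw μ) ≤ R.toReal := by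
  set T := timeTuples (Fin α) n
  set Λ : (ℕ → Fin d → ℤ) → ENNReal := fun ω => ∑ f ∈ T, coInd f ω with hΛ
  have hL : selfIntersection (simpleIncrement d) α n = fun ω => (Λ ω).toReal :=
    funext fun ω => selfIntersection_eq_toReal hα n ω
  have hΛm : Measurable Λ := by fun_prop
  have hΛfin : ∀ ω, Λ ω < ⊤ := fun ω => by
    refine ENNReal.sum_lt_top.2 fun f _ => (coInd_le_one f ω).trans_lt (by simp)
  have h1 : ∫ ω, (Λ ω).toReal ∂pathLaw μ = (∑ f ∈ T, coProb μ f).toReal := by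
    rw [integral_toReal hΛm.aemeasurable (ae_of_all _ hΛfin), hΛ,
      lintegral_finsetSum _ (fun f _ => by fun_prop)]
    rfl
  have h2 : ∫ ω, (Λ ω).toReal ^ 2 ∂pathLaw μ = (∑ p ∈ T ×ˢ T, coProb₂ μ p.1 p.2).toReal := by
    have : ∀ ω, (Λ ω).toReal ^ 2 = (∑ p ∈ T ×ˢ T, coInd p.1 ω * coInd p.2 ω).toReal := by
      intro ω
      simp only [Finset.sum_product]
      rw [← Finset.sum_mul_sum, ENNReal.toReal_mul, sq]
    simp only [this]
    rw [integral_toReal (by fun_prop), lintegral_finsetSum _ (fun f _ => by fun_prop)]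
    · rfl
    · refine ae_of_all _ fun ω => ENNReal.sum_lt_top.2 fun p _ => ?_
      exact (mul_le_mul' (coInd_le_one p.1 ω) (coInd_le_one p.2 ω)).trans_lt (by simp)
  have hfin : ∑ f ∈ T, coProb μ f ≠ ⊤ := ENNReal.sum_ne_top.2 fun f _ => coProb_ne_top f
  have hsq : ∑ p ∈ T ×ˢ T, coProb μ p.1 * coProb μ p.2 = (∑ f ∈ T, coProb μ f) ^ 2 := by
    rw [Finset.sum_product, ← Finset.sum_mul_sum, sq]
  rw [variance_eq_sub (memLp_selfIntersection hα n 2), hL]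
  simp only [Pi.pow_apply]
  rw [h1, h2, ← ENNReal.toReal_pow, ← hsq, sub_le_iff_le_add,
    ← ENNReal.toReal_add hR (by rw [hsq]; exact ENNReal.pow_ne_top hfin)]
  refine ENNReal.toReal_mono ?_ (by rwa [add_comm])
  exact ENNReal.add_ne_top.2 ⟨hR, by rw [hsq]; exact ENNReal.pow_ne_top hfin⟩

theorem variance_eq_variance_pathLaw {Ω : Type*} [MeasurableSpace Ω] {P : Measure Ω}
    [IsProbabilityMeasure P] {X : ℕ → Ω → Fin d → ℤ} (hX : IsIID X P) {α : ℕ} (hα : 1 ≤ α) (n : ℕ)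
    [IsProbabilityMeasure (P.map (X 0))] :
    variance (selfIntersection X α n) P =
      variance (selfIntersection (simpleIncrement d) α n) (pathLaw (P.map (X 0))) := by
  have hlaw : P.map (fun ω i => X i ω) = pathLaw (P.map (X 0)) := by
    rw [(iIndepFun_iff_map_fun_eq_infinitePi_map hX.measurable).1 hX.indep]
    unfold pathLaw
    congr 1
    funext i
    exact (hX.identDistrib i).map_eq
  rw [← hlaw, variance_map (measurable_selfIntersection hα n).aemeasurable
    (measurable_pi_lambda _ hX.measurable).aemeasurable]
  rfl

theorem selfIntersection_of_le_one {α : ℕ} (hα : 1 ≤ α) {n : ℕ} (hn : n ≤ 1)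
    (ω : ℕ → Fin d → ℤ) : selfIntersection (simpleIncrement d) α n ω = n := by
  classical
  have : Nonempty (Fin α) := ⟨⟨0, hα⟩⟩
  rw [selfIntersection_eq_card hα, Finset.filter_true_of_mem]
  · rw [timeTuples, Fintype.card_piFinset_const]
    interval_cases n
    · simp; omega
    · simp
  · intro f hf i j
    have h1 := Finset.mem_Icc.1 (mem_timeTuples.1 hf i)
    have h2 := Finset.mem_Icc.1 (mem_timeTuples.1 hf j)
    rw [show f i = f j by omega]

theorem selfIntersection_one (n : ℕ) (ω : ℕ → Fin d → ℤ) :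
    selfIntersection (simpleIncrement d) 1 n ω = n := by
  classical
  rw [selfIntersection_eq_card le_rfl, Finset.filter_true_of_mem]
  · rw [timeTuples, Fintype.card_piFinset_const]; simp
  · intro f _ i j
    rw [Subsingleton.elim i j]

theorem variance_eq_zero_of_eq_const {F : (ℕ → Fin d → ℤ) → ℝ} {c : ℝ} (h : ∀ ω, F ω = c) :
    variance F (pathLaw μ) = 0 := by
  have : F = fun _ => c := funext h
  rw [this, variance_eq_integral (by fun_prop)]
  simp

end RandomWalk

end

/-! ### The decay profile -/

noncomputable section

namespace RandomWalk

theorem pairBound_le_sum_perm (β : ℕ → ENNReal) (a b c : ℕ) :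
    pairBound β a b c ≤
      (if a ≤ b ∧ b ≤ c then β b * β c else 0) + (if a ≤ c ∧ c ≤ b then β c * β b else 0) +
      (if b ≤ a ∧ a ≤ c then β a * β c else 0) + (if b ≤ c ∧ c ≤ a then β c * β a else 0) +
      (if c ≤ a ∧ a ≤ b then β a * β b else 0) + (if c ≤ b ∧ b ≤ a then β b * β a else 0) := by
  have h1 : pairBound β a b c ≤ β b * β c := min_le_left _ _
  have h2 : pairBound β a b c ≤ β a * β c := (min_le_right _ _).trans (min_le_left _ _)
  have h3 : pairBound β a b c ≤ β a * β b := (min_le_right _ _).trans (min_le_right _ _)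
  rcases le_total a b with hab | hab <;> rcases le_total b c with hbc | hbc <;>
    rcases le_total a c with hac | hac
  · rw [if_pos ⟨hab, hbc⟩]; simp only [add_assoc]; exact h1.trans le_self_add
  · rw [if_pos ⟨hab, hbc⟩]; simp only [add_assoc]; exact h1.trans le_self_add
  · rw [if_pos (⟨hac, hbc⟩ : a ≤ c ∧ c ≤ b), mul_comm (β c) (β b)]
    exact le_add_right (le_add_right (le_add_right (le_add_right (le_add_left h1))))
  · rw [if_pos (⟨hac, hab⟩ : c ≤ a ∧ a ≤ b)]
    exact le_add_right (le_add_left h3)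
  · rw [if_pos (⟨hab, hac⟩ : b ≤ a ∧ a ≤ c)]
    exact le_add_right (le_add_right (le_add_right (le_add_left h2)))
  · rw [if_pos (⟨hbc, hac⟩ : b ≤ c ∧ c ≤ a), mul_comm (β c) (β a)]
    exact le_add_right (le_add_right (le_add_left h2))
  · rw [if_pos (⟨hbc, hab⟩ : c ≤ b ∧ b ≤ a), mul_comm (β b) (β a)]
    exact le_add_left h3
  · rw [if_pos (⟨hbc, hab⟩ : c ≤ b ∧ b ≤ a), mul_comm (β b) (β a)]
    exact le_add_left h3

/-- The six orderings of the gaps contribute equally. In each, the two largest gaps `b ≤ c` carry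
the factors `β b * β c`, and the smallest has at most `b + 1` values. -/
theorem pairSum_le (β : ℕ → ENNReal) (n : ℕ) :
    pairSum β n ≤ 6 * ∑ c ∈ Finset.range (n + 1), β c *
      ∑ b ∈ Finset.range (c + 1), (b + 1) * β b := by
  set I := Finset.range (n + 1) with hI
  set f : ℕ → ℕ → ℕ → ENNReal := fun a b c => if a ≤ b ∧ b ≤ c then β b * β c else 0 with hf
  set S : (ℕ → ℕ → ℕ → ENNReal) → ENNReal := fun g => ∑ a ∈ I, ∑ b ∈ I, ∑ c ∈ I, g a b c with hS
  have s1 : ∀ g, S (fun a b c => g b a c) = S g := fun g => Finset.sum_comm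
  have s2 : ∀ g, S (fun a b c => g a c b) = S g := fun g =>
    Finset.sum_congr rfl fun a _ => Finset.sum_comm
  have key : pairSum β n ≤ S f + S f + S f + S f + S f + S f := by
    calc pairSum β n ≤ S (fun a b c => f a b c + f a c b + f b a c + f b c a + f c a b + f c b a) :=
          Finset.sum_le_sum fun a _ => Finset.sum_le_sum fun b _ => Finset.sum_le_sum fun c _ =>
            pairBound_le_sum_perm β a b c
      _ = S f + S (fun a b c => f a c b) + S (fun a b c => f b a c) + S (fun a b c => f b c a) +
          S (fun a b c => f c a b) + S (fun a b c => f c b a) := by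
          simp only [hS, Finset.sum_add_distrib]
      _ = _ := by
          have e3 : S (fun a b c => f b c a) = S f := by
            rw [s1 (fun a b c => f a c b), s2]
          have e4 : S (fun a b c => f c a b) = S f := by
            rw [s2 (fun a b c => f b a c), s1]
          have e5 : S (fun a b c => f c b a) = S f := by
            rw [s2 (fun a b c => f b c a), e3]
          rw [s2 f, s1 f, e3, e4, e5]
  have hSf : S f ≤ ∑ c ∈ I, β c * ∑ b ∈ Finset.range (c + 1), (b + 1) * β b := by
    have : S f = ∑ c ∈ I, ∑ b ∈ I, ∑ a ∈ I, f a b c := by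
      calc S f = ∑ a ∈ I, ∑ c ∈ I, ∑ b ∈ I, f a b c :=
            Finset.sum_congr rfl fun a _ => Finset.sum_comm
        _ = ∑ c ∈ I, ∑ a ∈ I, ∑ b ∈ I, f a b c := Finset.sum_comm
        _ = _ := Finset.sum_congr rfl fun a _ => Finset.sum_comm
    rw [this]
    refine Finset.sum_le_sum fun c hc => ?_
    rw [Finset.mul_sum]
    calc _ ≤ ∑ b ∈ I, (if b ≤ c then β c * ((b + 1) * β b) else 0) := by
          refine Finset.sum_le_sum fun b _ => ?_
          simp only [hf]
          split_ifs with hbc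
          · simp only [hbc, and_true]
            rw [← Finset.sum_filter, Finset.sum_const, nsmul_eq_mul]
            have : ((I.filter (· ≤ b)).card : ENNReal) ≤ b + 1 := by
              have h := Finset.card_le_card (show I.filter (· ≤ b) ⊆ Finset.range (b + 1) from
                fun x hx => Finset.mem_range.2 (by have := (Finset.mem_filter.1 hx).2; omega))
              rw [Finset.card_range] at h
              exact_mod_cast h
            calc _ ≤ (b + 1 : ENNReal) * (β b * β c) := by gcongr
              _ = _ := by ring
          · simp [hbc]
      _ ≤ _ := by
          rw [← Finset.sum_filter]
          exact Finset.sum_le_sum_of_subset fun x hx => Finset.mem_range.2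
            (by have := (Finset.mem_filter.1 hx).2; omega)
  refine key.trans ?_
  calc _ = 6 * S f := by ring
    _ ≤ _ := by gcongr

/-- The decay profile `(m + 1) ^ (-d / 2)`. -/
def decay (d m : ℕ) : ℝ := ((m : ℝ) + 1) ^ (-(d : ℝ) / 2)

theorem decay_pos (d m : ℕ) : 0 < decay d m := by unfold decay; positivity

theorem decay_antitone (d : ℕ) : Antitone (decay d) := by
  intro a b h
  unfold decay
  refine Real.rpow_le_rpow_of_nonpos (by positivity) (by gcongr) ?_
  have : (0 : ℝ) ≤ d := by positivity
  linarith

theorem decay_half_le (d m : ℕ) : decay d (m / 2) ≤ 2 ^ ((d : ℝ) / 2) * decay d m := by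
  unfold decay
  have h : ((m : ℝ) + 1) / 2 ≤ ((m / 2 : ℕ) : ℝ) + 1 := by
    have : m + 1 ≤ 2 * (m / 2 + 1) := by omega
    have : ((m + 1 : ℕ) : ℝ) ≤ ((2 * (m / 2 + 1) : ℕ) : ℝ) := by exact_mod_cast this
    push_cast at this
    linarith
  have hd : -(d : ℝ) / 2 ≤ 0 := by
    have : (0 : ℝ) ≤ d := by positivity
    linarith
  calc _ ≤ (((m : ℝ) + 1) / 2) ^ (-(d : ℝ) / 2) :=
        Real.rpow_le_rpow_of_nonpos (by positivity) h hd
    _ = _ := by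
        rw [Real.div_rpow (by positivity) (by positivity), neg_div, Real.rpow_neg two_pos.le]
        field_simp

theorem decay_zero (d : ℕ) : decay d 0 = 1 := by simp [decay]

theorem decay_add_two (d m : ℕ) : decay (d + 2) m = decay d m / (m + 1) := by
  unfold decay
  have : -((d + 2 : ℕ) : ℝ) / 2 = -(d : ℝ) / 2 - 1 := by push_cast; ring
  rw [this, Real.rpow_sub_one (by positivity)]

theorem decay_one (m : ℕ) : decay 1 m = (√((m : ℝ) + 1))⁻¹ := by
  unfold decay
  rw [Real.sqrt_eq_rpow, ← Real.rpow_neg (by positivity)]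
  congr 1; norm_num

theorem decay_two (m : ℕ) : decay 2 m = ((m : ℝ) + 1)⁻¹ := by
  rw [decay_add_two 0]; simp [decay]

theorem decay_le_of_le {d e : ℕ} (h : e ≤ d) (m : ℕ) : decay d m ≤ decay e m := by
  unfold decay
  refine Real.rpow_le_rpow_of_exponent_le (by simp) ?_
  have : (e : ℝ) ≤ d := by exact_mod_cast h
  linarith

theorem sum_decay_one_le (n : ℕ) : ∑ m ∈ Finset.range n, decay 1 m ≤ 2 * √n := by
  induction n with
  | zero => simp
  | succ n ih =>
    rw [Finset.sum_range_succ]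
    refine (add_le_add_left ih _).trans ?_
    rw [decay_one]
    push_cast
    have h1 : 0 < √((n : ℝ) + 1) := by positivity
    have h2 : √(n : ℝ) ^ 2 = n := Real.sq_sqrt (by positivity)
    have h3 : √((n : ℝ) + 1) ^ 2 = n + 1 := Real.sq_sqrt (by positivity)
    rw [← sub_nonneg]
    -- The increment of `2 √n` exceeds the new term by a perfect square over `√(n + 1)`.
    have : 2 * √((n : ℝ) + 1) - (2 * √(n : ℝ) + (√((n : ℝ) + 1))⁻¹) =
        (√((n : ℝ) + 1) - √(n : ℝ)) ^ 2 / √((n : ℝ) + 1) := by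
      field_simp
      nlinarith
    rw [this]; positivity

theorem sum_decay_two_le (n : ℕ) :
    ∑ m ∈ Finset.range n, decay 2 m ≤ 1 + Real.log n := by
  have := harmonic_le_one_add_log n
  refine le_trans (le_of_eq ?_) this
  simp [harmonic, decay_two]

theorem exists_sum_decay_three_le : ∃ K, 1 ≤ K ∧ ∀ n, ∑ m ∈ Finset.range n, decay 3 m ≤ K := by
  have hs : Summable (decay 3) := by
    have := (summable_nat_add_iff 1).2 (Real.summable_nat_rpow.2 (show (-(3 : ℝ) / 2) < -1 by norm_num))
    refine this.congr fun m => ?_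
    simp [decay]
  refine ⟨max 1 (∑' m, decay 3 m), le_max_left _ _, fun n => ?_⟩
  exact (hs.sum_le_tsum _ fun i _ => (decay_pos 3 i).le).trans (le_max_right _ _)

/-- The partial sums of the decay profile. -/
def decaySum (d n : ℕ) : ℝ := ∑ m ∈ Finset.range (n + 1), decay d m

/-- The double sum of `(b + 1) (b + 1) ^ (-d / 2) (c + 1) ^ (-d / 2)` over `b ≤ c ≤ n`. -/
def decayPairSum (d n : ℕ) : ℝ :=
  ∑ c ∈ Finset.range (n + 1), decay d c * ∑ b ∈ Finset.range (c + 1), ((b : ℝ) + 1) * decay d b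

theorem succ_mul_decay_add_two (d b : ℕ) : ((b : ℝ) + 1) * decay (d + 2) b = decay d b := by
  rw [decay_add_two]; field_simp

theorem decaySum_nonneg (d n : ℕ) : 0 ≤ decaySum d n :=
  Finset.sum_nonneg fun _ _ => (decay_pos _ _).le

theorem decayPairSum_nonneg (d n : ℕ) : 0 ≤ decayPairSum d n :=
  Finset.sum_nonneg fun _ _ => mul_nonneg (decay_pos _ _).le (Finset.sum_nonneg fun _ _ =>
    mul_nonneg (by positivity) (decay_pos _ _).le)

theorem decayPairSum_one_le (n : ℕ) : decayPairSum 1 n ≤ ((n : ℝ) + 1) ^ 2 := by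
  calc decayPairSum 1 n ≤ ∑ c ∈ Finset.range (n + 1), ((n : ℝ) + 1) := by
        refine Finset.sum_le_sum fun c hc => ?_
        have hc := Finset.mem_range.1 hc
        calc _ ≤ decay 1 c * ∑ b ∈ Finset.range (c + 1), √((c : ℝ) + 1) := by
              gcongr with b hb
              · exact (decay_pos _ _).le
              · have hb := Finset.mem_range.1 hb
                rw [decay_one]
                have : ((b : ℝ) + 1) * (√((b : ℝ) + 1))⁻¹ = √((b : ℝ) + 1) := by
                  rw [← div_eq_mul_inv, Real.div_sqrt]
                rw [this]
                gcongr
                omega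
          _ = (c : ℝ) + 1 := by
              rw [Finset.sum_const, Finset.card_range, nsmul_eq_mul, decay_one]
              have : √((c : ℝ) + 1) ≠ 0 := by positivity
              push_cast; field_simp
          _ ≤ _ := by gcongr; omega
    _ = _ := by rw [Finset.sum_const, Finset.card_range, nsmul_eq_mul]; push_cast; ring

theorem decayPairSum_two (n : ℕ) : decayPairSum 2 n = (n : ℝ) + 1 := by
  unfold decayPairSum
  calc _ = ∑ c ∈ Finset.range (n + 1), (1 : ℝ) := by
        refine Finset.sum_congr rfl fun c _ => ?_
        simp only [succ_mul_decay_add_two 0]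
        rw [decay_two]
        simp only [decay, CharP.cast_eq_zero, neg_zero, zero_div, Real.rpow_zero,
          Finset.sum_const, Finset.card_range, nsmul_eq_mul, mul_one]
        push_cast; field_simp
    _ = _ := by simp

theorem decayPairSum_three_le (n : ℕ) : decayPairSum 3 n ≤ 2 * (1 + Real.log (n + 1)) := by
  calc decayPairSum 3 n ≤ ∑ c ∈ Finset.range (n + 1), 2 * decay 2 c := by
        refine Finset.sum_le_sum fun c hc => ?_
        simp only [succ_mul_decay_add_two 1]
        refine (mul_le_mul_of_nonneg_left (sum_decay_one_le (c + 1)) (decay_pos _ _).le).trans ?_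
        rw [decay_add_two 1, decay_one, decay_two]
        push_cast
        have : √((c : ℝ) + 1) ≠ 0 := by positivity
        apply le_of_eq; field_simp
    _ ≤ _ := by
        rw [← Finset.mul_sum]
        have := sum_decay_two_le (n + 1)
        push_cast at this
        gcongr

theorem exists_decayPairSum_le : ∃ K, 0 ≤ K ∧ ∀ d, 4 ≤ d → ∀ n, decayPairSum d n ≤ K := by
  obtain ⟨K, hK1, hK⟩ := exists_sum_decay_three_le
  refine ⟨2 * K, by linarith, fun d hd n => ?_⟩
  calc decayPairSum d n ≤ ∑ c ∈ Finset.range (n + 1), 2 * decay 3 c := by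
        refine Finset.sum_le_sum fun c hc => ?_
        -- A wasteful bound: for `d = 4` the inner sum is only logarithmic, but bounding it by a
        -- square root still leaves the summable profile of exponent `-3 / 2`.
        calc _ ≤ decay 4 c * ∑ b ∈ Finset.range (c + 1), decay 1 b := by
              refine mul_le_mul (decay_le_of_le hd c) (Finset.sum_le_sum fun b _ => ?_)
                (Finset.sum_nonneg fun b _ => mul_nonneg (by positivity) (decay_pos _ _).le)
                (decay_pos _ _).le
              rw [← succ_mul_decay_add_two 1]
              exact mul_le_mul_of_nonneg_left (decay_le_of_le (by omega) b) (by positivity)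
          _ ≤ decay 4 c * (2 * √((c + 1 : ℕ) : ℝ)) := by
              gcongr
              · exact (decay_pos _ _).le
              · exact sum_decay_one_le (c + 1)
          _ = 2 * decay 3 c := by
              rw [decay_add_two 2, decay_add_two 1, decay_one, decay_two]
              push_cast
              have h : √((c : ℝ) + 1) ≠ 0 := by positivity
              have h2 : √((c : ℝ) + 1) ^ 2 = c + 1 := Real.sq_sqrt (by positivity)
              field_simp
              exact h2
    _ ≤ _ := by
        rw [← Finset.mul_sum]
        gcongr
        exact hK _

end RandomWalk

end

/-! ### Upper bound for the variance -/

noncomputable section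

namespace RandomWalk

theorem one_add_log_succ_le {n : ℕ} (hn : 2 ≤ n) :
    1 + Real.log (n + 1) ≤ 4 * Real.log n := by
  have h2 : (2 : ℝ) ≤ n := by exact_mod_cast hn
  have h1 : Real.log (n + 1) ≤ 2 * Real.log n := by
    have : Real.log ((n : ℝ) ^ 2) = 2 * Real.log n := by rw [Real.log_pow]; norm_num
    rw [← this]
    exact Real.log_le_log (by positivity) (by nlinarith)
  have h3 : Real.log 2 ≤ Real.log n := Real.log_le_log (by norm_num) h2
  have := Real.log_two_gt_d9
  linarith

theorem log_sq_le (n : ℕ) : Real.log n ^ 2 ≤ 4 * n := by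
  rcases Nat.eq_zero_or_pos n with rfl | hn
  · simp
  have hn' : (1 : ℝ) ≤ n := by exact_mod_cast hn
  have h1 : Real.log n = 2 * Real.log (√(n : ℝ)) := by
    rw [Real.log_sqrt (by positivity)]; ring
  have h2 : Real.log (√(n : ℝ)) ≤ √(n : ℝ) := Real.log_le_self (by positivity)
  have h3 : 0 ≤ Real.log (√(n : ℝ)) := Real.log_nonneg (by rw [Real.one_le_sqrt]; exact hn')
  have h4 : √(n : ℝ) ^ 2 = n := Real.sq_sqrt (by positivity)
  rw [h1]
  nlinarith [pow_le_pow_left₀ h3 h2 2]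

theorem varianceOrder_nonneg (d α n : ℕ) : 0 ≤ varianceOrder d α n := by
  have : 0 ≤ Real.log n := Real.log_natCast_nonneg n
  unfold varianceOrder
  split_ifs <;> positivity

theorem varianceOrder_two (k n : ℕ) :
    varianceOrder 2 (k + 2) n = (n : ℝ) ^ 2 * Real.log n ^ (2 * k) := by
  unfold varianceOrder
  rw [if_neg (by norm_num), if_pos rfl]
  congr 1
  rw [← zpow_natCast]
  congr 1
  push_cast; ring

/-- The partial sums are of order `√n`, `log n`, `1`, `1` in dimensions one, two, three and at least
four, and the pair sums of order `n ^ 2`, `n`, `log n`, `1`. The crossing term has the order of the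
variance; the tie term is never larger, up to constants. -/
theorem exists_decay_bound_le_varianceOrder {d : ℕ} (hd : 1 ≤ d) (k : ℕ) :
    ∃ K, 0 ≤ K ∧ ∀ n : ℕ, 2 ≤ n → ((n : ℝ) + 1) * (decaySum d n ^ (2 * (k + 1)) +
      decaySum d n ^ (2 * k) * decayPairSum d n) ≤ K * varianceOrder d (k + 2) n := by
  have hS := decaySum_nonneg d
  have hQ := decayPairSum_nonneg d
  rcases (by omega : d = 1 ∨ d = 2 ∨ d = 3 ∨ 4 ≤ d) with rfl | rfl | rfl | hd4
  · refine ⟨2 * 4 ^ (k + 1) * 2 ^ (k + 3), by positivity, fun n hn => ?_⟩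
    have hn' : (2 : ℝ) ≤ n := by exact_mod_cast hn
    have h1 : decaySum 1 n ^ 2 ≤ 4 * ((n : ℝ) + 1) := by
      have h := pow_le_pow_left₀ (hS n) (sum_decay_one_le (n + 1)) 2
      rw [mul_pow, Real.sq_sqrt (by positivity)] at h
      push_cast at h
      linarith
    have h2 := decayPairSum_one_le n
    unfold varianceOrder
    rw [if_pos rfl]
    calc _ ≤ ((n : ℝ) + 1) * ((4 * ((n : ℝ) + 1)) ^ (k + 1) +
          (4 * ((n : ℝ) + 1)) ^ k * ((n : ℝ) + 1) ^ 2) := by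
          rw [pow_mul, pow_mul]
          have := hQ n
          gcongr
      _ = 4 ^ (k + 1) * ((n : ℝ) + 1) ^ (k + 2) * 1 + 4 ^ k * ((n : ℝ) + 1) ^ (k + 3) := by
          rw [mul_pow, mul_pow]; ring
      _ ≤ 4 ^ (k + 1) * ((n : ℝ) + 1) ^ (k + 2) * (n + 1) +
          4 ^ (k + 1) * ((n : ℝ) + 1) ^ (k + 3) := by
          gcongr <;> linarith
      _ = 2 * 4 ^ (k + 1) * ((n : ℝ) + 1) ^ (k + 3) := by ring
      _ ≤ 2 * 4 ^ (k + 1) * (2 * (n : ℝ)) ^ (k + 3) := by gcongr; linarith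
      _ = _ := by rw [mul_pow]; ring
  · refine ⟨132 * 16 ^ k, by positivity, fun n hn => ?_⟩
    have hn' : (2 : ℝ) ≤ n := by exact_mod_cast hn
    have hl : 0 ≤ Real.log n := Real.log_natCast_nonneg n
    have h1 : decaySum 2 n ≤ 4 * Real.log n := by
      have h := sum_decay_two_le (n + 1)
      push_cast at h
      exact h.trans (one_add_log_succ_le hn)
    have h3 := log_sq_le n
    rw [varianceOrder_two, decayPairSum_two]
    have := hS n
    calc _ ≤ ((n : ℝ) + 1) * ((4 * Real.log n) ^ (2 * (k + 1)) +
          (4 * Real.log n) ^ (2 * k) * ((n : ℝ) + 1)) := by gcongr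
      _ = ((n : ℝ) + 1) * (16 ^ k * Real.log n ^ (2 * k) *
          (16 * Real.log n ^ 2 + ((n : ℝ) + 1))) := by
          have : (16 : ℝ) ^ k = 4 ^ (2 * k) := by rw [pow_mul]; norm_num
          rw [this]; ring
      -- Here `66 = 16 * 4 + 2`, from `Real.log n ^ 2 ≤ 4 * n` for the tie term and `n + 1 ≤ 2 * n`
      -- for the crossing term.
      _ ≤ (2 * (n : ℝ)) * (16 ^ k * Real.log n ^ (2 * k) * (66 * n)) := by
          gcongr <;> linarith
      _ = _ := by ring
  · obtain ⟨K, hK1, hK⟩ := exists_sum_decay_three_le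
    refine ⟨4 * K ^ (2 * (k + 1)) + 16 * K ^ (2 * k), by positivity, fun n hn => ?_⟩
    have hn' : (2 : ℝ) ≤ n := by exact_mod_cast hn
    have hl := one_add_log_succ_le hn
    have hl0 : 0 ≤ Real.log ((n : ℝ) + 1) := Real.log_nonneg (by linarith)
    have hl1 : 1 ≤ 2 * Real.log n := by
      have h3 : Real.log 2 ≤ Real.log n := Real.log_le_log (by norm_num) hn'
      have := Real.log_two_gt_d9
      linarith
    have hln : 0 ≤ Real.log n := by linarith
    have h1 : decaySum 3 n ≤ K := hK _
    have h2 := decayPairSum_three_le n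
    have := hS n
    have := hQ n
    unfold varianceOrder
    rw [if_neg (by norm_num), if_neg (by norm_num), if_pos rfl]
    calc _ ≤ (2 * (n : ℝ)) * (K ^ (2 * (k + 1)) * (2 * Real.log n) +
          K ^ (2 * k) * (2 * (4 * Real.log n))) := by
          refine mul_le_mul (by linarith) (add_le_add ?_ ?_) (by positivity) (by positivity)
          · calc _ ≤ K ^ (2 * (k + 1)) := by gcongr
              _ ≤ _ := le_mul_of_one_le_right (by positivity) hl1
          · gcongr
            linarith
      _ = _ := by ring
  · obtain ⟨K, hK1, hK⟩ := exists_sum_decay_three_le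
    obtain ⟨K', hK0', hK'⟩ := exists_decayPairSum_le
    refine ⟨2 * (K ^ (2 * (k + 1)) + K ^ (2 * k) * K'), by positivity, fun n hn => ?_⟩
    have hn' : (2 : ℝ) ≤ n := by exact_mod_cast hn
    have h1 : decaySum d n ≤ K :=
      (Finset.sum_le_sum fun m _ => decay_le_of_le (by omega) m).trans (hK (n + 1))
    have h2 := hK' d hd4 n
    have := hS n
    have := hQ n
    unfold varianceOrder
    rw [if_neg (by omega), if_neg (by omega), if_neg (by omega)]
    calc _ ≤ (2 * (n : ℝ)) * (K ^ (2 * (k + 1)) + K ^ (2 * k) * K') := by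
          gcongr; linarith
      _ = _ := by ring

variable {d : ℕ} {μ : Measure (Fin d → ℤ)} [IsProbabilityMeasure μ]

theorem isDecayBound_decay {C : ℝ} (hC : 0 ≤ C)
    (h : ∀ m x, stepProb μ m x ≤ ENNReal.ofReal (C * decay d m)) :
    IsDecayBound μ (fun m => ENNReal.ofReal (C * decay d m))
      (ENNReal.ofReal (2 ^ ((d : ℝ) / 2))) where
  stepProb_le := h
  antitone := fun a b hab => ENNReal.ofReal_le_ofReal
    (mul_le_mul_of_nonneg_left (decay_antitone d hab) hC)
  half_le := fun m => by
    rw [← ENNReal.ofReal_mul (by positivity)]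
    refine ENNReal.ofReal_le_ofReal ?_
    have := mul_le_mul_of_nonneg_left (decay_half_le d m) hC
    linarith
  one_le := by
    rw [ENNReal.one_le_ofReal]
    exact Real.one_le_rpow (by norm_num) (by positivity)

theorem partialSum_decay {C : ℝ} (hC : 0 ≤ C) (n : ℕ) :
    partialSum (fun m => ENNReal.ofReal (C * decay d m)) n =
      ENNReal.ofReal (C * decaySum d n) := by
  unfold partialSum decaySum
  rw [Finset.mul_sum, ENNReal.ofReal_sum_of_nonneg]
  exact fun m _ => mul_nonneg hC (decay_pos d m).le

theorem pairSum_decay_le {C : ℝ} (hC : 0 ≤ C) (n : ℕ) :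
    pairSum (fun m => ENNReal.ofReal (C * decay d m)) n ≤
      ENNReal.ofReal (6 * C ^ 2 * decayPairSum d n) := by
  refine (pairSum_le _ n).trans (le_of_eq ?_)
  have h0 : ∀ m, 0 ≤ C * decay d m := fun m => mul_nonneg hC (decay_pos d m).le
  have h1 : ∀ c : ℕ, ∑ b ∈ Finset.range (c + 1), ((b : ENNReal) + 1) *
      ENNReal.ofReal (C * decay d b) =
      ENNReal.ofReal (∑ b ∈ Finset.range (c + 1), ((b : ℝ) + 1) * (C * decay d b)) := by
    intro c
    rw [ENNReal.ofReal_sum_of_nonneg fun b _ => mul_nonneg (by positivity) (h0 b)]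
    refine Finset.sum_congr rfl fun b _ => ?_
    rw [ENNReal.ofReal_mul (p := (b : ℝ) + 1) (by positivity)]
    congr 1
    rw [ENNReal.ofReal_add (by positivity) zero_le_one]; simp
  have h2 : ∀ c : ℕ, 0 ≤ ∑ b ∈ Finset.range (c + 1), ((b : ℝ) + 1) * (C * decay d b) :=
    fun c => Finset.sum_nonneg fun b _ => mul_nonneg (by positivity) (h0 b)
  simp only [h1]
  have h6 : (6 : ENNReal) = ENNReal.ofReal 6 := by simp
  simp only [← ENNReal.ofReal_mul (h0 _)]
  rw [← ENNReal.ofReal_sum_of_nonneg fun c _ => mul_nonneg (h0 c) (h2 c), h6,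
    ← ENNReal.ofReal_mul (by norm_num)]
  congr 1
  unfold decayPairSum
  simp only [Finset.mul_sum]
  refine Finset.sum_congr rfl fun c _ => Finset.sum_congr rfl fun b _ => ?_
  ring

theorem exists_variance_le_varianceOrder (hd : 1 ≤ d) {α : ℕ} (hα : 2 ≤ α)
    (hμ : ∃ C : ℝ, ∀ m x, stepProb μ m x ≤ ENNReal.ofReal (C * decay d m)) :
    ∃ A : ℝ, 0 ≤ A ∧ ∀ n, 2 ≤ n →
      variance (selfIntersection (simpleIncrement d) α n) (pathLaw μ) ≤
        A * varianceOrder d α n := by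
  obtain ⟨C', hC'⟩ := hμ
  set C := max C' 1
  have hC1 : 1 ≤ C := le_max_right _ _
  have hC0 : 0 ≤ C := by linarith
  have hC : ∀ m x, stepProb μ m x ≤ ENNReal.ofReal (C * decay d m) := fun m x =>
    (hC' m x).trans (ENNReal.ofReal_le_ofReal
      (mul_le_mul_of_nonneg_right (le_max_left _ _) (decay_pos d m).le))
  obtain ⟨k, rfl⟩ : ∃ k, α = k + 2 := ⟨α - 2, by omega⟩
  have : Nonempty (Fin (k + 2)) := ⟨0⟩
  obtain ⟨K, hK, hsum⟩ := exists_sum_coProb₂_le (ι := Fin (k + 2)) (isDecayBound_decay hC0 hC)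
    ENNReal.ofReal_ne_top ENNReal.ofReal_ne_top
  obtain ⟨B, hB0, hB⟩ := exists_decay_bound_le_varianceOrder hd k
  refine ⟨K.toReal * (6 * C ^ (2 * (k + 1)) * B), by positivity, fun n hn => ?_⟩
  have hS := decaySum_nonneg d n
  have hQ := decayPairSum_nonneg d n
  have hfin : K * ENNReal.ofReal (6 * C ^ (2 * (k + 1)) * (((n : ℝ) + 1) *
      (decaySum d n ^ (2 * (k + 1)) + decaySum d n ^ (2 * k) * decayPairSum d n))) ≠ ⊤ := by
    finiteness
  refine (variance_le_of_sum_coProb₂_le (by omega) n hfin ((hsum n).trans ?_)).trans ?_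
  · gcongr
    have e1 : 2 * (Fintype.card (Fin (k + 2)) - 1) = 2 * (k + 1) := by simp
    have e2 : 2 * (Fintype.card (Fin (k + 2)) - 2) = 2 * k := by simp
    rw [e1, e2, partialSum_decay hC0]
    have hn1 : ((n : ENNReal) + 1) = ENNReal.ofReal ((n : ℝ) + 1) := by
      rw [ENNReal.ofReal_add (by positivity) zero_le_one]; simp
    calc _ ≤ ENNReal.ofReal ((n : ℝ) + 1) * (ENNReal.ofReal (C * decaySum d n) ^ (2 * (k + 1)) +
          ENNReal.ofReal (C * decaySum d n) ^ (2 * k) *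
            ENNReal.ofReal (6 * C ^ 2 * decayPairSum d n)) := by
          rw [hn1]
          gcongr
          exact pairSum_decay_le hC0 n
      _ = ENNReal.ofReal (((n : ℝ) + 1) * ((C * decaySum d n) ^ (2 * (k + 1)) +
          (C * decaySum d n) ^ (2 * k) * (6 * C ^ 2 * decayPairSum d n))) := by
          rw [← ENNReal.ofReal_pow (by positivity), ← ENNReal.ofReal_pow (by positivity),
            ← ENNReal.ofReal_mul (by positivity), ← ENNReal.ofReal_add (by positivity)
            (by positivity), ← ENNReal.ofReal_mul (by positivity)]
      _ ≤ _ := by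
          refine ENNReal.ofReal_le_ofReal ?_
          calc _ = ((n : ℝ) + 1) * (C ^ (2 * (k + 1)) * decaySum d n ^ (2 * (k + 1)) +
                6 * C ^ (2 * (k + 1)) * (decaySum d n ^ (2 * k) * decayPairSum d n)) := by
                rw [mul_pow, mul_pow]; ring
            _ ≤ ((n : ℝ) + 1) * (6 * C ^ (2 * (k + 1)) * decaySum d n ^ (2 * (k + 1)) +
                6 * C ^ (2 * (k + 1)) * (decaySum d n ^ (2 * k) * decayPairSum d n)) := by
                gcongr
                exact le_mul_of_one_le_left (by positivity) (by norm_num)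
            _ = _ := by ring
  · rw [ENNReal.toReal_mul, ENNReal.toReal_ofReal (by positivity)]
    have := hB n hn
    calc _ ≤ K.toReal * (6 * C ^ (2 * (k + 1)) * (B * varianceOrder d (k + 2) n)) := by gcongr
      _ = _ := by ring

end RandomWalk

end

/-! ### Characteristic functions -/

noncomputable section

namespace RandomWalk

open Complex in
/-- The characteristic function of `μ`. -/
def char {d : ℕ} (μ : Measure (Fin d → ℤ)) (θ : Fin d → ℝ) : ℂ :=
  ∫ x, exp ((∑ k, θ k * (x k : ℝ) : ℝ) * I) ∂μ

variable {d : ℕ} (μ : Measure (Fin d → ℤ)) [IsProbabilityMeasure μ]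

open Complex

theorem integral_glue (s : ℕ) {F : (ℕ → Fin d → ℤ) → ℂ} (hF : Measurable F) :
    ∫ ω, F ω ∂pathLaw μ =
      ∫ p, F (glue s p.1 p.2) ∂(pathLaw μ).prod (pathLaw μ) := by
  conv_lhs => rw [← map_glue μ s]
  rw [integral_map (by fun_prop) hF.aestronglyMeasurable]

theorem measurable_exp_freq (θ : Fin d → ℝ) :
    Measurable (fun x : Fin d → ℤ => exp ((∑ k, θ k * (x k : ℝ) : ℝ) * I)) :=
  Measurable.of_discrete

theorem integral_pos_one {f : (Fin d → ℤ) → ℂ} :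
    ∫ ω, f (pos 1 ω) ∂pathLaw μ = ∫ x, f x ∂μ := by
  have h : (pathLaw μ).map (fun ω => pos 1 ω) = μ := by
    have : (fun ω : ℕ → Fin d → ℤ => pos 1 ω) = fun ω => ω 0 := by
      funext ω; rw [pos_succ]; simp
    rw [this]; exact Measure.infinitePi_map_eval _ 0
  conv_rhs => rw [← h]
  rw [integral_map (by fun_prop) (Measurable.of_discrete).aestronglyMeasurable]

theorem integral_exp_pos (θ : Fin d → ℝ) (m : ℕ) :
    ∫ ω, exp ((∑ k, θ k * (pos m ω k : ℝ) : ℝ) * I) ∂pathLaw μ = char μ θ ^ m := by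
  induction m with
  | zero => simp
  | succ m ih =>
    have hmeas : ∀ m, Measurable (fun ω : ℕ → Fin d → ℤ =>
        exp ((∑ k, θ k * (pos m ω k : ℝ) : ℝ) * I)) := fun m =>
      (measurable_exp_freq θ).comp (measurable_pos m)
    rw [integral_glue μ m (hmeas _), pow_succ, ← ih, char, ← integral_pos_one, ← integral_prod_mul]
    refine integral_congr_ae (ae_of_all _ fun p => ?_)
    simp only [pos_glue_add]
    rw [← exp_add, ← add_mul, ← ofReal_add, ← Finset.sum_add_distrib]
    congr 4
    funext k
    simp; ring

/-- The squared modulus is the characteristic function of the symmetrized step `X₁ - X₂`. This is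
why genuine dimensionality is stated for differences and why no moments are needed. -/
theorem norm_char_sq (θ : Fin d → ℝ) :
    ‖char μ θ‖ ^ 2 = ∫ p : (Fin d → ℤ) × (Fin d → ℤ),
      Real.cos (∑ k, θ k * ((p.1 - p.2) k : ℝ)) ∂μ.prod μ := by
  set f : (Fin d → ℤ) → ℝ := fun x => ∑ k, θ k * (x k : ℝ) with hf
  have hI : ∀ g : ℝ → ℝ, (∀ x, |g x| ≤ 1) → Integrable (fun x => g (f x)) μ := fun g hg =>
    Integrable.of_bound (Measurable.of_discrete).aestronglyMeasurable 1
      (ae_of_all _ fun x => hg _)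
  have hint : Integrable (fun x => exp ((f x : ℝ) * I)) μ :=
    Integrable.of_bound (measurable_exp_freq θ).aestronglyMeasurable 1
      (ae_of_all _ fun x => by rw [norm_exp_ofReal_mul_I])
  have hre : (char μ θ).re = ∫ x, Real.cos (f x) ∂μ := by
    rw [char, ← RCLike.re_eq_complex_re, ← integral_re hint]
    simp [exp_ofReal_mul_I_re]
  have him : (char μ θ).im = ∫ x, Real.sin (f x) ∂μ := by
    rw [char, ← RCLike.im_eq_complex_im, ← integral_im hint]
    simp [exp_ofReal_mul_I_im]
  have hc := hI Real.cos Real.abs_cos_le_one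
  have hs := hI Real.sin Real.abs_sin_le_one
  rw [← normSq_eq_norm_sq, normSq_apply, hre, him, ← integral_prod_mul, ← integral_prod_mul,
    ← integral_add (hc.mul_prod hc) (hs.mul_prod hs)]
  refine integral_congr_ae (ae_of_all _ fun p => ?_)
  simp only
  rw [← Real.cos_sub]
  congr 1
  rw [hf, ← Finset.sum_sub_distrib]
  refine Finset.sum_congr rfl fun k _ => ?_
  simp; ring

theorem norm_char_sq_le (θ : Fin d → ℝ) (z : Fin d → ℤ) :
    ‖char μ θ‖ ^ 2 ≤ 1 - (μ.prod μ).real {p | p.1 - p.2 = z} *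
      (1 - Real.cos (∑ k, θ k * (z k : ℝ))) := by
  set g : (Fin d → ℤ) → ℝ := fun y => Real.cos (∑ k, θ k * (y k : ℝ)) with hg
  have hA : MeasurableSet {p : (Fin d → ℤ) × (Fin d → ℤ) | p.1 - p.2 = z} :=
    MeasurableSet.of_discrete
  have hint : Integrable (fun p : (Fin d → ℤ) × (Fin d → ℤ) => g (p.1 - p.2)) (μ.prod μ) :=
    Integrable.of_bound (Measurable.of_discrete).aestronglyMeasurable 1
      (ae_of_all _ fun x => Real.abs_cos_le_one _)
  have h1 : ∫ p, {p : (Fin d → ℤ) × (Fin d → ℤ) | p.1 - p.2 = z}.indicator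
      (fun _ => 1 - g z) p ∂μ.prod μ ≤ ∫ p, (1 - g (p.1 - p.2)) ∂μ.prod μ := by
    refine integral_mono ((integrable_const _).indicator hA) ((integrable_const _).sub hint)
      fun p => ?_
    by_cases hp : p.1 - p.2 = z
    · rw [Set.indicator_of_mem (by exact hp)]; simp [hp]
    · rw [Set.indicator_of_notMem (by exact hp)]
      have := Real.cos_le_one (∑ k, θ k * ((p.1 - p.2) k : ℝ))
      simp only [hg]; linarith
  rw [integral_indicator_const _ hA, integral_sub (integrable_const _) hint] at h1
  have h2 := norm_char_sq μ θ
  simp only [smul_eq_mul, integral_const, probReal_univ, one_mul] at h1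
  simp only [hg] at h1
  linarith

/-- Average the single-atom bounds over `d` atoms `z k` of the difference and use `1 - t ≤ exp
(-t)`; passing from the squared modulus to the modulus halves the exponent. -/
theorem norm_char_pow_le {z : Fin d → Fin d → ℤ} {q : ℝ}
    (hq : ∀ k, q ≤ (μ.prod μ).real {p | p.1 - p.2 = z k}) (θ : Fin d → ℝ) (m : ℕ) :
    ‖char μ θ‖ ^ m ≤ ∏ k, Real.exp (-(m * q / (2 * d) *
      (1 - Real.cos (∑ i, θ i * (z k i : ℝ))))) := by
  rcases Nat.eq_zero_or_pos d with rfl | hd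
  · simp only [Finset.univ_eq_empty, Finset.prod_empty]
    refine pow_le_one₀ (norm_nonneg _) ?_
    simp [char]
  set t : ℝ := q / d * ∑ k, (1 - Real.cos (∑ i, θ i * (z k i : ℝ))) with ht
  have h1 : ‖char μ θ‖ ^ 2 ≤ 1 - t := by
    have : ∀ k, q * (1 - Real.cos (∑ i, θ i * (z k i : ℝ))) ≤ 1 - ‖char μ θ‖ ^ 2 := fun k => by
      have := norm_char_sq_le μ θ (z k)
      have h := mul_le_mul_of_nonneg_right (hq k)
        (sub_nonneg.2 (Real.cos_le_one (∑ i, θ i * (z k i : ℝ))))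
      linarith
    have h := Finset.sum_le_sum fun k (_ : k ∈ Finset.univ) => this k
    rw [← Finset.mul_sum, Finset.sum_const, Finset.card_univ, Fintype.card_fin, nsmul_eq_mul] at h
    have : t ≤ 1 - ‖char μ θ‖ ^ 2 := by
      rw [ht, div_mul_eq_mul_div, div_le_iff₀ (by positivity)]; linarith
    linarith
  have h2 : ‖char μ θ‖ ≤ Real.exp (-(t / 2)) := by
    refine le_of_sq_le_sq ?_ (Real.exp_pos _).le
    rw [← Real.exp_nat_mul]
    have := Real.add_one_le_exp (-t)
    have e : ((2 : ℕ) : ℝ) * -(t / 2) = -t := by push_cast; ring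
    rw [e]; linarith
  calc _ ≤ Real.exp (-(t / 2)) ^ m := by gcongr
    _ = Real.exp (m * -(t / 2)) := by rw [Real.exp_nat_mul]
    _ = _ := by
      rw [← Real.exp_sum]
      congr 1
      rw [Finset.sum_neg_distrib, ← Finset.mul_sum, ht]
      ring

theorem integral_exp_int_mul_I (n : ℤ) :
    ∫ t in Set.Icc (-Real.pi) Real.pi, exp (((t * n : ℝ)) * I) = if n = 0 then 2 * Real.pi else 0 := by
  rw [integral_Icc_eq_integral_Ioc, ← intervalIntegral.integral_of_le (by linarith [Real.pi_pos])]
  split_ifs with h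
  · subst h
    simp; ring
  · have hc : (n : ℂ) * I ≠ 0 := by simp [h]
    have := integral_exp_mul_complex (a := -Real.pi) (b := Real.pi) hc
    calc _ = ∫ x in -Real.pi..Real.pi, exp ((n : ℂ) * I * x) := by
          congr 1; funext x; congr 1; push_cast; ring
      _ = _ := by
          rw [this]
          have e : exp ((n : ℂ) * I * (Real.pi : ℝ)) = exp ((n : ℂ) * I * ((-Real.pi : ℝ) : ℂ)) := by
            rw [exp_eq_exp_iff_exists_int]
            exact ⟨n, by push_cast; ring⟩
          rw [e]; simp

end RandomWalk

end

/-! ### Decay of the transition probabilities -/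

noncomputable section

namespace RandomWalk

/-- The fundamental cell of the frequency torus. -/
def freqBox (d : ℕ) : Set (Fin d → ℝ) := Set.univ.pi fun _ => Set.Icc (-Real.pi) Real.pi

variable {d : ℕ} (μ : Measure (Fin d → ℤ)) [IsProbabilityMeasure μ]

theorem volume_restrict_freqBox :
    (volume : Measure (Fin d → ℝ)).restrict (freqBox d) =
      Measure.pi fun _ => volume.restrict (Set.Icc (-Real.pi) Real.pi) :=
  Measure.restrict_pi_pi _ _

instance isFiniteMeasure_restrict_freqBox :
    IsFiniteMeasure ((volume : Measure (Fin d → ℝ)).restrict (freqBox d)) := by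
  rw [volume_restrict_freqBox]; infer_instance

open Complex in
theorem integral_freqBox_exp (n : Fin d → ℤ) :
    ∫ θ in freqBox d, exp ((∑ k, θ k * (n k : ℝ) : ℝ) * I) =
      if n = 0 then (2 * Real.pi : ℂ) ^ d else 0 := by
  rw [volume_restrict_freqBox]
  have h : ∀ θ : Fin d → ℝ, exp ((∑ k, θ k * (n k : ℝ) : ℝ) * I) =
      ∏ k, exp (((θ k * n k : ℝ)) * I) := fun θ => by
    rw [← exp_sum, ← Finset.sum_mul, ofReal_sum]
  simp only [h]
  rw [integral_fintype_prod_eq_prod (fun k t => exp (((t * n k : ℝ)) * I))]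
  simp only [integral_exp_int_mul_I]
  split_ifs with hn
  · simp [hn]
  · obtain ⟨k, hk⟩ : ∃ k, n k ≠ 0 := by
      by_contra! h; exact hn (funext h)
    exact Finset.prod_eq_zero (Finset.mem_univ k) (by simp [hk])

theorem stepProb_eq_ofReal (m : ℕ) (x : Fin d → ℤ) :
    stepProb μ m x = ENNReal.ofReal ((pathLaw μ).real {ω | pos m ω = x}) := by
  rw [ofReal_measureReal]
  have hm : MeasurableSet {ω : ℕ → Fin d → ℤ | pos m ω = x} :=
    measurableSet_eq_fun (by fun_prop) measurable_const
  rw [stepProb, ← lintegral_indicator_one hm]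
  refine lintegral_congr fun ω => ?_
  simp [ind, Set.indicator_apply]

open Complex in
-- Fourier inversion on the torus, followed by taking absolute values, which removes the dependence
-- on `x`.
theorem measureReal_pos_eq_le (m : ℕ) (x : Fin d → ℤ) :
    (2 * Real.pi) ^ d * (pathLaw μ).real {ω | pos m ω = x} ≤
      ∫ θ in freqBox d, ‖char μ θ‖ ^ m := by
  have hm : MeasurableSet {ω : ℕ → Fin d → ℤ | pos m ω = x} :=
    measurableSet_eq_fun (by fun_prop) measurable_const
  set F : (ℕ → Fin d → ℤ) → (Fin d → ℝ) → ℂ := fun ω θ =>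
    exp ((∑ k, θ k * ((pos m ω - x) k : ℝ) : ℝ) * I) with hF
  have hcast : Measurable (fun z : ℤ => (z : ℝ)) := Measurable.of_discrete
  have hFm : Measurable (Function.uncurry F) := by
    have : ∀ k, Measurable fun p : (ℕ → Fin d → ℤ) × (Fin d → ℝ) =>
        (((pos m p.1 - x) k : ℤ) : ℝ) := fun k =>
      hcast.comp ((measurable_pi_apply k).comp
        (((measurable_pos m).comp measurable_fst).sub measurable_const))
    refine Complex.measurable_exp.comp (Measurable.mul_const ?_ _)
    refine Complex.measurable_ofReal.comp (Finset.measurable_sum _ fun k _ => ?_)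
    exact ((measurable_pi_apply k).comp measurable_snd).mul (this k)
  have h1 : ∀ ω, ∫ θ in freqBox d, F ω θ =
      {ω | pos m ω = x}.indicator (fun _ => (2 * Real.pi : ℂ) ^ d) ω := fun ω => by
    rw [hF, integral_freqBox_exp, Set.indicator_apply]
    simp [sub_eq_zero]
  have h2 : ∀ θ, ∫ ω, F ω θ ∂pathLaw μ =
      char μ θ ^ m * exp (((-∑ k, θ k * (x k : ℝ) : ℝ)) * I) := fun θ => by
    rw [← integral_exp_pos, ← integral_mul_const]
    refine integral_congr_ae (ae_of_all _ fun ω => ?_)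
    simp only [hF]
    rw [← exp_add, ← add_mul, ← ofReal_add, ← sub_eq_add_neg, ← Finset.sum_sub_distrib]
    congr 4
    funext k
    simp; ring
  have h3 : ∫ ω, (∫ θ in freqBox d, F ω θ) ∂pathLaw μ =
      ∫ θ in freqBox d, ∫ ω, F ω θ ∂pathLaw μ := by
    refine integral_integral_swap (Integrable.of_bound hFm.aestronglyMeasurable 1
      (ae_of_all _ fun p => ?_))
    simp only [Function.uncurry, hF, norm_exp_ofReal_mul_I, le_refl]
  simp only [h1, h2] at h3
  rw [integral_indicator_const _ hm] at h3
  have h4 := norm_integral_le_integral_norm (μ := volume.restrict (freqBox d))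
    fun θ => char μ θ ^ m * exp (((-∑ k, θ k * (x k : ℝ) : ℝ)) * I)
  rw [← h3] at h4
  simp only [norm_mul, norm_pow, norm_exp_ofReal_mul_I, mul_one, norm_smul, norm_real,
    Real.norm_eq_abs, abs_of_nonneg (measureReal_nonneg), abs_of_pos Real.pi_pos] at h4
  rw [mul_comm]
  simpa using h4

/-- A sum of translated Gaussians dominating `exp (-c (1 - cos u))` on a bounded interval. -/
def gaussianComb (N : ℕ) (b u : ℝ) : ℝ :=
  ∑ j ∈ Finset.Icc (-(N : ℤ)) N, Real.exp (-b * (u - 2 * Real.pi * j) ^ 2)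

theorem gaussianComb_nonneg (N : ℕ) (b u : ℝ) : 0 ≤ gaussianComb N b u :=
  Finset.sum_nonneg fun _ _ => (Real.exp_pos _).le

/-- Let `w` be the distance from `u` to the nearest multiple of `2π`. Then `1 - cos u ≥ (2 / π ^ 2)
* w ^ 2`, so the Gaussian centred at this multiple already dominates. A bounded `u` needs only
finitely many centres, which also takes care of periodic walks. -/
theorem exp_neg_one_sub_cos_le {N : ℕ} {c u : ℝ} (hc : 0 ≤ c) (hu : |u| ≤ N) :
    Real.exp (-(c * (1 - Real.cos u))) ≤ gaussianComb N (c * (2 / Real.pi ^ 2)) u := by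
  have hpi := Real.pi_gt_three
  set j : ℤ := round (u / (2 * Real.pi)) with hj
  have h1 : |u - 2 * Real.pi * j| ≤ Real.pi := by
    have h := abs_sub_round (u / (2 * Real.pi))
    have e : u - 2 * Real.pi * j = 2 * Real.pi * (u / (2 * Real.pi) - j) := by
      field_simp
    rw [e, abs_mul, abs_of_pos (by positivity)]
    nlinarith
  have hjN : |(j : ℝ)| ≤ N := by
    rcases Nat.eq_zero_or_pos N with rfl | hN
    · have : u = 0 := by simpa using hu
      simp [hj, this]
    have hN' : (1 : ℝ) ≤ N := by exact_mod_cast hN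
    have h2 : |2 * Real.pi * (j : ℝ)| ≤ |u| + Real.pi := by
      have := abs_sub_abs_le_abs_sub (2 * Real.pi * (j : ℝ)) u
      rw [abs_sub_comm] at this
      linarith
    rw [abs_mul, abs_of_pos (by positivity)] at h2
    nlinarith [abs_nonneg (j : ℝ)]
  have hmem : j ∈ Finset.Icc (-(N : ℤ)) N := by
    rw [Finset.mem_Icc, ← abs_le]
    exact_mod_cast hjN
  refine le_trans ?_ (Finset.single_le_sum (f := fun j : ℤ =>
    Real.exp (-(c * (2 / Real.pi ^ 2)) * (u - 2 * Real.pi * j) ^ 2))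
    (fun _ _ => (Real.exp_pos _).le) hmem)
  rw [Real.exp_le_exp]
  have h3 := Real.cos_le_one_sub_mul_cos_sq h1
  have h4 : Real.cos (u - 2 * Real.pi * j) = Real.cos u := by
    rw [mul_comm (2 * Real.pi)]; exact Real.cos_sub_int_mul_two_pi u j
  rw [h4] at h3
  nlinarith

theorem integrable_gaussianComb (N : ℕ) {b : ℝ} (hb : 0 < b) : Integrable (gaussianComb N b) :=
  integrable_finsetSum _ fun _ _ => (integrable_exp_neg_mul_sq hb).comp_sub_right _

theorem integral_gaussianComb (N : ℕ) {b : ℝ} (hb : 0 < b) :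
    ∫ u, gaussianComb N b u = (2 * N + 1) * √(Real.pi / b) := by
  unfold gaussianComb
  rw [integral_finsetSum _ fun j _ => (integrable_exp_neg_mul_sq hb).comp_sub_right _]
  have : ∀ j : ℤ, ∫ u : ℝ, Real.exp (-b * (u - 2 * Real.pi * j) ^ 2) = √(Real.pi / b) := by
    intro j
    rw [integral_sub_right_eq_self (fun u => Real.exp (-b * u ^ 2)), integral_gaussian]
  simp only [this, Finset.sum_const, nsmul_eq_mul, Int.card_Icc]
  congr 1
  have : (N : ℤ) + 1 - -(N : ℤ) = ((2 * N + 1 : ℕ) : ℤ) := by push_cast; ring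
  rw [this, Int.toNat_natCast]; push_cast; ring

/-- The map with rows `z k` turns the dominating product into a product of functions of one
variable. The integral can then be extended to the whole space, where each factor contributes order
`m ^ (-1 / 2)`. -/
theorem setIntegral_norm_char_pow_le {z : Fin d → Fin d → ℤ} {q : ℝ} (hq0 : 0 < q) (hd : 0 < d)
    (hq : ∀ k, q ≤ (μ.prod μ).real {p | p.1 - p.2 = z k}) {N : ℕ}
    (hN : ∀ k, ∀ θ ∈ freqBox d, |∑ i, θ i * (z k i : ℝ)| ≤ N)
    (hdet : (Matrix.of fun k i => (z k i : ℝ)).det ≠ 0) {m : ℕ} (hm : 0 < m) :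
    ∫ θ in freqBox d, ‖char μ θ‖ ^ m ≤ |(Matrix.of fun k i => (z k i : ℝ)).det⁻¹| *
      ((2 * N + 1) * √(Real.pi / (m * q / (2 * d) * (2 / Real.pi ^ 2)))) ^ d := by
  set M : Matrix (Fin d) (Fin d) ℝ := Matrix.of fun k i => (z k i : ℝ) with hM
  set b : ℝ := m * q / (2 * d) * (2 / Real.pi ^ 2) with hb
  have hb0 : 0 < b := by have := Real.pi_pos; positivity
  set G : (Fin d → ℝ) → ℝ := fun u => ∏ k, gaussianComb N b (u k) with hG
  have hGi : Integrable G := Integrable.fintype_prod fun k => integrable_gaussianComb N hb0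
  have hGc : Continuous G := by unfold G gaussianComb; fun_prop
  have hL : ∀ θ k, Matrix.toLin' M θ k = ∑ i, θ i * (z k i : ℝ) := fun θ k => by
    simp [Matrix.toLin'_apply, Matrix.mulVec, dotProduct, hM, mul_comm]
  have hmap := Real.map_matrix_volume_pi_eq_smul_volume_pi hdet
  have hMm : Measurable (Matrix.toLin' M) :=
    (LinearMap.continuous_of_finiteDimensional _).measurable
  have hcomp : Integrable fun θ => G (Matrix.toLin' M θ) := by
    have : Integrable G (Measure.map (Matrix.toLin' M) volume) := by
      rw [hmap]; exact hGi.smul_measure ENNReal.ofReal_ne_top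
    exact this.comp_measurable hMm
  have hint : ∫ θ, G (Matrix.toLin' M θ) = |M.det⁻¹| * ∫ u, G u := by
    rw [← integral_map hMm.aemeasurable hGc.aestronglyMeasurable, hmap, integral_smul_measure,
      ENNReal.toReal_ofReal (abs_nonneg _), smul_eq_mul]
  calc _ ≤ ∫ θ in freqBox d, G (Matrix.toLin' M θ) := by
        refine integral_mono_of_nonneg (ae_of_all _ fun θ => by positivity) hcomp.integrableOn ?_
        refine (ae_restrict_iff' (MeasurableSet.univ_pi fun _ => measurableSet_Icc)).2
          (ae_of_all _ fun θ hθ => ?_)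
        refine (norm_char_pow_le μ hq θ m).trans ?_
        refine Finset.prod_le_prod (fun k _ => (Real.exp_pos _).le) fun k _ => ?_
        rw [hL]
        exact exp_neg_one_sub_cos_le (by positivity) (hN k θ hθ)
    _ ≤ ∫ θ, G (Matrix.toLin' M θ) := setIntegral_le_integral hcomp (ae_of_all _ fun θ =>
        Finset.prod_nonneg fun k _ => gaussianComb_nonneg _ _ _)
    _ = _ := by
        rw [hint, hG, integral_fintype_prod_volume_eq_prod (fun _ => gaussianComb N b)]
        simp only [integral_gaussianComb N hb0, Finset.prod_const, Finset.card_univ,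
          Fintype.card_fin]

theorem decay_eq_pow (d m : ℕ) : decay d m = (√((m : ℝ) + 1))⁻¹ ^ d := by
  unfold decay
  rw [Real.sqrt_eq_rpow, ← Real.rpow_neg (by positivity), ← Real.rpow_natCast,
    ← Real.rpow_mul (by positivity)]
  congr 1; ring

/-- The differences of two independent steps with law `μ` span the whole space. -/
def IsGenuine (μ : Measure (Fin d → ℤ)) : Prop :=
  Submodule.span ℝ {v : Fin d → ℝ | ∃ z : Fin d → ℤ,
    (μ.prod μ) {p | p.1 - p.2 = z} ≠ 0 ∧ v = fun i => (z i : ℝ)} = ⊤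

variable {μ}

theorem IsGenuine.exists_det_ne_zero (h : IsGenuine μ) : ∃ z : Fin d → Fin d → ℤ,
    (∀ k, (μ.prod μ) {p | p.1 - p.2 = z k} ≠ 0) ∧
      (Matrix.of fun k i => (z k i : ℝ)).det ≠ 0 := by
  obtain ⟨f, hf, -, hli⟩ := Submodule.exists_fun_fin_finrank_span_eq ℝ
    {v : Fin d → ℝ | ∃ z : Fin d → ℤ,
      (μ.prod μ) {p | p.1 - p.2 = z} ≠ 0 ∧ v = fun i => (z i : ℝ)}
  have hfin : d = Module.finrank ℝ (Submodule.span ℝ {v : Fin d → ℝ | ∃ z : Fin d → ℤ,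
      (μ.prod μ) {p | p.1 - p.2 = z} ≠ 0 ∧ v = fun i => (z i : ℝ)}) := by
    rw [h, finrank_top]; simp
  choose z hz hzf using hf
  refine ⟨fun k => z (Fin.cast hfin k), fun k => hz _, ?_⟩
  rw [← isUnit_iff_ne_zero, ← Matrix.isUnit_iff_isUnit_det, ← Matrix.linearIndependent_rows_iff_isUnit]
  have : (Matrix.of fun k i => (z (Fin.cast hfin k) i : ℝ)).row = f ∘ Fin.cast hfin := by
    funext k
    exact (hzf _).symm
  rw [this]
  exact hli.comp _ (Fin.cast_injective hfin)

theorem IsGenuine.exists_stepProb_le (h : IsGenuine μ) (hd : 0 < d) :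
    ∃ C : ℝ, ∀ m x, stepProb μ m x ≤ ENNReal.ofReal (C * decay d m) := by
  obtain ⟨z, hz, hdet⟩ := h.exists_det_ne_zero
  have hne : (Finset.univ : Finset (Fin d)).Nonempty := ⟨⟨0, hd⟩, Finset.mem_univ _⟩
  obtain ⟨q, hq0, hq⟩ : ∃ q : ℝ, 0 < q ∧ ∀ k, q ≤ (μ.prod μ).real {p | p.1 - p.2 = z k} := by
    refine ⟨Finset.univ.inf' hne fun k => (μ.prod μ).real {p | p.1 - p.2 = z k}, ?_, fun k =>
      Finset.inf'_le _ (Finset.mem_univ k)⟩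
    rw [Finset.lt_inf'_iff]
    exact fun k _ => ENNReal.toReal_pos (hz k) (measure_ne_top _ _)
  obtain ⟨N, hN⟩ : ∃ N : ℕ, ∀ k, ∀ θ ∈ freqBox d, |∑ i, θ i * (z k i : ℝ)| ≤ N := by
    obtain ⟨N, hN⟩ := exists_nat_ge (∑ k, ∑ i, Real.pi * |(z k i : ℝ)|)
    refine ⟨N, fun k θ hθ => le_trans ?_ hN⟩
    calc _ ≤ ∑ i, |θ i * (z k i : ℝ)| := Finset.abs_sum_le_sum_abs _ _
      _ ≤ ∑ i, Real.pi * |(z k i : ℝ)| := by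
          refine Finset.sum_le_sum fun i _ => ?_
          rw [abs_mul]
          have : |θ i| ≤ Real.pi := abs_le.2 (hθ i (Set.mem_univ i))
          gcongr
      _ ≤ _ := Finset.single_le_sum (f := fun k => ∑ i, Real.pi * |(z k i : ℝ)|)
          (fun k _ => Finset.sum_nonneg fun i _ => by positivity) (Finset.mem_univ k)
  set D := |(Matrix.of fun k i => (z k i : ℝ)).det⁻¹|
  set B : ℝ := Real.pi / (q / (2 * d) * (2 / Real.pi ^ 2)) with hB
  have hB0 : 0 ≤ B := by positivity
  -- The `1` covers `m = 0`; the factor `2` comes from `1 / m ≤ 2 / (m + 1)`.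
  refine ⟨max 1 (D * ((2 * N + 1) * √(2 * B)) ^ d), fun m x => ?_⟩
  rw [stepProb_eq_ofReal]
  refine ENNReal.ofReal_le_ofReal ?_
  rcases Nat.eq_zero_or_pos m with rfl | hm
  · rw [decay_zero, mul_one]
    exact measureReal_le_one.trans (le_max_left _ _)
  have hm' : (1 : ℝ) ≤ m := by exact_mod_cast hm
  have h1 := (measureReal_pos_eq_le μ m x).trans
    (setIntegral_norm_char_pow_le μ hq0 hd hq hN hdet hm)
  have h2 : √(Real.pi / (m * q / (2 * d) * (2 / Real.pi ^ 2))) ≤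
      √(2 * B) * (√((m : ℝ) + 1))⁻¹ := by
    rw [← div_eq_mul_inv, ← Real.sqrt_div (by positivity)]
    refine Real.sqrt_le_sqrt ?_
    have e : Real.pi / (m * q / (2 * d) * (2 / Real.pi ^ 2)) = B / m := by
      rw [hB]; field_simp
    rw [e, div_le_div_iff₀ (by positivity) (by positivity)]
    nlinarith
  have h3 : 1 ≤ (2 * Real.pi) ^ d := one_le_pow₀ (by linarith [Real.pi_gt_three])
  calc _ ≤ (2 * Real.pi) ^ d * (pathLaw μ).real {ω | pos m ω = x} :=
        le_mul_of_one_le_left measureReal_nonneg h3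
    _ ≤ D * ((2 * N + 1) * (√(2 * B) * (√((m : ℝ) + 1))⁻¹)) ^ d := by
        refine h1.trans ?_
        gcongr
    _ = D * ((2 * N + 1) * √(2 * B)) ^ d * decay d m := by
        rw [decay_eq_pow, ← mul_assoc, mul_pow, mul_assoc]
    _ ≤ _ := by
        gcongr
        · exact (decay_pos d m).le
        · exact le_max_right _ _

/-- The simple random walk is genuinely `d`-dimensional. -/
theorem isGenuine_simpleStep (d : ℕ) [NeZero d] : IsGenuine (simpleStep d) := by
  have hd : 0 < (d : ENNReal) := by exact_mod_cast Nat.pos_of_ne_zero (NeZero.ne d)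
  have hatom : ∀ k : Fin d, simpleStep d {Pi.single k 1} ≠ 0 ∧
      simpleStep d {-Pi.single k 1} ≠ 0 := by
    intro k
    have h : ∀ x : Fin d → ℤ, (x = Pi.single k 1 ∨ x = -Pi.single k 1) →
        simpleStep d {x} ≠ 0 := by
      intro x hx
      rw [simpleStep, Measure.smul_apply, smul_eq_mul, Measure.finsetSum_apply]
      refine mul_ne_zero (by simp [ENNReal.mul_eq_top]) ?_
      rw [Ne, Finset.sum_eq_zero_iff]
      intro h0
      have := h0 k (Finset.mem_univ k)
      revert this
      rcases hx with rfl | rfl <;> simp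
    exact ⟨h _ (Or.inl rfl), h _ (Or.inr rfl)⟩
  rw [IsGenuine, eq_top_iff, ← (Pi.basisFun ℝ (Fin d)).span_eq, Submodule.span_le]
  rintro _ ⟨k, rfl⟩
  -- The difference of the opposite steps `e_k` and `-e_k` is `2 e_k`.
  have hmem : (fun i => (((2 : ℤ) • Pi.single k (1 : ℤ) : Fin d → ℤ) i : ℝ)) ∈
      {v : Fin d → ℝ | ∃ z : Fin d → ℤ, ((simpleStep d).prod (simpleStep d))
        {p | p.1 - p.2 = z} ≠ 0 ∧ v = fun i => (z i : ℝ)} := by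
    refine ⟨_, ?_, rfl⟩
    have hsub : ({Pi.single k 1} : Set (Fin d → ℤ)) ×ˢ ({-Pi.single k 1} : Set (Fin d → ℤ)) ⊆
        {p | p.1 - p.2 = (2 : ℤ) • Pi.single k (1 : ℤ)} := by
      rintro ⟨x, y⟩ ⟨hx, hy⟩
      simp only [Set.mem_singleton_iff] at hx hy
      subst hx hy
      simp only [Set.mem_ofPred_eq, sub_neg_eq_add, two_smul]
    have := measure_mono (μ := (simpleStep d).prod (simpleStep d)) hsub
    rw [Measure.prod_prod] at this
    exact ((pos_iff_ne_zero.2 (mul_ne_zero (hatom k).1 (hatom k).2)).trans_le this).ne'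
  have := Submodule.smul_mem _ (2⁻¹ : ℝ) (Submodule.subset_span hmem)
  have e : Pi.basisFun ℝ (Fin d) k = (2⁻¹ : ℝ) •
      fun i => (((2 : ℤ) • Pi.single k (1 : ℤ) : Fin d → ℤ) i : ℝ) := by
    funext i
    simp [Pi.single_apply]
  rw [e]
  exact this

theorem IsGenuinelyDimensional.isGenuine {Ω : Type*} [MeasurableSpace Ω] {P : Measure Ω}
    [IsProbabilityMeasure P] {X : ℕ → Ω → Fin d → ℤ} (hX : IsIID X P)
    (h : IsGenuinelyDimensional X P) : IsGenuine (P.map (X 0)) := by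
  unfold IsGenuine
  unfold IsGenuinelyDimensional at h
  rw [← h]
  congr 1
  ext v
  refine exists_congr fun z => and_congr_left fun _ => not_congr ?_
  have hprod : P.map (fun ω => (X 0 ω, X 1 ω)) = (P.map (X 0)).prod (P.map (X 0)) := by
    rw [(indepFun_iff_map_prod_eq_prod_map_map (hX.measurable 0).aemeasurable
      (hX.measurable 1).aemeasurable).1 (hX.indep.indepFun (by norm_num)),
      (hX.identDistrib 1).map_eq]
  rw [← hprod, Measure.map_apply ((hX.measurable 0).prodMk (hX.measurable 1))
    MeasurableSet.of_discrete]
  rfl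

end RandomWalk

end

/-! ### Correlations with products of two increments -/

noncomputable section

namespace RandomWalk

/-- Bessel's inequality for the variance. -/
theorem sum_sq_integral_mul_le_variance {Ω κ : Type*} [MeasurableSpace Ω] {P : Measure Ω}
    [IsProbabilityMeasure P] {L : Ω → ℝ} {ψ : κ → Ω → ℝ} {J : Finset κ} (hL : MemLp L 2 P)
    (hψ : ∀ i ∈ J, MemLp (ψ i) 2 P) (h0 : ∀ i ∈ J, ∫ ω, ψ i ω ∂P = 0)
    (h1 : ∀ i ∈ J, ∫ ω, ψ i ω * ψ i ω ∂P ≤ 1)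
    (horth : ∀ i ∈ J, ∀ j ∈ J, i ≠ j → ∫ ω, ψ i ω * ψ j ω ∂P = 0) :
    ∑ i ∈ J, (∫ ω, L ω * ψ i ω ∂P) ^ 2 ≤ variance L P := by
  classical
  set c : κ → ℝ := fun i => ∫ ω, L ω * ψ i ω ∂P with hc
  have hcψ : ∀ i ∈ J, MemLp (fun ω => c i * ψ i ω) 2 P := fun i hi => (hψ i hi).const_mul _
  have hY : MemLp (fun ω => ∑ i ∈ J, c i * ψ i ω) 2 P := memLp_finsetSum J hcψ
  -- The residual after projecting on the `ψ i` has nonnegative variance. Norms at most one suffice,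
  -- because they only enter with a favourable sign.
  have hv := variance_nonneg (fun ω => L ω - ∑ i ∈ J, c i * ψ i ω) P
  have e1 : ∀ i ∈ J, cov[L, fun ω => c i * ψ i ω; P] = c i ^ 2 := fun i hi => by
    rw [covariance_const_mul_right, covariance_eq_sub hL (hψ i hi), h0 i hi, mul_zero, sub_zero, sq]
    rfl
  have e2 : ∀ i ∈ J, ∀ j ∈ J, cov[fun ω => c i * ψ i ω, fun ω => c j * ψ j ω; P] =
      c i * (c j * ∫ ω, ψ i ω * ψ j ω ∂P) := fun i hi j hj => by
    rw [covariance_const_mul_right, covariance_const_mul_left,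
      covariance_eq_sub (hψ i hi) (hψ j hj), h0 i hi, zero_mul, sub_zero]
    simp only [Pi.mul_apply]; ring
  rw [variance_fun_sub hL hY, covariance_fun_sum_right' hcψ hL, Finset.sum_congr rfl e1,
    variance_fun_sum' hcψ] at hv
  have e3 : ∑ i ∈ J, ∑ j ∈ J, cov[fun ω => c i * ψ i ω, fun ω => c j * ψ j ω; P] ≤
      ∑ i ∈ J, c i ^ 2 := by
    refine Finset.sum_le_sum fun i hi => ?_
    rw [Finset.sum_eq_single_of_mem i hi]
    · rw [e2 i hi i hi]
      nlinarith [h1 i hi, sq_nonneg (c i)]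
    · intro j hj hji
      rw [e2 i hi j hj, horth i hi j hj hji.symm]; simp
  linarith

/-- A symmetric law carried by the unit sphere. -/
structure IsUnitSymmetric {d : ℕ} (μ : Measure (Fin d → ℤ)) : Prop where
  map_neg : μ.map (fun x => -x) = μ
  ae_unit : ∀ᵐ x ∂μ, ∑ k, (x k : ℝ) * (x k : ℝ) = 1

theorem isUnitSymmetric_simpleStep (d : ℕ) : IsUnitSymmetric (simpleStep d) where
  map_neg := by
    ext s hs
    rw [Measure.map_apply Measurable.of_discrete hs]
    simp only [simpleStep, Measure.smul_apply, Measure.finsetSum_apply, Measure.add_apply,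
      Measure.dirac_apply]
    congr 1
    refine Finset.sum_congr rfl fun k _ => ?_
    rw [add_comm]
    have e : ∀ x : Fin d → ℤ, ((fun x => -x) ⁻¹' s).indicator (1 : (Fin d → ℤ) → ENNReal) x =
        s.indicator 1 (-x) := fun x => by
      by_cases hx : -x ∈ s
      · rw [Set.indicator_of_mem hx, Set.indicator_of_mem (by exact hx)]; rfl
      · rw [Set.indicator_of_notMem hx, Set.indicator_of_notMem (by exact hx)]
    rw [e, e, neg_neg]
  ae_unit := by
    rw [ae_iff]
    simp only [simpleStep, Measure.smul_apply, Measure.finsetSum_apply, Measure.add_apply,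
      Measure.dirac_apply, Set.indicator_apply, smul_eq_mul]
    rw [Finset.sum_eq_zero, mul_zero]
    intro k _
    simp [Pi.single_apply]

variable {d : ℕ} {μ : Measure (Fin d → ℤ)} [IsProbabilityMeasure μ]

/-- The path whose increments at the times in `A` are negated. -/
def flip (A : Set ℕ) [DecidablePred (· ∈ A)] (ω : ℕ → Fin d → ℤ) (j : ℕ) : Fin d → ℤ :=
  if j ∈ A then -ω j else ω j

theorem measurable_flip (A : Set ℕ) [DecidablePred (· ∈ A)] :
    Measurable (flip A : (ℕ → Fin d → ℤ) → ℕ → Fin d → ℤ) := by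
  refine measurable_pi_lambda _ fun j => ?_
  unfold flip
  split_ifs <;> fun_prop

theorem IsUnitSymmetric.map_flip (h : IsUnitSymmetric μ) (A : Set ℕ) [DecidablePred (· ∈ A)] :
    (pathLaw μ).map (flip A) = pathLaw μ := by
  have := Measure.infinitePi_map_pi (μ := fun _ : ℕ => μ)
    (f := fun j (x : Fin d → ℤ) => if j ∈ A then -x else x) (fun j => Measurable.of_discrete)
  refine Eq.trans this ?_
  unfold pathLaw
  congr 1
  funext j
  by_cases hj : j ∈ A
  · simpa [hj] using h.map_neg
  · simp [hj]

theorem IsUnitSymmetric.integral_flip (h : IsUnitSymmetric μ) (A : Set ℕ) [DecidablePred (· ∈ A)]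
    {F : (ℕ → Fin d → ℤ) → ℝ} (hF : Measurable F) :
    ∫ ω, F (flip A ω) ∂pathLaw μ = ∫ ω, F ω ∂pathLaw μ := by
  conv_rhs => rw [← h.map_flip A]
  rw [integral_map (measurable_flip A).aemeasurable hF.aestronglyMeasurable]

theorem IsUnitSymmetric.integral_eq_zero (h : IsUnitSymmetric μ) (A : Set ℕ)
    [DecidablePred (· ∈ A)] {F : (ℕ → Fin d → ℤ) → ℝ} (hF : Measurable F)
    (hodd : ∀ ω, F (flip A ω) = -F ω) : ∫ ω, F ω ∂pathLaw μ = 0 := by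
  have h1 := h.integral_flip A hF
  simp only [hodd, integral_neg] at h1
  linarith

/-- The inner product of two increments. -/
def dot (a b : ℕ) (ω : ℕ → Fin d → ℤ) : ℝ := ∑ k, (ω a k : ℝ) * (ω b k : ℝ)

@[fun_prop]
theorem measurable_dot (a b : ℕ) : Measurable (dot a b : (ℕ → Fin d → ℤ) → ℝ) := by
  have hcast : Measurable (fun z : ℤ => (z : ℝ)) := Measurable.of_discrete
  have h : ∀ a k, Measurable fun ω : ℕ → Fin d → ℤ => (ω a k : ℝ) := fun a k =>
    hcast.comp ((measurable_pi_apply k).comp (measurable_pi_apply a))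
  exact Finset.measurable_sum _ fun k _ => (h a k).mul (h b k)

theorem dot_comm (a b : ℕ) (ω : ℕ → Fin d → ℤ) : dot a b ω = dot b a ω :=
  Finset.sum_congr rfl fun _ _ => mul_comm _ _

theorem dot_flip_of_mem_of_notMem {A : Set ℕ} [DecidablePred (· ∈ A)] {a b : ℕ} (ha : a ∈ A)
    (hb : b ∉ A) (ω : ℕ → Fin d → ℤ) : dot a b (flip A ω) = -dot a b ω := by
  simp [dot, flip, ha, hb]

theorem dot_flip_of_notMem {A : Set ℕ} [DecidablePred (· ∈ A)] {a b : ℕ} (ha : a ∉ A)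
    (hb : b ∉ A) (ω : ℕ → Fin d → ℤ) : dot a b (flip A ω) = dot a b ω := by
  simp [dot, flip, ha, hb]

theorem IsUnitSymmetric.ae_dot_self (h : IsUnitSymmetric μ) (a : ℕ) :
    ∀ᵐ ω ∂pathLaw μ, dot a a ω = 1 := by
  have h1 := h.ae_unit
  rw [← Measure.infinitePi_map_eval (fun _ : ℕ => μ) a] at h1
  exact ae_of_ae_map (measurable_pi_apply a).aemeasurable h1

theorem IsUnitSymmetric.ae_abs_dot_le (h : IsUnitSymmetric μ) (a b : ℕ) :
    ∀ᵐ ω ∂pathLaw μ, |dot a b ω| ≤ 1 := by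
  filter_upwards [h.ae_dot_self a, h.ae_dot_self b] with ω h1 h2
  have := Finset.sum_mul_sq_le_sq_mul_sq Finset.univ (fun k => (ω a k : ℝ)) (fun k => (ω b k : ℝ))
  simp only [dot, ← sq] at h1 h2
  rw [h1, h2, one_mul] at this
  exact abs_le_one_iff_mul_self_le_one.2 (by rw [← sq]; exact this)

theorem IsUnitSymmetric.memLp_dot (h : IsUnitSymmetric μ) (a b : ℕ) (p : ENNReal) :
    MemLp (dot a b) p (pathLaw μ) :=
  MemLp.of_bound (measurable_dot a b).aestronglyMeasurable 1 (h.ae_abs_dot_le a b)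

theorem IsUnitSymmetric.integral_dot (h : IsUnitSymmetric μ) {a b : ℕ} (hab : a ≠ b) :
    ∫ ω, dot a b ω ∂pathLaw μ = 0 :=
  h.integral_eq_zero {a} (by fun_prop) fun ω =>
    dot_flip_of_mem_of_notMem (Set.mem_singleton _) (by simpa using hab.symm) ω

/-- Two different pairs have an index that belongs to only one of them; negating that increment
changes the sign of the product. -/
theorem IsUnitSymmetric.integral_dot_mul_dot (h : IsUnitSymmetric μ) {a b a' b' : ℕ}
    (hab : a < b) (hab' : a' < b') (hne : (a, b) ≠ (a', b')) :
    ∫ ω, dot a b ω * dot a' b' ω ∂pathLaw μ = 0 := by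
  by_cases h1 : a = a' ∨ a = b'
  · have hb : b ≠ a' ∧ b ≠ b' := by
      constructor
      · rintro rfl; omega
      · rintro rfl
        rcases h1 with rfl | rfl
        · exact hne rfl
        · omega
    refine h.integral_eq_zero {b} (by fun_prop) fun ω => ?_
    rw [dot_comm a b, dot_flip_of_mem_of_notMem (Set.mem_singleton _) (by simp; omega),
      dot_flip_of_notMem (by simpa using hb.1.symm) (by simpa using hb.2.symm)]
    rw [dot_comm a b]; ring
  · push Not at h1
    refine h.integral_eq_zero {a} (by fun_prop) fun ω => ?_
    rw [dot_flip_of_mem_of_notMem (Set.mem_singleton _) (by simp; omega),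
      dot_flip_of_notMem (by simpa using h1.1.symm) (by simpa using h1.2.symm)]
    ring

theorem IsUnitSymmetric.sum_sq_le_variance (h : IsUnitSymmetric μ) {L : (ℕ → Fin d → ℤ) → ℝ}
    (hL : MemLp L 2 (pathLaw μ)) {J : Finset (ℕ × ℕ)} (hJ : ∀ p ∈ J, p.1 < p.2) :
    ∑ p ∈ J, (∫ ω, L ω * dot p.1 p.2 ω ∂pathLaw μ) ^ 2 ≤ variance L (pathLaw μ) := by
  refine sum_sq_integral_mul_le_variance hL (fun p _ => h.memLp_dot p.1 p.2 2)
    (fun p hp => h.integral_dot (hJ p hp).ne) (fun p _ => ?_) fun p hp q hq hne =>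
    h.integral_dot_mul_dot (hJ p hp) (hJ q hq) hne
  have hb : ∀ᵐ ω ∂pathLaw μ, dot p.1 p.2 ω * dot p.1 p.2 ω ≤ 1 := by
    filter_upwards [h.ae_abs_dot_le p.1 p.2] with ω hω
    exact abs_le_one_iff_mul_self_le_one.1 hω
  have := integral_mono_ae ((h.memLp_dot p.1 p.2 2).integrable_mul (h.memLp_dot p.1 p.2 2))
    (integrable_const (1 : ℝ)) hb
  simpa using this

variable {ι : Type*}

/-- The real-valued indicator of `Coincide f`. -/
def coReal (f : ι → ℕ) (ω : ℕ → Fin d → ℤ) : ℝ := (coInd f ω).toReal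

@[fun_prop]
theorem measurable_coReal [Countable ι] (f : ι → ℕ) :
    Measurable (coReal f : (ℕ → Fin d → ℤ) → ℝ) := (measurable_coInd f).ennreal_toReal

theorem coReal_congr {f : ι → ℕ} {ω ω' : ℕ → Fin d → ℤ} (h : Coincide f ω ↔ Coincide f ω') :
    coReal f ω = coReal f ω' := by rw [coReal, coReal, coInd_congr h]

theorem coReal_mem (f : ι → ℕ) (ω : ℕ → Fin d → ℤ) : 0 ≤ coReal f ω ∧ coReal f ω ≤ 1 := by
  classical
  unfold coReal coInd
  split_ifs <;> simp

theorem coReal_of_not {f : ι → ℕ} {ω : ℕ → Fin d → ℤ} (h : ¬ Coincide f ω) : coReal f ω = 0 := by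
  simp [coReal, coInd, h]

theorem memLp_coReal [Countable ι] (f : ι → ℕ) (p : ENNReal) : MemLp (coReal f) p (pathLaw μ) :=
  MemLp.of_bound (measurable_coReal f).aestronglyMeasurable 1 (ae_of_all _ fun ω => by
    rw [Real.norm_eq_abs, abs_of_nonneg (coReal_mem f ω).1]; exact (coReal_mem f ω).2)

theorem integral_coReal [Countable ι] (f : ι → ℕ) :
    ∫ ω, coReal f ω ∂pathLaw μ = (coProb μ f).toReal := by
  classical
  refine integral_toReal (measurable_coInd f).aemeasurable (ae_of_all _ fun ω => ?_)
  unfold coInd; split_ifs <;> simp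

theorem pos_flip_of_le {A : Set ℕ} [DecidablePred (· ∈ A)] {j : ℕ} (h : ∀ i < j, i ∉ A)
    (ω : ℕ → Fin d → ℤ) : pos j (flip A ω) = pos j ω :=
  Finset.sum_congr rfl fun i hi => by simp [flip, h i (Finset.mem_range.1 hi)]

theorem pos_flip_Ici {s j : ℕ} (h : s ≤ j) (ω : ℕ → Fin d → ℤ) :
    pos j (flip (Set.Ici s) ω) = pos s ω + pos s ω - pos j ω := by
  induction j, h using Nat.le_induction with
  | base => rw [pos_flip_of_le fun i hi => by simpa using hi]; abel
  | succ j hj ih =>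
    rw [pos_succ, ih, pos_succ]
    have : flip (Set.Ici s) ω j = -ω j := by simp [flip, hj]
    rw [this]; abel

theorem pos_flip_singleton {a j : ℕ} (h : a < j) (ω : ℕ → Fin d → ℤ) :
    pos j (flip {a} ω) = pos j ω - ω a - ω a := by
  induction j, h using Nat.le_induction with
  | base =>
    rw [pos_succ, pos_flip_of_le fun i hi => by simp; omega, pos_succ]
    have : flip {a} ω a = -ω a := by simp [flip]
    rw [this]; abel
  | succ j hj ih =>
    rw [pos_succ, ih, pos_succ]
    have : flip {a} ω j = ω j := by
      have : j ≠ a := by omega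
      simp [flip, this]
    rw [this]; abel

theorem IsUnitSymmetric.integral_coReal_mul_dot_of_odd [Countable ι] (h : IsUnitSymmetric μ)
    {f : ι → ℕ} {a b : ℕ} (A : Set ℕ) [DecidablePred (· ∈ A)] (hmem : a ∈ A ∧ b ∉ A ∨ b ∈ A ∧ a ∉ A)
    (hco : ∀ ω : ℕ → Fin d → ℤ, Coincide f (flip A ω) ↔ Coincide f ω) :
    ∫ ω, coReal f ω * dot a b ω ∂pathLaw μ = 0 := by
  refine h.integral_eq_zero A (by fun_prop) fun ω => ?_
  rw [coReal_congr (hco ω)]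
  rcases hmem with ⟨h1, h2⟩ | ⟨h1, h2⟩
  · rw [dot_flip_of_mem_of_notMem h1 h2]; ring
  · rw [dot_comm a b, dot_flip_of_mem_of_notMem h1 h2, dot_comm b a]; ring

/-- If some time of `f` separates the increments, the correlation vanishes by reflection. -/
theorem IsUnitSymmetric.integral_coReal_mul_dot_of_separated [Countable ι] (h : IsUnitSymmetric μ)
    {f : ι → ℕ} {a b : ℕ} (hsep : ∃ i, a < f i ∧ f i ≤ b) :
    ∫ ω, coReal f ω * dot a b ω ∂pathLaw μ = 0 := by
  obtain ⟨i, hi1, hi2⟩ := hsep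
  -- Negating all increments from time `f i` on reflects the later path in its position at that
  -- time. This preserves the coincidence and negates only the increment `b`.
  refine h.integral_coReal_mul_dot_of_odd (Set.Ici (f i)) (Or.inr ⟨hi2, by simpa using hi1⟩)
    fun ω => ?_
  have key : ∀ j, pos (f j) (flip (Set.Ici (f i)) ω) = pos (f i) ω ↔ pos (f j) ω = pos (f i) ω := by
    intro j
    rcases le_total (f i) (f j) with hj | hj
    · rw [pos_flip_Ici hj, sub_eq_iff_eq_add, add_left_cancel_iff, eq_comm]
    · rw [pos_flip_of_le fun k hk => by simp; omega]
  have hii : pos (f i) (flip (Set.Ici (f i)) ω) = pos (f i) ω :=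
    (key i).2 rfl
  constructor
  · intro hc j k
    rw [(key j).1 ((hc j i).trans hii), (key k).1 ((hc k i).trans hii)]
  · intro hc j k
    rw [(key j).2 (hc j i), (key k).2 (hc k i)]

/-- Negating the increment `a` moves no time of `f` if all are at most `a`, and translates all of
them by the same vector if all are later. -/
theorem IsUnitSymmetric.integral_coReal_mul_dot_of_outer [Countable ι] (h : IsUnitSymmetric μ)
    {f : ι → ℕ} {a b : ℕ} (hab : a ≠ b) (hout : (∀ i, f i ≤ a) ∨ (∀ i, a < f i)) :
    ∫ ω, coReal f ω * dot a b ω ∂pathLaw μ = 0 := by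
  refine h.integral_coReal_mul_dot_of_odd {a} (Or.inl ⟨Set.mem_singleton _, by simpa using hab.symm⟩) fun ω => ?_
  refine forall_congr' fun i => forall_congr' fun j => ?_
  rcases hout with ho | ho
  · have hpos : ∀ i, pos (f i) (flip {a} ω) = pos (f i) ω := fun i =>
      pos_flip_of_le (fun k hk => by have := ho i; simp; omega) ω
    rw [hpos, hpos]
  · rw [pos_flip_singleton (ho i), pos_flip_singleton (ho j), sub_left_inj, sub_left_inj]

theorem pos_swap_of_le {b k j : ℕ} (hb : j ≤ b) (hk : j ≤ k) (ω : ℕ → Fin d → ℤ) :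
    pos j (fun i => ω (Equiv.swap b k i)) = pos j ω := by
  refine Finset.sum_congr rfl fun i hi => ?_
  have := Finset.mem_range.1 hi
  simp only
  rw [Equiv.swap_apply_of_ne_of_ne (by omega) (by omega)]

theorem pos_swap_of_lt {b k j : ℕ} (hb : b < j) (hk : k < j) (ω : ℕ → Fin d → ℤ) :
    pos j (fun i => ω (Equiv.swap b k i)) = pos j ω := by
  refine Finset.sum_bijective (Equiv.swap b k) (Equiv.bijective _) (fun i => ?_) fun _ _ => rfl
  simp only [Finset.mem_range]
  rcases eq_or_ne i b with rfl | h1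
  · simp [hb, hk]
  rcases eq_or_ne i k with rfl | h2
  · simp [hb, hk]
  rw [Equiv.swap_apply_of_ne_of_ne h1 h2]

/-- Within one gap `[u, v)` of `f` the increments are exchangeable and sum to zero. -/
theorem IsUnitSymmetric.integral_coReal_mul_dot_of_gap [Countable ι] (h : IsUnitSymmetric μ)
    {f : ι → ℕ} {a b u v : ℕ} (hua : u ≤ a) (hab : a < b) (hbv : b < v) (hu : ∃ i, f i = u)
    (hv : ∃ i, f i = v) (hgap : ∀ i, f i ≤ u ∨ v ≤ f i) :
    ∫ ω, coReal f ω * dot a b ω ∂pathLaw μ =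
      -((coProb μ f).toReal / ((v : ℝ) - u - 1)) := by
  obtain ⟨i₁, hi₁⟩ := hu
  obtain ⟨i₂, hi₂⟩ := hv
  have hint : ∀ k, Integrable (fun ω => coReal f ω * dot a k ω) (pathLaw μ) := fun k =>
    (memLp_coReal f 2).integrable_mul (h.memLp_dot a k 2)
  -- Transposing two increments of the gap does not affect the positions at the times of `f`.
  have hswap : ∀ k ∈ Finset.Ico u v, k ≠ a → ∫ ω, coReal f ω * dot a k ω ∂pathLaw μ =
      ∫ ω, coReal f ω * dot a b ω ∂pathLaw μ := by
    intro k hk hka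
    have hk' := Finset.mem_Ico.1 hk
    have hF : Measurable fun ω : ℕ → Fin d → ℤ => coReal f ω * dot a b ω := by fun_prop
    have hmap := map_comp_injective μ (Equiv.swap b k).injective
    conv_rhs => rw [← hmap]
    rw [integral_map (measurable_pi_lambda _ fun j => measurable_pi_apply _).aemeasurable hF.aestronglyMeasurable]
    refine integral_congr_ae (ae_of_all _ fun ω => ?_)
    have hpos : ∀ i, pos (f i) (fun j => ω (Equiv.swap b k j)) = pos (f i) ω := fun i => by
      rcases hgap i with hi | hi
      · exact pos_swap_of_le (by omega) (by omega) ω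
      · exact pos_swap_of_lt (by omega) (by omega) ω
    have h1 : Coincide f (fun j => ω (Equiv.swap b k j)) ↔ Coincide f ω := by
      simp only [Coincide, hpos]
    have h2 : dot a b (fun j => ω (Equiv.swap b k j)) = dot a k ω := by
      simp only [dot, Equiv.swap_apply_left]
      rw [Equiv.swap_apply_of_ne_of_ne hab.ne hka.symm]
    simp only
    rw [coReal_congr h1, h2]
  -- On the event the gap is a loop. The term `k = a` equals the probability of the event, since
  -- `dot a a = 1` almost surely, and the other `v - u - 1` terms are equal; this gives the formula.
  have hsum : ∑ k ∈ Finset.Ico u v, ∫ ω, coReal f ω * dot a k ω ∂pathLaw μ = 0 := by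
    rw [← integral_finsetSum _ fun k _ => hint k]
    refine integral_eq_zero_of_ae (ae_of_all _ fun ω => ?_)
    simp only [Pi.zero_apply]
    rw [← Finset.mul_sum]
    by_cases hc : Coincide f ω
    · have h1 : ∑ k ∈ Finset.Ico u v, ω k = 0 := by
        rw [Finset.sum_Ico_eq_sub _ (by omega : u ≤ v), ← hi₁, ← hi₂]
        exact sub_eq_zero.2 (hc i₂ i₁)
      have h2 : ∑ k ∈ Finset.Ico u v, dot a k ω = 0 := by
        unfold dot
        rw [Finset.sum_comm]
        refine Finset.sum_eq_zero fun l _ => ?_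
        rw [← Finset.mul_sum]
        have := congrFun h1 l
        rw [Finset.sum_apply] at this
        have h3 : ∑ k ∈ Finset.Ico u v, (ω k l : ℝ) = 0 := by exact_mod_cast this
        rw [h3, mul_zero]
      rw [h2, mul_zero]
    · rw [coReal_of_not hc, zero_mul]
  have ha : a ∈ Finset.Ico u v := Finset.mem_Ico.2 ⟨hua, by omega⟩
  rw [← Finset.add_sum_erase _ _ ha, Finset.sum_congr rfl fun k hk =>
    hswap k (Finset.mem_of_mem_erase hk) (Finset.ne_of_mem_erase hk), Finset.sum_const,
    Finset.card_erase_of_mem ha, Nat.card_Ico, nsmul_eq_mul] at hsum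
  have hself : ∫ ω, coReal f ω * dot a a ω ∂pathLaw μ = (coProb μ f).toReal := by
    rw [← integral_coReal]
    refine integral_congr_ae ?_
    filter_upwards [h.ae_dot_self a] with ω hω
    rw [hω, mul_one]
  have hcast : ((v - u - 1 : ℕ) : ℝ) = (v : ℝ) - u - 1 := by
    rw [Nat.cast_sub (by omega), Nat.cast_sub (by omega)]; simp
  have hpos : 0 < (v : ℝ) - u - 1 := by
    rw [← hcast]; exact_mod_cast (by omega : 0 < v - u - 1)
  rw [hself, hcast] at hsum
  rw [← neg_div, eq_div_iff hpos.ne']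
  linarith

/-- The common sign of all correlations: there is no cancellation between families, so any subfamily
gives a lower bound for the total. The gap around `a` is bounded by the last time of `f` up to `a`
and the first one after `a`. -/
theorem IsUnitSymmetric.integral_coReal_mul_dot_nonpos [Fintype ι] (h : IsUnitSymmetric μ)
    (f : ι → ℕ) {a b : ℕ} (hab : a < b) :
    ∫ ω, coReal f ω * dot a b ω ∂pathLaw μ ≤ 0 := by
  classical
  by_cases hsep : ∃ i, a < f i ∧ f i ≤ b
  · exact (h.integral_coReal_mul_dot_of_separated hsep).le
  by_cases ho : (∀ i, f i ≤ a) ∨ (∀ i, a < f i)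
  · exact (h.integral_coReal_mul_dot_of_outer hab.ne ho).le
  push Not at hsep ho
  obtain ⟨⟨i₂, hi₂⟩, ⟨i₁, hi₁⟩⟩ := ho
  obtain ⟨i, hi, hmax⟩ := Finset.exists_max_image (Finset.univ.filter fun i => f i ≤ a) f
    ⟨i₁, by simpa using hi₁⟩
  obtain ⟨j, hj, hmin⟩ := Finset.exists_min_image (Finset.univ.filter fun i => a < f i) f
    ⟨i₂, by simpa using hi₂⟩
  simp only [Finset.mem_filter, Finset.mem_univ, true_and] at hi hmax hj hmin
  have hbj := hsep j hj
  rw [h.integral_coReal_mul_dot_of_gap hi hab hbj ⟨i, rfl⟩ ⟨j, rfl⟩ fun k => ?_]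
  · have : (0 : ℝ) ≤ (f j : ℝ) - f i - 1 := by
      have : ((f i + 1 : ℕ) : ℝ) ≤ f j := by exact_mod_cast (by omega : f i + 1 ≤ f j)
      push_cast at this; linarith
    have := div_nonneg (ENNReal.toReal_nonneg (a := coProb μ f)) this
    linarith
  · rcases le_or_gt (f k) a with hk | hk
    · exact Or.inl (hmax k hk)
    · exact Or.inr (hmin k hk)

end RandomWalk

end

/-! ### Lower bound for the correlations -/

noncomputable section

namespace RandomWalk

theorem pow_lintegral_le_lintegral_pow {Ω : Type*} [MeasurableSpace Ω] {P : Measure Ω}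
    [IsProbabilityMeasure P] {f : Ω → ENNReal} (hf : AEMeasurable f P) (k : ℕ) :
    (∫⁻ x, f x ∂P) ^ k ≤ ∫⁻ x, f x ^ k ∂P := by
  cases k with
  | zero => simp
  | succ k =>
    have h := eLpNorm'_le_eLpNorm'_of_exponent_le (f := f) (p := 1) (q := (k + 1 : ℕ)) one_pos
      (by simp) P hf.aestronglyMeasurable
    simp only [eLpNorm', enorm_eq_self, ENNReal.rpow_one, div_one, ENNReal.rpow_natCast] at h
    calc _ ≤ ((∫⁻ x, f x ^ (k + 1) ∂P) ^ (1 / ((k + 1 : ℕ) : ℝ))) ^ (k + 1) := by gcongr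
      _ = _ := by
        rw [← ENNReal.rpow_natCast, ← ENNReal.rpow_mul, one_div_mul_cancel (by positivity),
          ENNReal.rpow_one]

variable {d : ℕ} {μ : Measure (Fin d → ℤ)} [IsProbabilityMeasure μ]

variable (μ) in
/-- The probability of being at the origin at time `m`. -/
def returnProb (m : ℕ) : ℝ := (stepProb μ m 0).toReal

variable (μ) in
/-- The expected number of visits to the origin at the times `0, …, n`. -/
def greenSum (n : ℕ) : ℝ := ∑ m ∈ Finset.range (n + 1), returnProb μ m

theorem stepProb_ne_top (m : ℕ) (x : Fin d → ℤ) : stepProb μ m x ≠ ⊤ := by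
  rw [stepProb_eq_ofReal]; exact ENNReal.ofReal_ne_top

theorem returnProb_nonneg (m : ℕ) : 0 ≤ returnProb μ m := ENNReal.toReal_nonneg

theorem greenSum_nonneg (n : ℕ) : 0 ≤ greenSum μ n :=
  Finset.sum_nonneg fun _ _ => returnProb_nonneg _

theorem greenSum_mono : Monotone (greenSum μ) := fun _ _ h =>
  Finset.sum_le_sum_of_subset_of_nonneg (Finset.range_mono (by omega))
    fun _ _ _ => returnProb_nonneg _

theorem returnProb_zero : returnProb μ 0 = 1 := by
  simp [returnProb, stepProb, ind]

theorem one_le_greenSum (n : ℕ) : 1 ≤ greenSum μ n := by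
  rw [← returnProb_zero (μ := μ)]
  exact Finset.single_le_sum (f := returnProb μ) (fun _ _ => returnProb_nonneg _)
    (Finset.mem_range.2 (by omega))

theorem lintegral_visits_zero (n : ℕ) :
    ∫⁻ ω, visits n 0 ω ∂pathLaw μ = ENNReal.ofReal (greenSum μ n) := by
  unfold visits greenSum
  rw [lintegral_finsetSum _ fun j _ => by fun_prop, ENNReal.ofReal_sum_of_nonneg fun _ _ =>
    returnProb_nonneg _]
  refine Finset.sum_congr rfl fun m _ => ?_
  rw [returnProb, ENNReal.ofReal_toReal (stepProb_ne_top m 0)]; rfl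

theorem lintegral_ind_pos_pos {u v : ℕ} (huv : u ≤ v) :
    ∫⁻ ω, ind (pos u ω) (pos v ω) ∂pathLaw μ = stepProb μ (v - u) 0 := by
  rw [lintegral_glue μ u (by fun_prop)]
  have : ∀ ω ω' : ℕ → Fin d → ℤ, ind (pos u (glue u ω ω')) (pos v (glue u ω ω')) =
      ind (pos (v - u) ω') 0 := fun ω ω' => by
    rw [pos_glue_of_le le_rfl, pos_glue_of_ge huv]
    exact ind_congr (by simp)
  simp only [this, lintegral_const, measure_univ, mul_one]
  rfl

theorem coInd_vecCons {k : ℕ} (u v : ℕ) (g : Fin k → ℕ) (ω : ℕ → Fin d → ℤ) :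
    coInd (Matrix.vecCons u (Matrix.vecCons v g)) ω =
      ind (pos u ω) (pos v ω) * ∏ i, ind (pos (g i) ω) (pos v ω) := by
  classical
  have h : Coincide (Matrix.vecCons u (Matrix.vecCons v g)) ω ↔
      pos u ω = pos v ω ∧ ∀ i, pos (g i) ω = pos v ω := by
    constructor
    · intro hc
      refine ⟨by simpa using hc 0 1, fun i => by simpa using hc i.succ.succ 1⟩
    · rintro ⟨h1, h2⟩
      have : ∀ i, pos (Matrix.vecCons u (Matrix.vecCons v g) i) ω = pos v ω := by
        intro i
        refine Fin.cases ?_ (fun i => Fin.cases ?_ (fun i => ?_) i) i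
        · simpa using h1
        · simp
        · simpa using h2 i
      intro i j
      rw [this i, this j]
  unfold coInd ind
  rw [Finset.prod_ite_zero, ite_zero_mul_ite_zero]
  simp [h]

/-- Summing over the `k` later times gives the `k`-th moment of the number of visits after `v`,
which is independent of the loop from `u` to `v`; Jensen's inequality bounds it below by the power
of its mean. -/
theorem le_sum_coProb_vecCons {k u v n : ℕ} (huv : u ≤ v) (hvn : v ≤ n) :
    stepProb μ (v - u) 0 * ENNReal.ofReal (greenSum μ (n - v)) ^ k ≤
      ∑ g ∈ Fintype.piFinset fun _ : Fin k => Finset.Ico v (n + 1),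
        coProb μ (Matrix.vecCons u (Matrix.vecCons v g)) := by
  have h1 : ∑ g ∈ Fintype.piFinset fun _ : Fin k => Finset.Ico v (n + 1),
        coProb μ (Matrix.vecCons u (Matrix.vecCons v g)) =
      ∫⁻ ω, ind (pos u ω) (pos v ω) *
        (∑ j ∈ Finset.Ico v (n + 1), ind (pos j ω) (pos v ω)) ^ k ∂pathLaw μ := by
    unfold coProb
    rw [← lintegral_finsetSum _ fun g _ => by fun_prop]
    refine lintegral_congr fun ω => ?_
    simp only [coInd_vecCons]
    rw [← Finset.mul_sum, ← Finset.prod_univ_sum (fun _ : Fin k => Finset.Ico v (n + 1))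
      (fun _ j => ind (pos j ω) (pos v ω))]
    simp
  rw [h1, lintegral_glue μ v (by fun_prop), ← lintegral_visits_zero]
  calc _ ≤ stepProb μ (v - u) 0 * ∫⁻ ω, visits (n - v) 0 ω ^ k ∂pathLaw μ := by
        gcongr
        exact pow_lintegral_le_lintegral_pow (by fun_prop) k
    _ = _ := by
        rw [← lintegral_ind_pos_pos huv, ← lintegral_mul_const _ (by fun_prop)]
        refine lintegral_congr fun ω => ?_
        rw [← lintegral_const_mul _ (by fun_prop)]
        refine lintegral_congr fun ω' => ?_
        rw [pos_glue_of_le huv, pos_glue_of_le le_rfl, Finset.sum_Ico_eq_sum_range, visits]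
        have e : n + 1 - v = n - v + 1 := by omega
        rw [e]
        congr 2
        refine Finset.sum_congr rfl fun j _ => ?_
        rw [pos_glue_add]
        exact ind_congr (by simp)

theorem selfIntersection_eq_sum_coReal {α : ℕ} (hα : 1 ≤ α) (n : ℕ) (ω : ℕ → Fin d → ℤ) :
    selfIntersection (simpleIncrement d) α n ω = ∑ f ∈ timeTuples (Fin α) n, coReal f ω := by
  classical
  rw [selfIntersection_eq_toReal hα, ENNReal.toReal_sum]
  · rfl
  · intro f _
    unfold coInd; split_ifs <;> simp

/-- Among all families keep only `(u, v, g)` with `g` at or after `v` and the gap `[u, v)` around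
`a` and `b`. Fixing the positions of `u` and `v` in the tuple makes these families distinct. -/
theorem IsUnitSymmetric.le_neg_integral_selfIntersection_mul_dot (h : IsUnitSymmetric μ)
    {k n a b : ℕ} (hab : a < b) {W : Finset (ℕ × ℕ)}
    (hW : ∀ p ∈ W, 1 ≤ p.1 ∧ p.1 ≤ a ∧ b < p.2 ∧ p.2 ≤ n) :
    ∑ p ∈ W, returnProb μ (p.2 - p.1) * greenSum μ (n - p.2) ^ k / ((p.2 : ℝ) - p.1 - 1) ≤
      -∫ ω, selfIntersection (simpleIncrement d) (k + 2) n ω * dot a b ω ∂pathLaw μ := by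
  classical
  have hint : ∀ f : Fin (k + 2) → ℕ, Integrable (fun ω => coReal f ω * dot a b ω) (pathLaw μ) :=
    fun f => (memLp_coReal f 2).integrable_mul (h.memLp_dot a b 2)
  have e1 : -∫ ω, selfIntersection (simpleIncrement d) (k + 2) n ω * dot a b ω ∂pathLaw μ =
      ∑ f ∈ timeTuples (Fin (k + 2)) n, -∫ ω, coReal f ω * dot a b ω ∂pathLaw μ := by
    rw [Finset.sum_neg_distrib, ← integral_finsetSum _ fun f _ => hint f]
    congr 1
    refine integral_congr_ae (ae_of_all _ fun ω => ?_)
    simp only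
    rw [selfIntersection_eq_sum_coReal (by omega), Finset.sum_mul]
  set Sg := W.sigma fun p => Fintype.piFinset fun _ : Fin k => Finset.Ico p.2 (n + 1) with hSg
  set e : (_ : ℕ × ℕ) × (Fin k → ℕ) → Fin (k + 2) → ℕ := fun q =>
    Matrix.vecCons q.1.1 (Matrix.vecCons q.1.2 q.2) with he
  have hinj : Function.Injective e := by
    rintro ⟨⟨u, v⟩, g⟩ ⟨⟨u', v'⟩, g'⟩ heq
    simp only [he] at heq
    obtain ⟨rfl, h2⟩ := Matrix.vecCons_inj.1 heq
    obtain ⟨rfl, rfl⟩ := Matrix.vecCons_inj.1 h2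
    rfl
  have hsub : Sg.image e ⊆ timeTuples (Fin (k + 2)) n := by
    intro f hf
    obtain ⟨⟨⟨u, v⟩, g⟩, hq, rfl⟩ := Finset.mem_image.1 hf
    rw [hSg, Finset.mem_sigma] at hq
    obtain ⟨hq1, hq2⟩ := hq
    have hw := hW _ hq1
    rw [Fintype.mem_piFinset] at hq2
    simp only [Finset.mem_Ico] at hw hq2
    rw [timeTuples, Fintype.mem_piFinset]
    intro i
    rw [Finset.mem_Icc]
    refine Fin.cases ?_ (fun i => Fin.cases ?_ (fun i => ?_) i) i
    · simp only [he, Matrix.cons_val_zero]; omega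
    · simp only [he, Matrix.cons_val_succ, Matrix.cons_val_zero]; omega
    · have := hq2 i
      simp only [he, Matrix.cons_val_succ]; omega
  rw [e1]
  refine le_trans ?_ (Finset.sum_le_sum_of_subset_of_nonneg hsub fun f _ _ =>
    neg_nonneg.2 (h.integral_coReal_mul_dot_nonpos f hab))
  rw [Finset.sum_image hinj.injOn, hSg, Finset.sum_sigma]
  refine Finset.sum_le_sum fun p hp => ?_
  obtain ⟨u, v⟩ := p
  obtain ⟨hu1, hua, hbv, hvn⟩ := hW _ hp
  simp only at hu1 hua hbv hvn ⊢
  have hgap : ∀ g ∈ Fintype.piFinset fun _ : Fin k => Finset.Ico v (n + 1),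
      -∫ ω, coReal (e ⟨(u, v), g⟩) ω * dot a b ω ∂pathLaw μ =
        (coProb μ (Matrix.vecCons u (Matrix.vecCons v g))).toReal / ((v : ℝ) - u - 1) := by
    intro g hg
    rw [Fintype.mem_piFinset] at hg
    rw [h.integral_coReal_mul_dot_of_gap hua hab hbv ⟨0, by simp [he]⟩ ⟨1, by simp [he]⟩, neg_neg]
    intro i
    refine Fin.cases ?_ (fun i => Fin.cases ?_ (fun i => ?_) i) i
    · left; simp [he]
    · right; simp [he]
    · right; simpa [he] using (Finset.mem_Ico.1 (hg i)).1
  rw [Finset.sum_congr rfl hgap, ← Finset.sum_div,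
    ← ENNReal.toReal_sum fun g _ => coProb_ne_top _]
  have hpos : (0 : ℝ) ≤ (v : ℝ) - u - 1 := by
    have : ((u + 1 : ℕ) : ℝ) ≤ v := by exact_mod_cast (by omega : u + 1 ≤ v)
    push_cast at this; linarith
  refine div_le_div_of_nonneg_right ?_ hpos
  have := ENNReal.toReal_mono (ENNReal.sum_ne_top.2 fun g _ => coProb_ne_top _)
    (le_sum_coProb_vecCons (μ := μ) (k := k) (by omega : u ≤ v) hvn)
  rwa [ENNReal.toReal_mul, ENNReal.toReal_pow, ENNReal.toReal_ofReal (greenSum_nonneg _)] at this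

end RandomWalk

end

/-! ### Return probabilities -/

noncomputable section

namespace RandomWalk

variable {d : ℕ} {μ : Measure (Fin d → ℤ)} [IsProbabilityMeasure μ]

theorem sum_sq_pos_eq_sum_dot (m : ℕ) (ω : ℕ → Fin d → ℤ) :
    ∑ k, (pos m ω k : ℝ) ^ 2 = ∑ i ∈ Finset.range m, ∑ j ∈ Finset.range m, dot i j ω := by
  unfold dot
  have : ∀ k, (pos m ω k : ℝ) ^ 2 =
      ∑ i ∈ Finset.range m, ∑ j ∈ Finset.range m, (ω i k : ℝ) * (ω j k : ℝ) := fun k => by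
    rw [sq, pos, Finset.sum_apply, Int.cast_sum, Finset.sum_mul_sum]
  simp only [this]
  rw [Finset.sum_comm]
  exact Finset.sum_congr rfl fun i _ => Finset.sum_comm

theorem IsUnitSymmetric.integrable_sum_sq_pos (h : IsUnitSymmetric μ) (m : ℕ) :
    Integrable (fun ω => ∑ k, (pos m ω k : ℝ) ^ 2) (pathLaw μ) := by
  simp only [sum_sq_pos_eq_sum_dot]
  exact integrable_finsetSum _ fun i _ => integrable_finsetSum _ fun j _ =>
    (h.memLp_dot i j 1).integrable le_rfl

theorem IsUnitSymmetric.integral_sum_sq_pos (h : IsUnitSymmetric μ) (m : ℕ) :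
    ∫ ω, ∑ k, (pos m ω k : ℝ) ^ 2 ∂pathLaw μ = m := by
  have hint : ∀ i j, Integrable (dot i j) (pathLaw μ) := fun i j =>
    (h.memLp_dot i j 1).integrable le_rfl
  simp only [sum_sq_pos_eq_sum_dot]
  rw [integral_finsetSum _ fun i _ => integrable_finsetSum _ fun j _ => hint i j]
  have : ∀ i ∈ Finset.range m, ∫ ω, ∑ j ∈ Finset.range m, dot i j ω ∂pathLaw μ = 1 := by
    intro i hi
    rw [integral_finsetSum _ fun j _ => hint i j, Finset.sum_eq_single_of_mem i hi fun j _ hj =>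
      h.integral_dot hj.symm]
    rw [integral_congr_ae (h.ae_dot_self i)]
    simp
  rw [Finset.sum_congr rfl this]; simp

/-- Markov's inequality for the squared distance, whose mean is `m`, at level `2 * m`. -/
theorem IsUnitSymmetric.half_le_sum_stepProb (h : IsUnitSymmetric μ) {m : ℕ} (hm : 0 < m) :
    1 / 2 ≤ ∑ x ∈ Fintype.piFinset fun _ : Fin d => Finset.Icc (-(Nat.sqrt (2 * m) : ℤ))
      (Nat.sqrt (2 * m)), (stepProb μ m x).toReal := by
  classical
  set B := Fintype.piFinset fun _ : Fin d => Finset.Icc (-(Nat.sqrt (2 * m) : ℤ))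
      (Nat.sqrt (2 * m)) with hB
  have hm' : (0 : ℝ) < m := by exact_mod_cast hm
  have hmeas : MeasurableSet {ω : ℕ → Fin d → ℤ | pos m ω ∈ B} :=
    (measurable_pos m) (MeasurableSet.of_discrete (s := {x | x ∈ B}))
  have h1 : ∑ x ∈ B, (stepProb μ m x).toReal = (pathLaw μ).real {ω | pos m ω ∈ B} := by
    rw [← ENNReal.toReal_sum fun x _ => stepProb_ne_top m x, measureReal_def]
    congr 1
    unfold stepProb
    rw [← lintegral_finsetSum _ fun x _ => by fun_prop, ← lintegral_indicator_one hmeas]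
    refine lintegral_congr fun ω => ?_
    simp only [ind, Finset.sum_ite_eq, Set.indicator_apply, Set.mem_ofPred_eq, Pi.one_apply]
  have h2 := mul_meas_ge_le_integral_of_nonneg (μ := pathLaw μ)
    (f := fun ω => ∑ k, (pos m ω k : ℝ) ^ 2)
    (ae_of_all _ fun ω => Finset.sum_nonneg fun k _ => sq_nonneg _)
    (h.integrable_sum_sq_pos m) (2 * m : ℝ)
  rw [h.integral_sum_sq_pos] at h2
  have h3 : (pathLaw μ).real {ω | pos m ω ∈ B}ᶜ ≤ 1 / 2 := by
    refine le_trans (measureReal_mono (fun ω hω => ?_) (measure_ne_top _ _))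
      (show (pathLaw μ).real {ω | (2 * m : ℝ) ≤ ∑ k, (pos m ω k : ℝ) ^ 2} ≤ 1 / 2 by nlinarith)
    by_contra hlt
    refine hω ?_
    simp only [Set.mem_ofPred_eq, not_le] at hlt ⊢
    rw [hB, Fintype.mem_piFinset]
    intro k
    rw [Finset.mem_Icc, ← abs_le]
    have h4 : (pos m ω k : ℝ) ^ 2 ≤ ∑ k, (pos m ω k : ℝ) ^ 2 :=
      Finset.single_le_sum (f := fun k => (pos m ω k : ℝ) ^ 2) (fun _ _ => sq_nonneg _)
        (Finset.mem_univ k)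
    have h5 : (pos m ω k) ^ 2 < 2 * (m : ℤ) := by
      have := h4.trans_lt hlt
      exact_mod_cast this
    rw [← Int.natCast_natAbs]
    have h6 : (pos m ω k).natAbs ≤ Nat.sqrt (2 * m) := by
      rw [Nat.le_sqrt]
      have : ((pos m ω k).natAbs : ℤ) * (pos m ω k).natAbs = (pos m ω k) ^ 2 := by
        rw [← sq, Int.natAbs_sq]
      zify
      simp only [Int.natCast_natAbs] at this
      linarith
    exact_mod_cast h6
  rw [probReal_compl_eq_one_sub hmeas] at h3
  rw [h1]; linarith

theorem IsUnitSymmetric.stepProb_neg (h : IsUnitSymmetric μ) (m : ℕ) (x : Fin d → ℤ) :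
    stepProb μ m (-x) = stepProb μ m x := by
  unfold stepProb
  conv_lhs => rw [← h.map_flip Set.univ]
  rw [lintegral_map (by fun_prop) (measurable_flip _)]
  refine lintegral_congr fun ω => ?_
  have : pos m (flip Set.univ ω) = -pos m ω := by
    simp [pos, flip]
  rw [this]
  exact ind_congr neg_inj

/-- A walk that is at `x` at time `m` returns to the origin at time `2 * m` with the probability of
making the displacement `-x`, which equals that of `x` by symmetry. -/
theorem IsUnitSymmetric.sum_stepProb_sq_le (h : IsUnitSymmetric μ) (m : ℕ)
    (B : Finset (Fin d → ℤ)) : ∑ x ∈ B, (stepProb μ m x).toReal ^ 2 ≤ returnProb μ (2 * m) := by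
  classical
  have h1 : ∑ x ∈ B, stepProb μ m x ^ 2 ≤ stepProb μ (2 * m) 0 := by
    calc _ = ∑ x ∈ B, stepProb μ m x * stepProb μ m (-x) :=
          Finset.sum_congr rfl fun x _ => by rw [h.stepProb_neg, sq]
      _ = ∫⁻ ω, ∫⁻ ω', ∑ x ∈ B, ind (pos m ω) x * ind (pos m ω') (-x) ∂pathLaw μ ∂pathLaw μ := by
          have : ∀ ω, ∫⁻ ω', ∑ x ∈ B, ind (pos m ω) x * ind (pos m ω') (-x) ∂pathLaw μ =
              ∑ x ∈ B, ind (pos m ω) x * stepProb μ m (-x) := fun ω => by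
            rw [lintegral_finsetSum _ fun x _ => by fun_prop]
            exact Finset.sum_congr rfl fun x _ => lintegral_const_mul _ (by fun_prop)
          simp only [this]
          rw [lintegral_finsetSum _ fun x _ => by fun_prop]
          exact Finset.sum_congr rfl fun x _ => (lintegral_mul_const _ (by fun_prop)).symm
      _ ≤ _ := by
          rw [stepProb, lintegral_glue μ m (F := fun ω => ind (pos (2 * m) ω) 0) (by fun_prop)]
          refine lintegral_mono fun ω => lintegral_mono fun ω' => ?_
          rw [two_mul, pos_glue_add]
          by_cases hc : pos m ω + pos m ω' = 0
          · calc _ ≤ ∑ x ∈ B, ind (pos m ω) x := Finset.sum_le_sum fun x _ =>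
                  mul_le_of_le_one_right zero_le (ind_le_one _ _)
              _ ≤ 1 := by
                  simp only [ind, Finset.sum_ite_eq]; split_ifs <;> simp
              _ = _ := by simp [ind, hc]
          · refine le_of_eq_of_le (Finset.sum_eq_zero fun x _ => ?_) zero_le
            by_cases h2 : pos m ω = x
            · have : pos m ω' ≠ -x := fun h3 => hc (by rw [h2, h3]; abel)
              simp [ind, this]
            · simp [ind, h2]
  have h2 := ENNReal.toReal_mono (stepProb_ne_top _ _) h1
  rw [ENNReal.toReal_sum fun x _ => ENNReal.pow_ne_top (stepProb_ne_top m x)] at h2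
  simpa only [ENNReal.toReal_pow, returnProb] using h2

/-- By Cauchy-Schwarz over a box of side of order `√m` that carries at least half of the mass. The
constant is `4 ^ d` for the box and `4` for the square of one half. -/
theorem IsUnitSymmetric.decay_le_returnProb (h : IsUnitSymmetric μ) (m : ℕ) :
    (4 ^ (d + 1) : ℝ)⁻¹ * decay d m ≤ returnProb μ (2 * m) := by
  rcases Nat.eq_zero_or_pos m with rfl | hm
  · rw [mul_zero, returnProb_zero, decay_zero, mul_one]
    exact inv_le_one_of_one_le₀ (one_le_pow₀ (by norm_num))
  set R := Nat.sqrt (2 * m) with hR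
  set B := Fintype.piFinset fun _ : Fin d => Finset.Icc (-(R : ℤ)) R with hB
  have h1 := h.half_le_sum_stepProb hm
  have h2 := sq_sum_le_card_mul_sum_sq (s := B) (f := fun x => (stepProb μ m x).toReal)
  have h3 := h.sum_stepProb_sq_le m B
  have hcard : (B.card : ℝ) = (2 * R + 1) ^ d := by
    rw [hB, Fintype.card_piFinset_const, Int.card_Icc]
    have : (R : ℤ) + 1 - -(R : ℤ) = ((2 * R + 1 : ℕ) : ℤ) := by push_cast; ring
    rw [this, Int.toNat_natCast]; push_cast; simp
  have hm' : (1 : ℝ) ≤ m := by exact_mod_cast hm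
  have hR4 : 2 * (R : ℝ) + 1 ≤ 4 * √((m : ℝ) + 1) := by
    have h5 : (R : ℝ) ^ 2 ≤ 2 * m := by
      have := Nat.sqrt_le' (2 * m)
      exact_mod_cast this
    have h6 : √((m : ℝ) + 1) ^ 2 = m + 1 := Real.sq_sqrt (by positivity)
    have h7 : 1 ≤ √((m : ℝ) + 1) := by rw [Real.one_le_sqrt]; linarith
    have h8 : (R : ℝ) ≤ 3 / 2 * √((m : ℝ) + 1) := by
      refine le_of_sq_le_sq ?_ (by positivity)
      rw [mul_pow, h6]; nlinarith
    linarith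
  have h9 : (1 / 2 : ℝ) ^ 2 ≤ (4 * √((m : ℝ) + 1)) ^ d * returnProb μ (2 * m) := by
    calc _ ≤ (∑ x ∈ B, (stepProb μ m x).toReal) ^ 2 := by gcongr
      _ ≤ B.card * ∑ x ∈ B, (stepProb μ m x).toReal ^ 2 := h2
      _ ≤ _ := by
          rw [hcard]
          exact mul_le_mul (by gcongr) h3 (Finset.sum_nonneg fun _ _ => sq_nonneg _)
            (by positivity)
  rw [decay_eq_pow, inv_pow, ← mul_inv, inv_le_iff_one_le_mul₀ (by positivity)]
  rw [mul_pow] at h9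
  rw [pow_succ]
  linarith

end RandomWalk

end

/-! ### Lower bound for the variance -/

noncomputable section

namespace RandomWalk

variable {d : ℕ} {μ : Measure (Fin d → ℤ)} [IsProbabilityMeasure μ]

theorem IsUnitSymmetric.decaySum_le_greenSum (h : IsUnitSymmetric μ) (n : ℕ) :
    (4 ^ (d + 1) : ℝ)⁻¹ * decaySum d (n / 2) ≤ greenSum μ n := by
  unfold decaySum greenSum
  rw [Finset.mul_sum]
  calc _ ≤ ∑ m ∈ Finset.range (n / 2 + 1), returnProb μ (2 * m) :=
        Finset.sum_le_sum fun m _ => h.decay_le_returnProb m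
    _ = ∑ m ∈ (Finset.range (n / 2 + 1)).image (2 * ·), returnProb μ m :=
        (Finset.sum_image fun i _ j _ hij => by simpa using hij).symm
    _ ≤ _ := by
        refine Finset.sum_le_sum_of_subset_of_nonneg (fun m hm => ?_)
          fun _ _ _ => returnProb_nonneg _
        obtain ⟨i, hi, rfl⟩ := Finset.mem_image.1 hm
        simp only [Finset.mem_range] at hi ⊢
        omega

/-- There are `D ^ 2` gaps of length comparable to `D` around `[a, a + D]`, each contributing order
`D ^ (-d / 2) / D` times the power of the Green sum. -/
theorem IsUnitSymmetric.le_neg_integral_of_scale (h : IsUnitSymmetric μ) {k n a D : ℕ}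
    (hD : 1 ≤ D) (hDn : 32 * D ≤ n) (ha : n ≤ 4 * a) (ha' : 2 * a ≤ n) :
    (4 ^ (d + 1) : ℝ)⁻¹ * (2 ^ ((d : ℝ) / 2))⁻¹ / 4 * (D * decay d D * greenSum μ (n / 4) ^ k) ≤
      -∫ ω, selfIntersection (simpleIncrement d) (k + 2) n ω * dot a (a + D) ω ∂pathLaw μ := by
  -- Gap lengths are even because only returns at even times are bounded below. The hypotheses on
  -- `a`, `D` and `n` keep the gap inside `{1, …, n}` and leave at least `n / 4` time units after
  -- it.
  set W := (Finset.range D ×ˢ Finset.Ioc D (2 * D)).image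
    (fun q : ℕ × ℕ => (a - q.1, a - q.1 + 2 * q.2)) with hWdef
  have hq : ∀ q ∈ Finset.range D ×ˢ Finset.Ioc D (2 * D), q.1 < D ∧ D < q.2 ∧ q.2 ≤ 2 * D :=
    fun q hq => by simpa [Finset.mem_product] using hq
  have hinj : Set.InjOn (fun q : ℕ × ℕ => (a - q.1, a - q.1 + 2 * q.2))
      (Finset.range D ×ˢ Finset.Ioc D (2 * D) : Finset (ℕ × ℕ)) := by
    rintro ⟨i, m⟩ h1 ⟨i', m'⟩ h2 heq
    have h1 := hq _ (Finset.mem_coe.1 h1)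
    have h2 := hq _ (Finset.mem_coe.1 h2)
    simp only [Prod.mk.injEq] at heq h1 h2 ⊢
    omega
  have hW : ∀ p ∈ W, 1 ≤ p.1 ∧ p.1 ≤ a ∧ a + D < p.2 ∧ p.2 ≤ n := by
    intro p hp
    obtain ⟨q, hq', rfl⟩ := Finset.mem_image.1 hp
    have := hq q hq'
    simp only; omega
  refine le_trans ?_ (h.le_neg_integral_selfIntersection_mul_dot (by omega : a < a + D) hW)
  rw [hWdef, Finset.sum_image hinj]
  set c : ℝ := (4 ^ (d + 1) : ℝ)⁻¹ * decay d (2 * D) * greenSum μ (n / 4) ^ k / (4 * D) with hc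
  have hD' : (1 : ℝ) ≤ D := by exact_mod_cast hD
  have hG : 0 ≤ greenSum μ (n / 4) := greenSum_nonneg _
  have hterm : ∀ q ∈ Finset.range D ×ˢ Finset.Ioc D (2 * D),
      c ≤ returnProb μ (a - q.1 + 2 * q.2 - (a - q.1)) *
        greenSum μ (n - (a - q.1 + 2 * q.2)) ^ k /
          (((a - q.1 + 2 * q.2 : ℕ) : ℝ) - (a - q.1 : ℕ) - 1) := by
    intro q hq'
    have hq1 := hq q hq'
    have e1 : a - q.1 + 2 * q.2 - (a - q.1) = 2 * q.2 := by omega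
    have e2 : ((a - q.1 + 2 * q.2 : ℕ) : ℝ) - (a - q.1 : ℕ) - 1 = 2 * q.2 - 1 := by
      push_cast; ring
    have hm1 : (1 : ℝ) ≤ q.2 := by exact_mod_cast (by omega : 1 ≤ q.2)
    have hm2 : (q.2 : ℝ) ≤ 2 * D := by exact_mod_cast hq1.2.2
    rw [e1, e2, hc]
    refine div_le_div₀ (mul_nonneg (returnProb_nonneg _) (pow_nonneg (greenSum_nonneg _) _))
      (mul_le_mul ?_ ?_ (by positivity) (returnProb_nonneg _)) (by linarith) (by linarith)
    · refine le_trans ?_ (h.decay_le_returnProb q.2)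
      gcongr
      exact decay_antitone d hq1.2.2
    · gcongr
      exact greenSum_mono (by omega)
  refine le_trans ?_ (Finset.sum_le_sum hterm)
  have hcard : (Finset.range D ×ˢ Finset.Ioc D (2 * D)).card = D * D := by
    rw [Finset.card_product, Finset.card_range, Nat.card_Ioc]; congr 1; omega
  rw [Finset.sum_const, hcard, nsmul_eq_mul, hc]
  have hdec : (2 ^ ((d : ℝ) / 2))⁻¹ * decay d D ≤ decay d (2 * D) := by
    have := decay_half_le d (2 * D)
    rw [Nat.mul_div_cancel_left D two_pos] at this
    rwa [inv_mul_le_iff₀ (by positivity)]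
  have hDne : (D : ℝ) ≠ 0 := by positivity
  calc _ = (4 ^ (d + 1) : ℝ)⁻¹ / 4 * D * greenSum μ (n / 4) ^ k *
        ((2 ^ ((d : ℝ) / 2))⁻¹ * decay d D) := by ring
    _ ≤ (4 ^ (d + 1) : ℝ)⁻¹ / 4 * D * greenSum μ (n / 4) ^ k * decay d (2 * D) := by gcongr
    _ = _ := by push_cast; field_simp

/-- The sum of `D² (D + 1) ^ (-d)` over `1 ≤ D ≤ q`. -/
def scaleSum (d q : ℕ) : ℝ := ∑ D ∈ Finset.Icc 1 q, ((D : ℝ) * decay d D) ^ 2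

theorem IsUnitSymmetric.scaleSum_le_variance (h : IsUnitSymmetric μ) {k n : ℕ} (hn : 2 ≤ n) :
    ((4 ^ (d + 1) : ℝ)⁻¹ * (2 ^ ((d : ℝ) / 2))⁻¹ / 4) ^ 2 / 8 *
      (n * scaleSum d (n / 32) * greenSum μ (n / 4) ^ (2 * k)) ≤
      variance (selfIntersection (simpleIncrement d) (k + 2) n) (pathLaw μ) := by
  set c : ℝ := (4 ^ (d + 1) : ℝ)⁻¹ * (2 ^ ((d : ℝ) / 2))⁻¹ / 4 with hc
  -- The lower end is `n / 4` rounded up; for `n ≥ 2` this interval has at least `n / 8` elements.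
  set A := Finset.Icc ((n + 3) / 4) (n / 2) with hA
  set I := Finset.Icc 1 (n / 32) with hI
  set J := (A ×ˢ I).image (fun q : ℕ × ℕ => (q.1, q.1 + q.2)) with hJ
  have hinj : Function.Injective (fun q : ℕ × ℕ => (q.1, q.1 + q.2)) := by
    rintro ⟨i, m⟩ ⟨i', m'⟩ heq
    simp only [Prod.mk.injEq] at heq ⊢
    omega
  have hJlt : ∀ p ∈ J, p.1 < p.2 := by
    intro p hp
    obtain ⟨q, hq, rfl⟩ := Finset.mem_image.1 hp
    have hq := Finset.mem_Icc.1 (Finset.mem_product.1 hq).2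
    simp only; omega
  have hG : 0 ≤ greenSum μ (n / 4) := greenSum_nonneg _
  refine le_trans ?_ (h.sum_sq_le_variance (memLp_selfIntersection (by omega) n 2) hJlt)
  rw [hJ, Finset.sum_image hinj.injOn, Finset.sum_product]
  have hterm : ∀ a ∈ A, c ^ 2 * greenSum μ (n / 4) ^ (2 * k) * scaleSum d (n / 32) ≤
      ∑ D ∈ I, (∫ ω, selfIntersection (simpleIncrement d) (k + 2) n ω * dot a (a + D) ω
        ∂pathLaw μ) ^ 2 := by
    intro a ha
    rw [hA, Finset.mem_Icc] at ha
    rw [scaleSum, Finset.mul_sum]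
    refine Finset.sum_le_sum fun D hD => ?_
    have hD := Finset.mem_Icc.1 hD
    have h1 := h.le_neg_integral_of_scale (k := k) hD.1 (by omega : 32 * D ≤ n)
      (by omega : n ≤ 4 * a) (by omega)
    have h0 : 0 ≤ c * (D * decay d D * greenSum μ (n / 4) ^ k) := by
      have := (decay_pos d D).le
      positivity
    have h2 := pow_le_pow_left₀ h0 h1 2
    rw [neg_sq] at h2
    refine le_trans (le_of_eq ?_) h2
    rw [mul_comm 2 k, pow_mul]; ring
  refine le_trans ?_ (Finset.sum_le_sum hterm)
  rw [Finset.sum_const, nsmul_eq_mul]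
  have hcardA : (n : ℝ) / 8 ≤ A.card := by
    have : n ≤ 8 * A.card := by rw [hA, Nat.card_Icc]; omega
    have : (n : ℝ) ≤ 8 * A.card := by exact_mod_cast this
    linarith
  have hS : 0 ≤ scaleSum d (n / 32) := Finset.sum_nonneg fun _ _ => sq_nonneg _
  calc _ = (n : ℝ) / 8 * (c ^ 2 * greenSum μ (n / 4) ^ (2 * k) * scaleSum d (n / 32)) := by ring
    _ ≤ _ := by gcongr

theorem decay_sq (d m : ℕ) : decay d m ^ 2 = (((m : ℝ) + 1) ^ d)⁻¹ := by
  rw [decay_eq_pow, ← pow_mul, mul_comm, pow_mul, inv_pow, Real.sq_sqrt (by positivity), inv_pow]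

theorem le_mul_decay_sq (d : ℕ) {D : ℕ} (hD : 1 ≤ D) :
    (2 ^ d : ℝ)⁻¹ * ((D : ℝ) ^ 2 / (D : ℝ) ^ d) ≤ ((D : ℝ) * decay d D) ^ 2 := by
  have hD' : (1 : ℝ) ≤ D := by exact_mod_cast hD
  rw [mul_pow, decay_sq]
  calc _ = (D : ℝ) ^ 2 * ((2 * (D : ℝ)) ^ d)⁻¹ := by rw [mul_pow]; field_simp
    _ ≤ _ := by gcongr; linarith

theorem half_log_le_log_div {n K : ℕ} (hK : 0 < K) (hn : K ^ 2 ≤ n) :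
    Real.log n / 2 ≤ Real.log (n / K : ℕ).succ := by
  have hK' : (0 : ℝ) < K := by exact_mod_cast hK
  have hn' : ((K : ℝ)) ^ 2 ≤ n := by exact_mod_cast hn
  have hn0 : (0 : ℝ) < n := lt_of_lt_of_le (by positivity) hn'
  have h1 : (n : ℝ) / K ≤ ((n / K : ℕ).succ : ℝ) := by
    rw [div_le_iff₀ hK']
    have := (Nat.lt_mul_div_succ n hK).le
    rw [mul_comm] at this
    exact_mod_cast this
  have h2 : Real.log ((n : ℝ) / K) ≤ Real.log (n / K : ℕ).succ :=
    Real.log_le_log (by positivity) h1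
  rw [Real.log_div hn0.ne' hK'.ne'] at h2
  have h3 : Real.log ((K : ℝ) ^ 2) ≤ Real.log n := Real.log_le_log (by positivity) hn'
  rw [Real.log_pow] at h3
  push_cast at h3
  linarith

theorem log_succ_le_sum_inv (q : ℕ) :
    Real.log (q + 1 : ℕ) ≤ ∑ m ∈ Finset.Icc 1 q, ((m : ℝ))⁻¹ := by
  have := log_add_one_le_harmonic q
  refine this.trans (le_of_eq ?_)
  rw [harmonic_eq_sum_Icc]; simp

theorem half_sq_le_sum (q : ℕ) : (q : ℝ) ^ 2 / 2 ≤ ∑ D ∈ Finset.Icc 1 q, (D : ℝ) := by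
  induction q with
  | zero => simp
  | succ q ih =>
    rw [Finset.sum_Icc_succ_top (by omega)]
    push_cast
    have : (0 : ℝ) ≤ q := by positivity
    nlinarith

theorem le_div_nat {n : ℕ} (hn : 64 ≤ n) : (n : ℝ) / 64 ≤ (n / 32 : ℕ) := by
  have : n ≤ 64 * (n / 32) := by omega
  have : (n : ℝ) ≤ 64 * (n / 32 : ℕ) := by exact_mod_cast this
  linarith

/-- The scale sum is essentially the sum of `D ^ (2 - d)`: at least of order `n ^ 2`, `n`, `log n`
in the first three dimensions, while for `d ≥ 4` its term `D = 1` suffices. The Green sum matters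
only for `d ≤ 2`, with orders `√n` and `log n`; otherwise it is bounded below by one. -/
theorem IsUnitSymmetric.exists_le_scaleSum_mul_greenSum (h : IsUnitSymmetric μ) (hd : 1 ≤ d)
    (k : ℕ) : ∃ κ : ℝ, 0 < κ ∧ ∃ N : ℕ, ∀ n, N ≤ n → κ * varianceOrder d (k + 2) n ≤
      n * scaleSum d (n / 32) * greenSum μ (n / 4) ^ (2 * k) := by
  have hG0 := greenSum_nonneg (μ := μ)
  have hG1 := one_le_greenSum (μ := μ)
  have hS0 : ∀ q, 0 ≤ scaleSum d q := fun q => Finset.sum_nonneg fun _ _ => sq_nonneg _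
  have hdiv : ∀ n : ℕ, n / 4 / 2 = n / 8 := fun n => by omega
  have hGd := fun n => h.decaySum_le_greenSum (n / 4)
  simp only [hdiv] at hGd
  have hS : ∀ q : ℕ, ∑ D ∈ Finset.Icc 1 q, (2 ^ d : ℝ)⁻¹ * ((D : ℝ) ^ 2 / (D : ℝ) ^ d) ≤
      scaleSum d q := fun q =>
    Finset.sum_le_sum fun D hD => le_mul_decay_sq d (Finset.mem_Icc.1 hD).1
  have hne : ∀ q : ℕ, ∀ D ∈ Finset.Icc 1 q, (D : ℝ) ≠ 0 := fun q D hD =>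
    Nat.cast_ne_zero.2 (by have := (Finset.mem_Icc.1 hD).1; omega)
  set c₀ : ℝ := (4 ^ (d + 1) : ℝ)⁻¹ with hc₀
  have hc₀pos : 0 < c₀ := by positivity
  rcases (by omega : d = 1 ∨ d = 2 ∨ d = 3 ∨ 4 ≤ d) with rfl | rfl | rfl | hd4
  · refine ⟨(4 * 64 ^ 2)⁻¹ * (c₀ ^ 2 / 8) ^ k, by positivity, 1024, fun n hn => ?_⟩
    have hn0 : (0 : ℝ) < n := by exact_mod_cast (by omega : 0 < n)
    have hq : ∀ q : ℕ, (q : ℝ) ^ 2 / 4 ≤ scaleSum 1 q := fun q => by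
      refine le_trans ?_ (hS q)
      have e : ∀ D ∈ Finset.Icc 1 q, (2 ^ 1 : ℝ)⁻¹ * ((D : ℝ) ^ 2 / (D : ℝ) ^ 1) =
          2⁻¹ * (D : ℝ) := fun D hD => by
        have := hne q D hD
        field_simp
      rw [Finset.sum_congr rfl e, ← Finset.mul_sum]
      have hsum := half_sq_le_sum q
      linarith
    have h1 : (4 * 64 ^ 2)⁻¹ * (n : ℝ) ^ 2 ≤ scaleSum 1 (n / 32) := by
      refine le_trans ?_ (hq _)
      have := pow_le_pow_left₀ (by positivity) (le_div_nat (by omega : 64 ≤ n)) 2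
      rw [div_pow] at this
      linarith
    have h2 : c₀ ^ 2 / 8 * n ≤ greenSum μ (n / 4) ^ 2 := by
      have h3 : √((n / 8 : ℕ) + 1 : ℝ) ≤ decaySum 1 (n / 8) := by
        calc _ = ((n / 8 : ℕ) + 1 : ℝ) * decay 1 (n / 8) := by
              rw [decay_one, ← div_eq_mul_inv, Real.div_sqrt]
          _ = ∑ m ∈ Finset.range (n / 8 + 1), decay 1 (n / 8) := by
              rw [Finset.sum_const, Finset.card_range, nsmul_eq_mul]; push_cast; rfl
          _ ≤ _ := Finset.sum_le_sum fun m hm =>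
              decay_antitone 1 (by have := Finset.mem_range.1 hm; omega)
      have h4 : (n : ℝ) / 8 ≤ (n / 8 : ℕ) + 1 := by
        have : n ≤ 8 * (n / 8 + 1) := by omega
        have : (n : ℝ) ≤ 8 * ((n / 8 : ℕ) + 1) := by exact_mod_cast this
        linarith
      calc _ = c₀ ^ 2 * (n / 8) := by ring
        _ ≤ c₀ ^ 2 * √((n / 8 : ℕ) + 1 : ℝ) ^ 2 := by
            rw [Real.sq_sqrt (by positivity)]; gcongr
        _ = (c₀ * √((n / 8 : ℕ) + 1 : ℝ)) ^ 2 := by ring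
        _ ≤ _ := by
            gcongr
            exact (mul_le_mul_of_nonneg_left h3 hc₀pos.le).trans (hGd n)
    have hv : varianceOrder 1 (k + 2) n = (n : ℝ) * n ^ 2 * n ^ k := by
      unfold varianceOrder; rw [if_pos rfl]; ring
    rw [hv, pow_mul]
    calc _ = n * ((4 * 64 ^ 2)⁻¹ * (n : ℝ) ^ 2) * (c₀ ^ 2 / 8 * n) ^ k := by
          rw [mul_pow _ (n : ℝ) k]; ring
      _ ≤ _ := by have := hS0 (n / 32); gcongr
  · refine ⟨256⁻¹ * (c₀ / 2) ^ (2 * k), by positivity, 1024, fun n hn => ?_⟩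
    have hn0 : (0 : ℝ) < n := by exact_mod_cast (by omega : 0 < n)
    have hl0 : 0 ≤ Real.log n := Real.log_natCast_nonneg n
    have h1 : (n : ℝ) / 256 ≤ scaleSum 2 (n / 32) := by
      refine le_trans ?_ (hS _)
      have e : ∀ D ∈ Finset.Icc 1 (n / 32), (2 ^ 2 : ℝ)⁻¹ * ((D : ℝ) ^ 2 / (D : ℝ) ^ 2) =
          4⁻¹ := fun D hD => by
        rw [div_self (pow_ne_zero 2 (hne _ D hD))]; norm_num
      rw [Finset.sum_congr rfl e, Finset.sum_const, Nat.card_Icc, nsmul_eq_mul]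
      have := le_div_nat (by omega : 64 ≤ n)
      rw [Nat.add_sub_cancel]
      linarith
    have h2 : c₀ / 2 * Real.log n ≤ greenSum μ (n / 4) := by
      refine le_trans ?_ (hGd n)
      have h3 := half_log_le_log_div (n := n) (K := 8) (by norm_num) (by omega)
      have h4 : Real.log (n / 8 + 1 : ℕ) ≤ decaySum 2 (n / 8) := by
        have h5 : Real.log (n / 8 + 1 : ℕ) ≤ Real.log (n / 8 + 1 + 1 : ℕ) :=
          Real.log_le_log (by positivity) (by push_cast; linarith)
        refine h5.trans ((log_add_one_le_harmonic (n / 8 + 1)).trans (le_of_eq ?_))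
        simp [harmonic, decaySum, decay_two]
      calc _ = c₀ * (Real.log n / 2) := by ring
        _ ≤ _ := mul_le_mul_of_nonneg_left (h3.trans h4) hc₀pos.le
    rw [varianceOrder_two]
    calc _ = n * ((n : ℝ) / 256) * (c₀ / 2 * Real.log n) ^ (2 * k) := by
          rw [mul_pow]; ring
      _ ≤ _ := by have := hS0 (n / 32); gcongr
  · refine ⟨16⁻¹, by positivity, 1024, fun n hn => ?_⟩
    have h1 : Real.log n / 16 ≤ scaleSum 3 (n / 32) := by
      refine le_trans ?_ (hS _)
      have e : ∀ D ∈ Finset.Icc 1 (n / 32), (2 ^ 3 : ℝ)⁻¹ * ((D : ℝ) ^ 2 / (D : ℝ) ^ 3) =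
          8⁻¹ * (D : ℝ)⁻¹ := fun D hD => by
        have := hne _ D hD
        field_simp; norm_num
      rw [Finset.sum_congr rfl e, ← Finset.mul_sum]
      have h2 := half_log_le_log_div (n := n) (K := 32) (by norm_num) (by omega)
      have h3 := log_succ_le_sum_inv (n / 32)
      simp only [Nat.succ_eq_add_one] at h2
      linarith
    have h2 : 1 ≤ greenSum μ (n / 4) ^ (2 * k) := one_le_pow₀ (hG1 _)
    have hv : varianceOrder 3 (k + 2) n = n * Real.log n := by
      unfold varianceOrder; rw [if_neg (by norm_num), if_neg (by norm_num), if_pos rfl]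
    have := hS0 (n / 32)
    rw [hv]
    calc _ = n * (Real.log n / 16) * 1 := by ring
      _ ≤ _ := by gcongr
  · refine ⟨(2 ^ d)⁻¹, by positivity, 1024, fun n hn => ?_⟩
    have h1 : (2 ^ d : ℝ)⁻¹ ≤ scaleSum d (n / 32) := by
      refine le_trans ?_ (hS _)
      have hmem : 1 ∈ Finset.Icc 1 (n / 32) := Finset.mem_Icc.2 ⟨le_rfl, by omega⟩
      refine le_trans (le_of_eq ?_) (Finset.single_le_sum
        (f := fun D : ℕ => (2 ^ d : ℝ)⁻¹ * ((D : ℝ) ^ 2 / (D : ℝ) ^ d))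
        (fun _ _ => by positivity) hmem)
      simp
    have h2 : 1 ≤ greenSum μ (n / 4) ^ (2 * k) := one_le_pow₀ (hG1 _)
    have hv : varianceOrder d (k + 2) n = n := by
      unfold varianceOrder; rw [if_neg (by omega), if_neg (by omega), if_neg (by omega)]
    have := hS0 (n / 32)
    rw [hv]
    calc _ = n * (2 ^ d : ℝ)⁻¹ * 1 := by ring
      _ ≤ _ := by gcongr

/-- A bound for small `n`: the increments `1` and `2` lie in the gap `[1, 3)`, whose denominator is
`3 - 1 - 1 = 1`. This gap needs `n ≥ 3`, matching the exclusion of `n = 2`. -/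
theorem IsUnitSymmetric.returnProb_two_sq_le_variance (h : IsUnitSymmetric μ) {k n : ℕ}
    (hn : 3 ≤ n) : returnProb μ 2 ^ 2 ≤
      variance (selfIntersection (simpleIncrement d) (k + 2) n) (pathLaw μ) := by
  have h1 := h.le_neg_integral_selfIntersection_mul_dot (k := k) (n := n) (W := {(1, 3)})
    (by norm_num : 1 < 2) (by intro p hp; rw [Finset.mem_singleton] at hp; subst hp; simp; omega)
  have h2 := h.sum_sq_le_variance (memLp_selfIntersection (by omega : 1 ≤ k + 2) n 2)
    (J := {(1, 2)}) (by intro p hp; rw [Finset.mem_singleton] at hp; subst hp; simp)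
  rw [Finset.sum_singleton] at h1 h2
  refine le_trans ?_ h2
  rw [← neg_sq (∫ ω, _ ∂_)]
  have h3 : 1 ≤ greenSum μ (n - 3) ^ k := one_le_pow₀ (one_le_greenSum _)
  have h0 := returnProb_nonneg (μ := μ) 2
  refine pow_le_pow_left₀ h0 (le_trans ?_ h1) 2
  norm_num
  exact le_mul_of_one_le_right h0 h3

theorem IsUnitSymmetric.exists_varianceOrder_le_variance (h : IsUnitSymmetric μ) (hd : 1 ≤ d)
    {α : ℕ} (hα : 2 ≤ α) : ∃ κ : ℝ, 0 < κ ∧ ∀ n : ℕ, 3 ≤ n → κ * varianceOrder d α n ≤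
      variance (selfIntersection (simpleIncrement d) α n) (pathLaw μ) := by
  obtain ⟨k, rfl⟩ : ∃ k, α = k + 2 := ⟨α - 2, by omega⟩
  obtain ⟨κ, hκ, N, hle⟩ := h.exists_le_scaleSum_mul_greenSum hd k
  set c : ℝ := ((4 ^ (d + 1) : ℝ)⁻¹ * (2 ^ ((d : ℝ) / 2))⁻¹ / 4) ^ 2 / 8 with hc
  have hc0 : 0 < c := by positivity
  have hp : 0 < returnProb μ 2 := by
    have := h.decay_le_returnProb 1
    exact lt_of_lt_of_le (mul_pos (by positivity) (decay_pos d 1)) this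
  have hv := varianceOrder_nonneg d (k + 2)
  set V : ℝ := ∑ n ∈ Finset.range N, varianceOrder d (k + 2) n with hV
  have hV0 : 0 ≤ V := Finset.sum_nonneg fun n _ => hv n
  -- The asymptotic bound holds from `N` on; below `N` the order is at most the finite sum `V`, and
  -- the variance is at least a positive constant.
  refine ⟨min (c * κ) (returnProb μ 2 ^ 2 / (1 + V)), by positivity, fun n hn => ?_⟩
  rcases lt_or_ge n N with hlt | hge
  · refine le_trans ?_ (h.returnProb_two_sq_le_variance hn)
    have h1 : varianceOrder d (k + 2) n ≤ V :=
      Finset.single_le_sum (f := fun n => varianceOrder d (k + 2) n) (fun n _ => hv n)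
        (Finset.mem_range.2 hlt)
    calc _ ≤ returnProb μ 2 ^ 2 / (1 + V) * varianceOrder d (k + 2) n :=
          mul_le_mul_of_nonneg_right (min_le_right _ _) (hv n)
      _ ≤ returnProb μ 2 ^ 2 / (1 + V) * (1 + V) := by gcongr; linarith
      _ = _ := by field_simp
  · refine le_trans ?_ (h.scaleSum_le_variance (by omega))
    calc _ ≤ c * κ * varianceOrder d (k + 2) n :=
          mul_le_mul_of_nonneg_right (min_le_left _ _) (hv n)
      _ = c * (κ * varianceOrder d (k + 2) n) := by ring
      _ ≤ _ := mul_le_mul_of_nonneg_left (hle n hge) hc0.le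

end RandomWalk

end

theorem theorem1 (d : ℕ) [NeZero d] (α : ℕ) (hα : 1 ≤ α)
    {Ω : Type*} [MeasurableSpace Ω] (P : MeasureTheory.Measure Ω)
    [MeasureTheory.IsProbabilityMeasure P]
    (X : ℕ → Ω → (Fin d → ℤ)) (hX : RandomWalk.IsIID X P)
    (hgen : RandomWalk.IsGenuinelyDimensional X P) :
    ∃ c C : ℝ, 0 < c ∧ 0 < C ∧ ∀ n : ℕ,
      (n ≠ 2 →
        variance (RandomWalk.selfIntersection X α n) P ≤
          c * variance (RandomWalk.selfIntersection (RandomWalk.simpleIncrement d) α n)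
            (RandomWalk.simpleLaw d)) ∧
      c * variance (RandomWalk.selfIntersection (RandomWalk.simpleIncrement d) α n)
          (RandomWalk.simpleLaw d) ≤
        C * RandomWalk.varianceOrder d α n ∧
      variance (RandomWalk.selfIntersection X α n) P ≤ C * RandomWalk.varianceOrder d α n := by
  have : IsProbabilityMeasure (P.map (X 0)) :=
    Measure.isProbabilityMeasure_map (hX.measurable 0).aemeasurable
  have hd : 1 ≤ d := Nat.pos_of_ne_zero (NeZero.ne d)
  have hlaw : RandomWalk.simpleLaw d = RandomWalk.pathLaw (RandomWalk.simpleStep d) := rfl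
  have hv := RandomWalk.varianceOrder_nonneg d α
  simp only [RandomWalk.variance_eq_variance_pathLaw hX hα, hlaw]
  rcases hα.eq_or_lt with rfl | hα2
  · refine ⟨1, 1, one_pos, one_pos, fun n => ?_⟩
    rw [RandomWalk.variance_eq_zero_of_eq_const (RandomWalk.selfIntersection_one n),
      RandomWalk.variance_eq_zero_of_eq_const (RandomWalk.selfIntersection_one n)]
    simpa using hv n
  obtain ⟨A, hA0, hA⟩ := RandomWalk.exists_variance_le_varianceOrder hd hα2
    ((hgen.isGenuine hX).exists_stepProb_le hd)
  obtain ⟨B, hB0, hB⟩ := RandomWalk.exists_variance_le_varianceOrder hd hα2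
    ((RandomWalk.isGenuine_simpleStep d).exists_stepProb_le hd)
  obtain ⟨κ, hκ, hlow⟩ :=
    (RandomWalk.isUnitSymmetric_simpleStep d).exists_varianceOrder_le_variance hd hα2
  -- Adding one keeps `c` positive when `A = 0`.
  set c : ℝ := (A + 1) / κ with hc
  have hc0 : 0 < c := by positivity
  have hAC : A ≤ A + 1 + c * B := by have := mul_nonneg hc0.le hB0; linarith
  have hBC : c * B ≤ A + 1 + c * B := by linarith
  refine ⟨c, A + 1 + c * B, hc0, by positivity, fun n => ?_⟩
  rcases le_or_gt n 1 with hn | hn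
  · rw [RandomWalk.variance_eq_zero_of_eq_const (RandomWalk.selfIntersection_of_le_one hα hn),
      RandomWalk.variance_eq_zero_of_eq_const (RandomWalk.selfIntersection_of_le_one hα hn)]
    have := mul_nonneg (show 0 ≤ A + 1 + c * B by positivity) (hv n)
    simpa using this
  · refine ⟨fun hn2 => ?_, ?_, (hA n hn).trans (mul_le_mul_of_nonneg_right hAC (hv n))⟩
    · have h1 := mul_le_mul_of_nonneg_left (hlow n (by omega)) hc0.le
      refine (hA n hn).trans (le_trans ?_ h1)
      have h2 : c * (κ * RandomWalk.varianceOrder d α n) =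
          (A + 1) * RandomWalk.varianceOrder d α n := by rw [hc]; field_simp
      rw [h2]
      exact mul_le_mul_of_nonneg_right (by linarith) (hv n)
    · calc _ ≤ c * (B * RandomWalk.varianceOrder d α n) :=
            mul_le_mul_of_nonneg_left (hB n hn) hc0.le
        _ = c * B * RandomWalk.varianceOrder d α n := by ring
        _ ≤ _ := mul_le_mul_of_nonneg_right hBC (hv n)
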